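/- Let $G=\operatorname{Pin}(2)=S^1\cup jS^1\subset\mathbb{H}$, let $\tilde{\mathbb{R}}$ be the real line on which $G$ acts through $G\to G/S^1=\{\pm1\}$, and let $\tilde{\mathbb{C}}=\tilde{\mathbb{R}}\otimes\mathbb{C}$. In the complex representation ring $R(G)$ put $w=1-[\tilde{\mathbb{C}}]$ and $z=2-[\mathbb{H}]$. For a representation $V$, let $V^+$ be its one-point compactification, based at $\infty$. A space of type SWF at level $s\ge 0$ is a pointed finite $G$-CW complex $X$ such that $X^{S^1}$ is $G$-homotopy equivalent (respecting base points) to $(\tilde{\mathbb{R}}^{s})^+$ and $G$ acts freely on $X\setminus X^{S^1}$. For $X$ of type SWF at an even level $2t$, fix a $G$-homotopy equivalence $X^{S^1}\simeq(\tilde{\mathbb{C}}^{t})^+$ as above and let $b\in\tilde K_G(X^{S^1})$ be the pullback of the Bott class of $\tilde{\mathbb{C}}^t$ (so $\tilde K_G(X^{S^1})$ is the free $R(G)$-module on $b$). Let $\iota\colon X^{S^1}\to X$ be the inclusion, and let $\mathfrak{I}(X)\subseteq R(G)$ be the ideal of all $a$ with $a\cdot b\in\iota^*\tilde K_G(X)$,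 so that $\iota^*\tilde K_G(X)=\mathfrak{I}(X)\cdot b$. Define $$k(X)=\min\{k\ge 0 \mid \exists\, x\in\mathfrak{I}(X),\ wx=2^k w\},$$ and call $X$ $K_G$-split if $\mathfrak{I}(X)=(z^k)$ for some $k\ge 0$. **Statement.** Let $X$ and $X'$ be spaces of type SWF at levels $2t$ and $2t'$ respectively, with $t<t'$, and let $f\colon X\to X'$ be a continuous $G$-equivariant map whose restriction $X^G\to (X')^G$ to the $G$-fixed point sets is a homotopy equivalence. Then (for every choice of the equivalences above) the sets defining $k(X)$ and $k(X')$ are non-empty, and $$k(X)+t\le k(X')+t'.$$ If moreover $X$ is $K_G$-split, then $$k(X)+t+1\le k(X')+t'.$$ -/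

import Mathlib

open scoped TensorProduct Quaternion

universe u v w

section EquivariantKTheory

theorem continuous_comp_subtype {W Z : Type*} [TopologicalSpace W] [TopologicalSpace Z]
    {P : Z → Prop} {Q : W → Prop} {f : {z // P z} → ℂ} (hf : Continuous f) {φ : W → Z}
    (hφ : Continuous φ) (h : ∀ w, Q w → P (φ w)) :
    Continuous fun w : {w // Q w} => f ⟨φ w.1, h w.1 w.2⟩ :=
  hf.comp ((hφ.comp continuous_subtype_val).subtype_mk _)

theorem continuous_restrict_subtype {Z : Type*} [TopologicalSpace Z] {P Q : Z → Prop}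
    {f : {z // P z} → ℂ} (hf : Continuous f) (h : ∀ z, Q z → P z) :
    Continuous fun z : {z // Q z} => f ⟨z.1, h z.1 z.2⟩ :=
  hf.comp (continuous_subtype_val.subtype_mk _)

/-- A finite-dimensional complex `G`-vector bundle over the `G`-space `X`, given by its fibres, a
trivialising atlas of local frames with continuous transition functions, and a continuous action
of `G` on the total space which is linear on fibres and covers the action on the base. The local
frame `frame a` is defined on the open neighbourhood `base a` of the point `a`; its length `Idx a`
may depend on `a`, so the rank is only locally constant. -/
structure GVectorBundle (G : Type v) (X : Type u) [Group G] [TopologicalSpace G]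
    [TopologicalSpace X] [MulAction G X] where
  Fiber : X → Type
  [addCommGroupFiber : ∀ x, AddCommGroup (Fiber x)]
  [moduleFiber : ∀ x, Module ℂ (Fiber x)]
  base : X → Set X
  isOpen_base : ∀ a, IsOpen (base a)
  mem_base : ∀ a, a ∈ base a
  Idx : X → Type
  [fintypeIdx : ∀ a, Fintype (Idx a)]
  frame : ∀ a x, x ∈ base a → Module.Basis (Idx a) ℂ (Fiber x)
  continuous_transition : ∀ a b i j, Continuous
    fun x : {x : X // x ∈ base a ∧ x ∈ base b} =>
      (frame b x.1 x.2.2).repr (frame a x.1 x.2.1 i) j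
  act : ∀ (g : G) (x y : X), g • x = y → Fiber x →ₗ[ℂ] Fiber y
  act_one : ∀ x v, act 1 x x (one_smul G x) v = v
  act_mul : ∀ (g h : G) (x y z : X) (hxy : g • x = y) (hyz : h • y = z) (hxz : (h * g) • x = z) v,
    act (h * g) x z hxz v = act h y z hyz (act g x y hxy v)
  continuous_act : ∀ a b i j, Continuous
    fun p : {p : G × X // p.2 ∈ base a ∧ p.1 • p.2 ∈ base b} =>
      (frame b (p.1.1 • p.1.2) p.2.2).repr
        (act p.1.1 p.1.2 (p.1.1 • p.1.2) rfl (frame a p.1.2 p.2.1 i)) j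

namespace GVectorBundle

attribute [instance] addCommGroupFiber moduleFiber fintypeIdx

variable {G : Type v} {X : Type u} {Y : Type w} [Group G] [TopologicalSpace G]
  [TopologicalSpace X] [MulAction G X] [TopologicalSpace Y] [MulAction G Y]

/-- Continuity of a family of linear maps between the fibres of two bundles, expressed by the
coefficients with respect to the local frames. -/
def ContinuousFamily (E F : GVectorBundle G X) (T : ∀ x, E.Fiber x →ₗ[ℂ] F.Fiber x) : Prop :=
  ∀ a b i j, Continuous fun x : {x : X // x ∈ E.base a ∧ x ∈ F.base b} =>
    (F.frame b x.1 x.2.2).repr (T x.1 (E.frame a x.1 x.2.1 i)) j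

theorem ContinuousFamily.comp {E F H : GVectorBundle G X}
    {S : ∀ x, F.Fiber x →ₗ[ℂ] H.Fiber x} {T : ∀ x, E.Fiber x →ₗ[ℂ] F.Fiber x}
    (hS : ContinuousFamily F H S) (hT : ContinuousFamily E F T) :
    ContinuousFamily E H fun x => S x ∘ₗ T x := by
  intro a b i j
  rw [continuous_iff_continuousAt]
  rintro ⟨x₀, hx₀⟩
  let U : Set {x : X // x ∈ E.base a ∧ x ∈ H.base b} := {x | x.1 ∈ F.base x₀}
  have hU : IsOpen U := (F.isOpen_base x₀).preimage continuous_subtype_val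
  have hU₀ : (⟨x₀, hx₀⟩ : {x : X // x ∈ E.base a ∧ x ∈ H.base b}) ∈ U := F.mem_base x₀
  refine (hU.isOpenEmbedding_subtypeVal.continuousAt_iff (x := ⟨_, hU₀⟩)).1 ?_
  refine Continuous.continuousAt ?_
  have key : ∀ x : U, (H.frame b x.1.1 x.1.2.2).repr
      ((S x.1.1 ∘ₗ T x.1.1) (E.frame a x.1.1 x.1.2.1 i)) j =
      ∑ k, (F.frame x₀ x.1.1 x.2).repr (T x.1.1 (E.frame a x.1.1 x.1.2.1 i)) k *
        (H.frame b x.1.1 x.1.2.2).repr (S x.1.1 (F.frame x₀ x.1.1 x.2 k)) j := by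
    intro x
    have := congrArg (fun v => (H.frame b x.1.1 x.1.2.2).repr (S x.1.1 v) j)
      ((F.frame x₀ x.1.1 x.2).sum_repr (T x.1.1 (E.frame a x.1.1 x.1.2.1 i)))
    simp only [map_sum, map_smul, Finsupp.coe_finsetSum, Finset.sum_apply, Finsupp.smul_apply,
      smul_eq_mul] at this
    simpa using this.symm
  refine (continuous_congr key).2 ?_
  refine continuous_finsetSum _ fun k _ => Continuous.mul ?_ ?_
  · exact (hT a x₀ i k).comp (f := fun x : U => ⟨x.1.1, x.1.2.1, x.2⟩) (by fun_prop)
  · exact (hS x₀ b k j).comp (f := fun x : U => ⟨x.1.1, x.2, x.1.2.2⟩) (by fun_prop)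

/-- Isomorphisms of `G`-vector bundles over `X`, covering the identity. -/
structure Iso (E F : GVectorBundle G X) where
  equiv : ∀ x, E.Fiber x ≃ₗ[ℂ] F.Fiber x
  map_act : ∀ (g : G) (x y : X) (h : g • x = y) v,
    equiv y (E.act g x y h v) = F.act g x y h (equiv x v)
  continuous_toFun : ContinuousFamily E F fun x => (equiv x).toLinearMap
  continuous_invFun : ContinuousFamily F E fun x => (equiv x).symm.toLinearMap

def Iso.refl (E : GVectorBundle G X) : Iso E E where
  equiv _ := LinearEquiv.refl ℂ _
  map_act _ _ _ _ _ := rfl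
  continuous_toFun := E.continuous_transition
  continuous_invFun := E.continuous_transition

def Iso.symm {E F : GVectorBundle G X} (e : Iso E F) : Iso F E where
  equiv x := (e.equiv x).symm
  map_act g x y h v := by
    rw [LinearEquiv.symm_apply_eq, e.map_act, LinearEquiv.apply_symm_apply]
  continuous_toFun := e.continuous_invFun
  continuous_invFun := e.continuous_toFun

def Iso.trans {E F H : GVectorBundle G X} (e : Iso E F) (f : Iso F H) : Iso E H where
  equiv x := (e.equiv x).trans (f.equiv x)
  map_act g x y h v := by simp [e.map_act, f.map_act]
  continuous_toFun := f.continuous_toFun.comp e.continuous_toFun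
  continuous_invFun := e.continuous_invFun.comp f.continuous_invFun

variable (G X) in
/-- The isomorphism relation on `G`-vector bundles over `X`. -/
instance isoSetoid : Setoid (GVectorBundle G X) where
  r E F := Nonempty (Iso E F)
  iseqv := ⟨fun E => ⟨Iso.refl E⟩, fun ⟨e⟩ => ⟨e.symm⟩, fun ⟨e⟩ ⟨f⟩ => ⟨e.trans f⟩⟩

/-- A continuous finite-dimensional complex representation `ρ` of `G` on `V`, as the product
bundle `X × V`. -/
noncomputable def ofRep (X : Type u) [TopologicalSpace X] [MulAction G X]
    (V : Type) [AddCommGroup V] [Module ℂ V] [Module.Finite ℂ V]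
    (ρ : G →* (V →ₗ[ℂ] V)) (hρ : ∀ (v : V) (l : V →ₗ[ℂ] ℂ), Continuous fun g => l (ρ g v)) :
    GVectorBundle G X where
  Fiber _ := V
  base _ := Set.univ
  isOpen_base _ := isOpen_univ
  mem_base _ := Set.mem_univ _
  Idx _ := Fin (Module.finrank ℂ V)
  frame _ _ _ := Module.finBasis ℂ V
  continuous_transition _ _ _ _ := continuous_const
  act g _ _ _ := ρ g
  act_one _ v := by simp
  act_mul g h _ _ _ _ _ _ v := by simp
  continuous_act _ _ i j :=
    (hρ (Module.finBasis ℂ V i) ((Module.finBasis ℂ V).coord j)).comp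
      (continuous_fst.comp continuous_subtype_val)

/-- The bundle of rank zero. -/
noncomputable def zero : GVectorBundle G X where
  Fiber _ := PUnit
  base _ := Set.univ
  isOpen_base _ := isOpen_univ
  mem_base _ := Set.mem_univ _
  Idx _ := PEmpty
  frame _ _ _ := Module.Basis.empty PUnit
  continuous_transition _ _ i _ := i.elim
  act _ _ _ _ := LinearMap.id
  act_one _ _ := rfl
  act_mul _ _ _ _ _ _ _ _ _ := rfl
  continuous_act _ _ i _ := i.elim

/-- The trivial line bundle with the trivial action on the fibre. -/
noncomputable def one : GVectorBundle G X where
  Fiber _ := ℂ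
  base _ := Set.univ
  isOpen_base _ := isOpen_univ
  mem_base _ := Set.mem_univ _
  Idx _ := Unit
  frame _ _ _ := Module.Basis.singleton Unit ℂ
  continuous_transition _ _ _ _ := continuous_const
  act _ _ _ _ := LinearMap.id
  act_one _ _ := rfl
  act_mul _ _ _ _ _ _ _ _ _ := rfl
  continuous_act _ _ _ _ := continuous_const

/-- The direct sum of two bundles. -/
noncomputable def sum (E F : GVectorBundle G X) : GVectorBundle G X where
  Fiber x := E.Fiber x × F.Fiber x
  base a := E.base a ∩ F.base a
  isOpen_base a := (E.isOpen_base a).inter (F.isOpen_base a)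
  mem_base a := ⟨E.mem_base a, F.mem_base a⟩
  Idx a := E.Idx a ⊕ F.Idx a
  frame a x hx := (E.frame a x hx.1).prod (F.frame a x hx.2)
  continuous_transition a b := by
    rintro (i | i) (j | j)
    · simpa using (continuous_restrict_subtype (E.continuous_transition a b i j) fun _ h => ⟨h.1.1, h.2.1⟩)
    · simpa using continuous_const
    · simpa using continuous_const
    · simpa using (continuous_restrict_subtype (F.continuous_transition a b i j) fun _ h => ⟨h.1.2, h.2.2⟩)
  act g x y h := (E.act g x y h).prodMap (F.act g x y h)
  act_one x v := by ext <;> simp [E.act_one, F.act_one]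
  act_mul g h x y z hxy hyz hxz v := by
    ext <;> simp [E.act_mul g h x y z hxy hyz hxz, F.act_mul g h x y z hxy hyz hxz]
  continuous_act a b := by
    rintro (i | i) (j | j)
    · simpa using (continuous_restrict_subtype (E.continuous_act a b i j)
        fun (p : G × X) (h : p.2 ∈ E.base a ∩ F.base a ∧ p.1 • p.2 ∈ E.base b ∩ F.base b) =>
          ⟨h.1.1, h.2.1⟩)
    · simpa using continuous_const
    · simpa using continuous_const
    · simpa using (continuous_restrict_subtype (F.continuous_act a b i j)
        fun (p : G × X) (h : p.2 ∈ E.base a ∩ F.base a ∧ p.1 • p.2 ∈ E.base b ∩ F.base b) =>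
          ⟨h.1.2, h.2.2⟩)

/-- The tensor product of two bundles. -/
noncomputable def tensor (E F : GVectorBundle G X) : GVectorBundle G X where
  Fiber x := E.Fiber x ⊗[ℂ] F.Fiber x
  base a := E.base a ∩ F.base a
  isOpen_base a := (E.isOpen_base a).inter (F.isOpen_base a)
  mem_base a := ⟨E.mem_base a, F.mem_base a⟩
  Idx a := E.Idx a × F.Idx a
  frame a x hx := (E.frame a x hx.1).tensorProduct (F.frame a x hx.2)
  continuous_transition a b := by
    rintro ⟨i, k⟩ ⟨j, l⟩
    simp only [Module.Basis.tensorProduct_apply, Module.Basis.tensorProduct_repr_tmul_apply,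
      smul_eq_mul]
    exact (continuous_restrict_subtype (F.continuous_transition a b k l) fun _ h => ⟨h.1.2, h.2.2⟩).mul
      (continuous_restrict_subtype (E.continuous_transition a b i j) fun _ h => ⟨h.1.1, h.2.1⟩)
  act g x y h := TensorProduct.map (E.act g x y h) (F.act g x y h)
  act_one x v := by
    induction v with
    | zero => simp
    | tmul a b => simp [E.act_one, F.act_one]
    | add a b ha hb => simp [ha, hb]
  act_mul g h x y z hxy hyz hxz v := by
    induction v with
    | zero => simp
    | tmul a b => simp [E.act_mul g h x y z hxy hyz hxz, F.act_mul g h x y z hxy hyz hxz]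
    | add a b ha hb => simp [ha, hb]
  continuous_act a b := by
    rintro ⟨i, k⟩ ⟨j, l⟩
    simp only [Module.Basis.tensorProduct_apply, Module.Basis.tensorProduct_repr_tmul_apply,
      smul_eq_mul, TensorProduct.map_tmul]
    exact (continuous_restrict_subtype (F.continuous_act a b k l) fun _ h => ⟨h.1.2, h.2.2⟩).mul
      (continuous_restrict_subtype (E.continuous_act a b i j)
        fun (p : G × X) (h : p.2 ∈ E.base a ∩ F.base a ∧ p.1 • p.2 ∈ E.base b ∩ F.base b) =>
          ⟨h.1.1, h.2.1⟩)

theorem sum_frame_inl (E F : GVectorBundle G X) (a x : X) (hx : x ∈ (sum E F).base a)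
    (i : E.Idx a) : (sum E F).frame a x hx (Sum.inl i) =
      ((E.frame a x hx.1 i, 0) : E.Fiber x × F.Fiber x) := by
  change (E.frame a x hx.1).prod (F.frame a x hx.2) (Sum.inl i) = _
  ext <;> simp

theorem sum_frame_inr (E F : GVectorBundle G X) (a x : X) (hx : x ∈ (sum E F).base a)
    (i : F.Idx a) : (sum E F).frame a x hx (Sum.inr i) =
      ((0, F.frame a x hx.2 i) : E.Fiber x × F.Fiber x) := by
  change (E.frame a x hx.1).prod (F.frame a x hx.2) (Sum.inr i) = _
  ext <;> simp

theorem sum_repr_inl (E F : GVectorBundle G X) (a x : X) (hx : x ∈ (sum E F).base a)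
    (v : E.Fiber x × F.Fiber x) (i : E.Idx a) :
    ((sum E F).frame a x hx).repr v (Sum.inl i) = (E.frame a x hx.1).repr v.1 i := by
  change ((E.frame a x hx.1).prod (F.frame a x hx.2)).repr v (Sum.inl i) = _
  simp

theorem sum_repr_inr (E F : GVectorBundle G X) (a x : X) (hx : x ∈ (sum E F).base a)
    (v : E.Fiber x × F.Fiber x) (i : F.Idx a) :
    ((sum E F).frame a x hx).repr v (Sum.inr i) = (F.frame a x hx.2).repr v.2 i := by
  change ((E.frame a x hx.1).prod (F.frame a x hx.2)).repr v (Sum.inr i) = _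
  simp

theorem tensor_frame (E F : GVectorBundle G X) (a x : X) (hx : x ∈ (tensor E F).base a)
    (i : E.Idx a) (j : F.Idx a) : (tensor E F).frame a x hx (i, j) =
      E.frame a x hx.1 i ⊗ₜ[ℂ] F.frame a x hx.2 j :=
  Module.Basis.tensorProduct_apply _ _ _ _

theorem tensor_repr (E F : GVectorBundle G X) (a x : X) (hx : x ∈ (tensor E F).base a)
    (v : E.Fiber x) (w : F.Fiber x) (i : E.Idx a) (j : F.Idx a) :
    ((tensor E F).frame a x hx).repr (v ⊗ₜ[ℂ] w) (i, j) =
      (F.frame a x hx.2).repr w j * (E.frame a x hx.1).repr v i :=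
  Module.Basis.tensorProduct_repr_tmul_apply _ _ _ _ _ _

theorem ContinuousFamily.sumMap {E E' F F' : GVectorBundle G X}
    {S : ∀ x, E.Fiber x →ₗ[ℂ] E'.Fiber x} {T : ∀ x, F.Fiber x →ₗ[ℂ] F'.Fiber x}
    (hS : ContinuousFamily E E' S) (hT : ContinuousFamily F F' T) :
    ContinuousFamily (sum E F) (sum E' F') fun x => (S x).prodMap (T x) := by
  intro a b
  rintro (i | i) (j | j)
  · refine (continuous_congr fun x => ?_).2
      (continuous_restrict_subtype (hS a b i j) fun _ h => ⟨h.1.1, h.2.1⟩)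
    rw [sum_frame_inl]
    exact sum_repr_inl _ _ _ _ _ _ _
  · refine (continuous_congr fun x => ?_).2 (continuous_const (y := (0 : ℂ)))
    rw [sum_frame_inl]
    refine (sum_repr_inr _ _ _ _ _ _ _).trans ?_
    change (F'.frame b x.1 x.2.2.2).repr (T x.1 0) j = 0
    simp
  · refine (continuous_congr fun x => ?_).2 (continuous_const (y := (0 : ℂ)))
    rw [sum_frame_inr]
    refine (sum_repr_inl _ _ _ _ _ _ _).trans ?_
    change (E'.frame b x.1 x.2.2.1).repr (S x.1 0) j = 0
    simp
  · refine (continuous_congr fun x => ?_).2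
      (continuous_restrict_subtype (hT a b i j) fun _ h => ⟨h.1.2, h.2.2⟩)
    rw [sum_frame_inr]
    exact sum_repr_inr _ _ _ _ _ _ _

theorem ContinuousFamily.tensorMap {E E' F F' : GVectorBundle G X}
    {S : ∀ x, E.Fiber x →ₗ[ℂ] E'.Fiber x} {T : ∀ x, F.Fiber x →ₗ[ℂ] F'.Fiber x}
    (hS : ContinuousFamily E E' S) (hT : ContinuousFamily F F' T) :
    ContinuousFamily (tensor E F) (tensor E' F') fun x => TensorProduct.map (S x) (T x) := by
  intro a b
  rintro ⟨i, k⟩ ⟨j, l⟩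
  refine (continuous_congr fun x => ?_).2
    ((continuous_restrict_subtype (hT a b k l) fun _ h => ⟨h.1.2, h.2.2⟩).mul
      (continuous_restrict_subtype (hS a b i j) fun _ h => ⟨h.1.1, h.2.1⟩))
  rw [tensor_frame]
  exact tensor_repr _ _ _ _ _ _ _ _ _

/-- A family of linear isomorphisms that is compatible with the actions and permutes the vectors
of the local frames is an isomorphism. -/
def Iso.ofFrame {E F : GVectorBundle G X} (e : ∀ x, E.Fiber x ≃ₗ[ℂ] F.Fiber x)
    (map_act : ∀ (g : G) (x y : X) (h : g • x = y) v, e y (E.act g x y h v) = F.act g x y h (e x v))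
    (hb : ∀ a, E.base a = F.base a) (σ : ∀ a, E.Idx a ≃ F.Idx a)
    (he : ∀ a x hx i, e x (E.frame a x hx i) = F.frame a x (hb a ▸ hx) (σ a i)) : Iso E F where
  equiv := e
  map_act := map_act
  continuous_toFun a b i j := by
    refine (continuous_congr fun x => ?_).2
      (continuous_restrict_subtype (F.continuous_transition a b (σ a i) j)
        fun _ h => ⟨hb a ▸ h.1, h.2⟩)
    exact congrArg (fun v => (F.frame b x.1 x.2.2).repr v j) (he a x.1 x.2.1 i)
  continuous_invFun a b i j := by
    refine (continuous_congr fun x => ?_).2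
      (continuous_restrict_subtype (E.continuous_transition a b ((σ a).symm i) j)
        fun _ h => ⟨(hb a).symm ▸ h.1, h.2⟩)
    refine congrArg (fun v => (E.frame b x.1 x.2.2).repr v j) ?_
    refine (LinearEquiv.symm_apply_eq _).2 ?_
    rw [he, Equiv.apply_symm_apply]

def Iso.sumCongr {E E' F F' : GVectorBundle G X} (e : Iso E E') (f : Iso F F') :
    Iso (sum E F) (sum E' F') where
  equiv x := (e.equiv x).prodCongr (f.equiv x)
  map_act g x y h v := Prod.ext (e.map_act g x y h v.1) (f.map_act g x y h v.2)
  continuous_toFun := e.continuous_toFun.sumMap f.continuous_toFun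
  continuous_invFun := e.continuous_invFun.sumMap f.continuous_invFun

noncomputable def Iso.tensorCongr {E E' F F' : GVectorBundle G X} (e : Iso E E') (f : Iso F F') :
    Iso (tensor E F) (tensor E' F') where
  equiv x := TensorProduct.congr (e.equiv x) (f.equiv x)
  map_act g x y h v := by
    refine LinearMap.congr_fun (f := (TensorProduct.congr (e.equiv y) (f.equiv y)).toLinearMap ∘ₗ
      TensorProduct.map (E.act g x y h) (F.act g x y h))
      (g := TensorProduct.map (E'.act g x y h) (F'.act g x y h) ∘ₗ
        (TensorProduct.congr (e.equiv x) (f.equiv x)).toLinearMap) (TensorProduct.ext' ?_) v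
    intro a b
    simp [e.map_act, f.map_act]
  continuous_toFun := e.continuous_toFun.tensorMap f.continuous_toFun
  continuous_invFun := e.continuous_invFun.tensorMap f.continuous_invFun

noncomputable def Iso.sumComm (E F : GVectorBundle G X) : Iso (sum E F) (sum F E) :=
  .ofFrame (fun x => LinearEquiv.prodComm ℂ (E.Fiber x) (F.Fiber x)) (fun _ _ _ _ _ => rfl)
    (fun _ => Set.inter_comm _ _) (fun _ => Equiv.sumComm _ _) <| by
    rintro a x hx (i | i)
    · exact (DFunLike.congr_arg _ (sum_frame_inl E F a x hx i)).trans
        (sum_frame_inr F E a x ⟨hx.2, hx.1⟩ i).symm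
    · exact (DFunLike.congr_arg _ (sum_frame_inr E F a x hx i)).trans
        (sum_frame_inl F E a x ⟨hx.2, hx.1⟩ i).symm

noncomputable def Iso.sumAssoc (E F H : GVectorBundle G X) :
    Iso (sum (sum E F) H) (sum E (sum F H)) :=
  .ofFrame (fun x => LinearEquiv.prodAssoc ℂ (E.Fiber x) (F.Fiber x) (H.Fiber x))
    (fun _ _ _ _ _ => rfl) (fun _ => Set.inter_assoc _ _ _) (fun _ => Equiv.sumAssoc _ _ _) <| by
    rintro a x hx ((i | i) | i)
    · refine (DFunLike.congr_arg _ ((sum_frame_inl (sum E F) H a x hx (Sum.inl i)).trans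
        (congrArg (fun v : E.Fiber x × F.Fiber x => (v, (0 : H.Fiber x)))
          (sum_frame_inl E F a x hx.1 i)))).trans ?_
      exact (sum_frame_inl E (sum F H) a x ⟨hx.1.1, hx.1.2, hx.2⟩ i).symm
    · refine (DFunLike.congr_arg _ ((sum_frame_inl (sum E F) H a x hx (Sum.inr i)).trans
        (congrArg (fun v : E.Fiber x × F.Fiber x => (v, (0 : H.Fiber x)))
          (sum_frame_inr E F a x hx.1 i)))).trans ?_
      exact ((sum_frame_inr E (sum F H) a x ⟨hx.1.1, hx.1.2, hx.2⟩ (Sum.inl i)).trans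
        (congrArg (fun v : F.Fiber x × H.Fiber x => ((0 : E.Fiber x), v))
          (sum_frame_inl F H a x ⟨hx.1.2, hx.2⟩ i))).symm
    · refine (DFunLike.congr_arg _ (sum_frame_inr (sum E F) H a x hx i)).trans ?_
      exact ((sum_frame_inr E (sum F H) a x ⟨hx.1.1, hx.1.2, hx.2⟩ (Sum.inr i)).trans
        (congrArg (fun v : F.Fiber x × H.Fiber x => ((0 : E.Fiber x), v))
          (sum_frame_inr F H a x ⟨hx.1.2, hx.2⟩ i))).symm

noncomputable def Iso.zeroSum (E : GVectorBundle G X) : Iso (sum zero E) E :=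
  .ofFrame (fun x => (LinearEquiv.uniqueProd : (PUnit × E.Fiber x) ≃ₗ[ℂ] E.Fiber x))
    (fun _ _ _ _ _ => rfl) (fun _ => Set.univ_inter _) (fun _ => Equiv.emptySum PEmpty _) <| by
    rintro a x hx (i | i)
    · exact i.elim
    · exact DFunLike.congr_arg _ (sum_frame_inr zero E a x hx i)

noncomputable def Iso.tensorComm (E F : GVectorBundle G X) : Iso (tensor E F) (tensor F E) :=
  .ofFrame (fun x => TensorProduct.comm ℂ (E.Fiber x) (F.Fiber x))
    (fun g x y h v => by
      refine LinearMap.congr_fun (f := (TensorProduct.comm ℂ _ _).toLinearMap ∘ₗ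
        TensorProduct.map (E.act g x y h) (F.act g x y h))
        (g := TensorProduct.map (F.act g x y h) (E.act g x y h) ∘ₗ
          (TensorProduct.comm ℂ _ _).toLinearMap) (TensorProduct.ext' ?_) v
      intro a b
      simp)
    (fun _ => Set.inter_comm _ _) (fun _ => Equiv.prodComm _ _) <| by
    rintro a x hx ⟨i, j⟩
    exact (DFunLike.congr_arg _ (tensor_frame E F a x hx i j)).trans
      (tensor_frame F E a x ⟨hx.2, hx.1⟩ j i).symm

noncomputable def Iso.tensorAssoc (E F H : GVectorBundle G X) :
    Iso (tensor (tensor E F) H) (tensor E (tensor F H)) :=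
  .ofFrame (fun x => TensorProduct.assoc ℂ (E.Fiber x) (F.Fiber x) (H.Fiber x))
    (fun g x y h v => by
      refine LinearMap.congr_fun (f := (TensorProduct.assoc ℂ _ _ _).toLinearMap ∘ₗ
        TensorProduct.map (TensorProduct.map (E.act g x y h) (F.act g x y h)) (H.act g x y h))
        (g := TensorProduct.map (E.act g x y h)
          (TensorProduct.map (F.act g x y h) (H.act g x y h)) ∘ₗ
          (TensorProduct.assoc ℂ _ _ _).toLinearMap) (TensorProduct.ext_threefold ?_) v
      intro a b c
      simp)
    (fun _ => Set.inter_assoc _ _ _) (fun _ => Equiv.prodAssoc _ _ _) <| by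
    rintro a x hx ⟨⟨i, j⟩, k⟩
    refine (DFunLike.congr_arg _ ((tensor_frame (tensor E F) H a x hx (i, j) k).trans
      (congrArg (fun v : E.Fiber x ⊗[ℂ] F.Fiber x => v ⊗ₜ[ℂ] H.frame a x hx.2 k)
        (tensor_frame E F a x hx.1 i j)))).trans ?_
    exact ((tensor_frame E (tensor F H) a x ⟨hx.1.1, hx.1.2, hx.2⟩ i (j, k)).trans
      (congrArg (fun v : F.Fiber x ⊗[ℂ] H.Fiber x => E.frame a x hx.1.1 i ⊗ₜ[ℂ] v)
        (tensor_frame F H a x ⟨hx.1.2, hx.2⟩ j k))).symm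

noncomputable def Iso.oneTensor (E : GVectorBundle G X) : Iso (tensor one E) E :=
  .ofFrame (fun x => TensorProduct.lid ℂ (E.Fiber x))
    (fun g x y h v => by
      refine LinearMap.congr_fun (f := (TensorProduct.lid ℂ _).toLinearMap ∘ₗ
        TensorProduct.map (LinearMap.id : ℂ →ₗ[ℂ] ℂ) (E.act g x y h))
        (g := E.act g x y h ∘ₗ (TensorProduct.lid ℂ _).toLinearMap) (TensorProduct.ext' ?_) v
      intro a b
      simp)
    (fun _ => Set.univ_inter _) (fun _ => Equiv.punitProd _) <| by
    rintro a x hx ⟨i, j⟩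
    refine (DFunLike.congr_arg _ (tensor_frame one E a x hx i j)).trans ?_
    refine (TensorProduct.lid_tmul _ _).trans ?_
    refine (congrArg (fun c : ℂ => c • E.frame a x hx.2 j)
      (Module.Basis.singleton_apply Unit ℂ i)).trans (one_smul _ _)

noncomputable def Iso.zeroTensor (E : GVectorBundle G X) : Iso (tensor zero E) zero where
  equiv x := show (PUnit ⊗[ℂ] E.Fiber x) ≃ₗ[ℂ] PUnit from
    { toFun := fun _ => PUnit.unit
      invFun := fun _ => 0
      map_add' := fun _ _ => rfl
      map_smul' := fun _ _ => rfl
      left_inv := fun v =>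
        LinearMap.congr_fun (f := 0) (g := LinearMap.id)
          (TensorProduct.ext' fun a b => by
            rw [Subsingleton.elim a (0 : PUnit), TensorProduct.zero_tmul, map_zero, map_zero]) v
      right_inv := fun _ => rfl }
  map_act _ _ _ _ _ := rfl
  continuous_toFun _ _ _ j := j.elim
  continuous_invFun _ _ i _ := i.elim

noncomputable def Iso.tensorSum (E F H : GVectorBundle G X) :
    Iso (tensor E (sum F H)) (sum (tensor E F) (tensor E H)) :=
  .ofFrame (fun x => TensorProduct.prodRight ℂ ℂ (E.Fiber x) (F.Fiber x) (H.Fiber x))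
    (fun g x y h v => by
      refine LinearMap.congr_fun (f := (TensorProduct.prodRight ℂ ℂ _ _ _).toLinearMap ∘ₗ
        TensorProduct.map (E.act g x y h) ((F.act g x y h).prodMap (H.act g x y h)))
        (g := LinearMap.prodMap (TensorProduct.map (E.act g x y h) (F.act g x y h))
          (TensorProduct.map (E.act g x y h) (H.act g x y h)) ∘ₗ
          (TensorProduct.prodRight ℂ ℂ _ _ _).toLinearMap) (TensorProduct.ext' ?_) v
      rintro a ⟨b, c⟩
      simp)
    (fun _ => Set.inter_inter_distrib_left _ _ _) (fun _ => Equiv.prodSumDistrib _ _ _) <| by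
    rintro a x hx ⟨i, j | j⟩
    · refine (DFunLike.congr_arg _ ((tensor_frame E (sum F H) a x hx i (Sum.inl j)).trans
        (congrArg (fun v : F.Fiber x × H.Fiber x => E.frame a x hx.1 i ⊗ₜ[ℂ] v)
          (sum_frame_inl F H a x hx.2 j)))).trans ?_
      refine (TensorProduct.prodRight_tmul _ _ _ _ _ _ _).trans ?_
      refine Eq.trans ?_ ((sum_frame_inl (tensor E F) (tensor E H) a x
        ⟨⟨hx.1, hx.2.1⟩, hx.1, hx.2.2⟩ (i, j)).trans
        (congrArg (fun v : E.Fiber x ⊗[ℂ] F.Fiber x => (v, (0 : E.Fiber x ⊗[ℂ] H.Fiber x)))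
          (tensor_frame E F a x ⟨hx.1, hx.2.1⟩ i j))).symm
      rw [TensorProduct.tmul_zero]
    · refine (DFunLike.congr_arg _ ((tensor_frame E (sum F H) a x hx i (Sum.inr j)).trans
        (congrArg (fun v : F.Fiber x × H.Fiber x => E.frame a x hx.1 i ⊗ₜ[ℂ] v)
          (sum_frame_inr F H a x hx.2 j)))).trans ?_
      refine (TensorProduct.prodRight_tmul _ _ _ _ _ _ _).trans ?_
      refine Eq.trans ?_ ((sum_frame_inr (tensor E F) (tensor E H) a x
        ⟨⟨hx.1, hx.2.1⟩, hx.1, hx.2.2⟩ (i, j)).trans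
        (congrArg (fun v : E.Fiber x ⊗[ℂ] H.Fiber x => ((0 : E.Fiber x ⊗[ℂ] F.Fiber x), v))
          (tensor_frame E H a x ⟨hx.1, hx.2.2⟩ i j))).symm
      rw [TensorProduct.tmul_zero]

/-- The pullback of a bundle along an equivariant continuous map. -/
def pullback (f : C(Y, X)) (hf : ∀ (g : G) y, f (g • y) = g • f y) (E : GVectorBundle G X) :
    GVectorBundle G Y where
  Fiber y := E.Fiber (f y)
  base a := f ⁻¹' E.base (f a)
  isOpen_base a := (E.isOpen_base _).preimage f.continuous
  mem_base a := E.mem_base (f a)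
  Idx a := E.Idx (f a)
  frame a y hy := E.frame (f a) (f y) hy
  continuous_transition a b i j :=
    continuous_comp_subtype (E.continuous_transition (f a) (f b) i j) f.continuous fun _ h => h
  act g x y h := E.act g (f x) (f y) (by rw [← hf, h])
  act_one x v := E.act_one (f x) v
  act_mul g h x y z hxy hyz hxz v := E.act_mul g h (f x) (f y) (f z) _ _ _ v
  continuous_act a b i j := by
    have key : ∀ (g : G) (y : Y) (z : X) (hz : g • f y = z) (h₁ : f y ∈ E.base (f a))
        (h₂ : z ∈ E.base (f b)) (h₃ : g • f y ∈ E.base (f b)),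
        (E.frame (f b) z h₂).repr (E.act g (f y) z hz (E.frame (f a) (f y) h₁ i)) j =
        (E.frame (f b) (g • f y) h₃).repr
          (E.act g (f y) (g • f y) rfl (E.frame (f a) (f y) h₁ i)) j := by
      intro g y z hz h₁ h₂ h₃
      subst hz
      rfl
    have hmem : ∀ p : G × Y, p.2 ∈ f ⁻¹' E.base (f a) ∧ p.1 • p.2 ∈ f ⁻¹' E.base (f b) →
        f p.2 ∈ E.base (f a) ∧ p.1 • f p.2 ∈ E.base (f b) :=
      fun p h => ⟨h.1, by rw [← hf]; exact h.2⟩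
    refine (continuous_congr fun p : {p : G × Y //
        p.2 ∈ f ⁻¹' E.base (f a) ∧ p.1 • p.2 ∈ f ⁻¹' E.base (f b)} =>
      key p.1.1 p.1.2 _ (hf _ _).symm p.2.1 p.2.2 (hmem p.1 p.2).2).2 ?_
    exact continuous_comp_subtype (φ := fun p : G × Y => (p.1, f p.2))
      (E.continuous_act (f a) (f b) i j) (by fun_prop) hmem

def Iso.pullback {f : C(Y, X)} {hf : ∀ (g : G) y, f (g • y) = g • f y} {E F : GVectorBundle G X}
    (e : Iso E F) : Iso (E.pullback f hf) (F.pullback f hf) where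
  equiv y := e.equiv (f y)
  map_act g x y h v := e.map_act g (f x) (f y) (by rw [← hf, h]) v
  continuous_toFun a b i j :=
    continuous_comp_subtype (e.continuous_toFun (f a) (f b) i j) f.continuous fun _ h => h
  continuous_invFun a b i j :=
    continuous_comp_subtype (e.continuous_invFun (f a) (f b) i j) f.continuous fun _ h => h

/-- Isomorphism classes of `G`-vector bundles over `X`. -/
def IsoClass (G : Type v) (X : Type u) [Group G] [TopologicalSpace G]
    [TopologicalSpace X] [MulAction G X] : Type (max u v 1) :=
  Quotient (isoSetoid G X)

noncomputable instance : Zero (IsoClass G X) := ⟨Quotient.mk _ zero⟩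

noncomputable instance : One (IsoClass G X) := ⟨Quotient.mk _ one⟩

noncomputable instance : Add (IsoClass G X) :=
  ⟨Quotient.map₂ sum fun _ _ ⟨e⟩ _ _ ⟨f⟩ => ⟨e.sumCongr f⟩⟩

noncomputable instance : Mul (IsoClass G X) :=
  ⟨Quotient.map₂ tensor fun _ _ ⟨e⟩ _ _ ⟨f⟩ => ⟨e.tensorCongr f⟩⟩

/-- Isomorphism classes form a commutative semiring under direct sum and tensor product. -/
noncomputable instance : CommSemiring (IsoClass G X) where
  nsmul := nsmulRec
  add_assoc := by
    rintro ⟨E⟩ ⟨F⟩ ⟨H⟩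
    exact Quotient.sound ⟨Iso.sumAssoc E F H⟩
  zero_add := by
    rintro ⟨E⟩
    exact Quotient.sound ⟨Iso.zeroSum E⟩
  add_zero := by
    rintro ⟨E⟩
    exact Quotient.sound ⟨(Iso.sumComm E zero).trans (Iso.zeroSum E)⟩
  add_comm := by
    rintro ⟨E⟩ ⟨F⟩
    exact Quotient.sound ⟨Iso.sumComm E F⟩
  mul_assoc := by
    rintro ⟨E⟩ ⟨F⟩ ⟨H⟩
    exact Quotient.sound ⟨Iso.tensorAssoc E F H⟩
  one_mul := by
    rintro ⟨E⟩
    exact Quotient.sound ⟨Iso.oneTensor E⟩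
  mul_one := by
    rintro ⟨E⟩
    exact Quotient.sound ⟨(Iso.tensorComm E one).trans (Iso.oneTensor E)⟩
  mul_comm := by
    rintro ⟨E⟩ ⟨F⟩
    exact Quotient.sound ⟨Iso.tensorComm E F⟩
  zero_mul := by
    rintro ⟨E⟩
    exact Quotient.sound ⟨Iso.zeroTensor E⟩
  mul_zero := by
    rintro ⟨E⟩
    exact Quotient.sound ⟨(Iso.tensorComm E zero).trans (Iso.zeroTensor E)⟩
  left_distrib := by
    rintro ⟨E⟩ ⟨F⟩ ⟨H⟩
    exact Quotient.sound ⟨Iso.tensorSum E F H⟩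
  right_distrib := by
    rintro ⟨E⟩ ⟨F⟩ ⟨H⟩
    exact Quotient.sound ⟨(Iso.tensorComm (sum E F) H).trans
      ((Iso.tensorSum H E F).trans ((Iso.tensorComm H E).sumCongr (Iso.tensorComm H F)))⟩

/-- Pullback of isomorphism classes of bundles. -/
def IsoClass.pullback (f : C(Y, X)) (hf : ∀ (g : G) y, f (g • y) = g • f y) :
    IsoClass G X →+* IsoClass G Y where
  toFun := Quotient.map (GVectorBundle.pullback f hf) fun _ _ ⟨e⟩ => ⟨e.pullback⟩
  map_zero' := rfl
  map_one' := rfl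
  map_add' := by rintro ⟨E⟩ ⟨F⟩; rfl
  map_mul' := by rintro ⟨E⟩ ⟨F⟩; rfl

end GVectorBundle

end EquivariantKTheory

section GrothendieckRing

/-- The Grothendieck ring of a commutative semiring: the Grothendieck group of its additive
monoid, with the multiplication extended biadditively. -/
def GrothendieckRing (M : Type u) [CommSemiring M] : Type u := Algebra.GrothendieckAddGroup M

namespace GrothendieckRing

variable {M : Type u} {N : Type v} [CommSemiring M] [CommSemiring N]

instance : AddCommGroup (GrothendieckRing M) :=
  inferInstanceAs (AddCommGroup (Algebra.GrothendieckAddGroup M))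

/-- The class of an element of the semiring. -/
def of : M →+ GrothendieckRing M := Algebra.GrothendieckAddGroup.of

/-- The extension of an additive map to the Grothendieck group. -/
noncomputable def liftHom {A : Type*} [AddCommGroup A] (f : M →+ A) : GrothendieckRing M →+ A :=
  Algebra.GrothendieckAddGroup.lift f

theorem liftHom_of {A : Type*} [AddCommGroup A] (f : M →+ A) (m : M) : liftHom f (of m) = f m :=
  DFunLike.congr_fun (Algebra.GrothendieckAddGroup.lift.symm_apply_apply f) m

theorem exists_sub (x : GrothendieckRing M) : ∃ a b : M, x = of a - of b := by
  induction x using AddLocalization.ind with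
  | H y =>
    refine ⟨y.1, y.2, Eq.symm ?_⟩
    refine (Algebra.GrothendieckAddGroup.mk_sub_mk y.1 y.2 0 0).trans ?_
    congr 1
    · simp
    · ext; simp

noncomputable def mulHom : GrothendieckRing M →+ GrothendieckRing M →+ GrothendieckRing M :=
  liftHom
    { toFun := fun m => liftHom (of.comp (AddMonoidHom.mulLeft m))
      map_zero' := by
        ext x
        obtain ⟨a, b, rfl⟩ := exists_sub x
        simp [liftHom_of]
      map_add' := fun m n => by
        ext x
        obtain ⟨a, b, rfl⟩ := exists_sub x
        simp [liftHom_of, add_mul]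
        abel }

noncomputable instance : Mul (GrothendieckRing M) := ⟨fun x y => mulHom x y⟩

instance : One (GrothendieckRing M) := ⟨of 1⟩

theorem of_mul_of (a b : M) : of a * of b = of (a * b) := by
  change mulHom (of a) (of b) = _
  simp [mulHom, liftHom_of]

theorem add_mul' (x y z : GrothendieckRing M) : (x + y) * z = x * z + y * z := by
  change mulHom (x + y) z = mulHom x z + mulHom y z
  simp

theorem mul_add' (x y z : GrothendieckRing M) : x * (y + z) = x * y + x * z := by
  change mulHom x (y + z) = mulHom x y + mulHom x z
  simp

theorem sub_mul' (x y z : GrothendieckRing M) : (x - y) * z = x * z - y * z := by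
  change mulHom (x - y) z = mulHom x z - mulHom y z
  simp

theorem mul_sub' (x y z : GrothendieckRing M) : x * (y - z) = x * y - x * z := by
  change mulHom x (y - z) = mulHom x y - mulHom x z
  simp

noncomputable instance : CommRing (GrothendieckRing M) where
  __ := (inferInstance : AddCommGroup (GrothendieckRing M))
  left_distrib := mul_add'
  right_distrib := add_mul'
  zero_mul x := by change mulHom 0 x = 0; simp
  mul_zero x := by change mulHom x 0 = 0; simp
  mul_assoc x y z := by
    obtain ⟨a, b, rfl⟩ := exists_sub x
    obtain ⟨c, d, rfl⟩ := exists_sub y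
    obtain ⟨e, f, rfl⟩ := exists_sub z
    simp only [sub_mul', mul_sub', of_mul_of, mul_assoc]
  one_mul x := by
    obtain ⟨a, b, rfl⟩ := exists_sub x
    change of 1 * _ = _
    simp only [mul_sub', of_mul_of, one_mul]
  mul_one x := by
    obtain ⟨a, b, rfl⟩ := exists_sub x
    change _ * of 1 = _
    simp only [sub_mul', of_mul_of, mul_one]
  mul_comm x y := by
    obtain ⟨a, b, rfl⟩ := exists_sub x
    obtain ⟨c, d, rfl⟩ := exists_sub y
    simp only [sub_mul', mul_sub', of_mul_of, mul_comm c, mul_comm d]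
    abel

/-- The ring homomorphism induced by a homomorphism of semirings. -/
noncomputable def map (f : M →+* N) : GrothendieckRing M →+* GrothendieckRing N where
  __ := liftHom (of.comp f.toAddMonoidHom)
  map_one' := (liftHom_of _ _).trans (congrArg of f.map_one)
  map_mul' x y := by
    change liftHom _ (x * y) = liftHom _ x * liftHom _ y
    obtain ⟨a, b, rfl⟩ := exists_sub x
    obtain ⟨c, d, rfl⟩ := exists_sub y
    simp only [sub_mul, mul_sub, of_mul_of, map_sub, liftHom_of, AddMonoidHom.comp_apply,
      RingHom.toAddMonoidHom_eq_coe, AddMonoidHom.coe_coe, map_mul]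

theorem map_of (f : M →+* N) (m : M) : map f (of m) = of (f m) := liftHom_of _ _

end GrothendieckRing

end GrothendieckRing

section EquivariantKTheory

variable {G : Type v} {X : Type u} {Y : Type w} [Group G] [TopologicalSpace G]
  [TopologicalSpace X] [MulAction G X] [TopologicalSpace Y] [MulAction G Y]

/-- `K_G(X)`: the Grothendieck ring of `G`-equivariant complex vector bundles on `X`. -/
abbrev KG (G : Type v) (X : Type u) [Group G] [TopologicalSpace G]
    [TopologicalSpace X] [MulAction G X] : Type (max u v 1) :=
  GrothendieckRing (GVectorBundle.IsoClass G X)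

/-- The class of a bundle in `K_G(X)`. -/
noncomputable def KG.mk (E : GVectorBundle G X) : KG G X := GrothendieckRing.of (Quotient.mk _ E)

/-- The representation ring `R(G) = K_G(pt)`. -/
abbrev RepRing (G : Type v) [Group G] [TopologicalSpace G] : Type (max v 1) := KG G Unit

/-- Continuous equivariant maps. -/
structure GMap (G : Type v) (X : Type u) (Y : Type w) [Group G] [TopologicalSpace X]
    [MulAction G X] [TopologicalSpace Y] [MulAction G Y] extends C(X, Y) where
  map_smul' : ∀ (g : G) (x : X), toFun (g • x) = g • toFun x

instance : CoeFun (GMap G X Y) fun _ => X → Y := ⟨fun f => f.toContinuousMap⟩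

/-- The ring homomorphism `f^* : K_G(Y) → K_G(X)`. -/
noncomputable def KG.pullback (f : GMap G X Y) : KG G Y →+* KG G X :=
  GrothendieckRing.map (GVectorBundle.IsoClass.pullback f.toContinuousMap f.map_smul')

/-- The map `X → pt`. -/
def GMap.toPoint (G : Type v) (X : Type u) [Group G] [TopologicalSpace X] [MulAction G X] :
    GMap G X Unit :=
  ⟨⟨fun _ => (), continuous_const⟩, fun _ _ => rfl⟩

/-- The inclusion of a fixed point. -/
def GMap.ofFixedPoint (x₀ : X) (h₀ : ∀ g : G, g • x₀ = x₀) : GMap G Unit X :=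
  ⟨⟨fun _ => x₀, continuous_const⟩, fun g _ => (h₀ g).symm⟩

/-- `f` and `f'` are homotopic through equivariant maps. -/
def GMap.Homotopic (f f' : GMap G X Y) : Prop :=
  ∃ H : ContinuousMap.Homotopy f.toContinuousMap f'.toContinuousMap,
    ∀ (s : unitInterval) (g : G) (x : X), H (s, g • x) = g • H (s, x)

def GMap.id (G : Type v) (X : Type u) [Group G] [TopologicalSpace X] [MulAction G X] :
    GMap G X X :=
  ⟨ContinuousMap.id X, fun _ _ => rfl⟩

def GMap.comp {Z : Type*} [TopologicalSpace Z] [MulAction G Z] (f' : GMap G Y Z)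
    (f : GMap G X Y) : GMap G X Z :=
  ⟨f'.toContinuousMap.comp f.toContinuousMap, fun g x =>
    (congrArg f' (f.map_smul' g x)).trans (f'.map_smul' g (f x))⟩

/-- `f` is a `G`-homotopy equivalence. -/
def GMap.IsHomotopyEquiv (f : GMap G X Y) : Prop :=
  ∃ f' : GMap G Y X, (f'.comp f).Homotopic (GMap.id G X) ∧ (f.comp f').Homotopic (GMap.id G Y)

/-- The map induced on the `G`-fixed points. -/
def GMap.onFixedPoints (f : GMap G X Y) :
    C(MulAction.fixedPoints G X, MulAction.fixedPoints G Y) where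
  toFun x := ⟨f x.1, fun g => (f.map_smul' g x.1).symm.trans (congrArg f (x.2 g))⟩
  continuous_toFun := (f.continuous.comp continuous_subtype_val).subtype_mk _

end EquivariantKTheory

section Pin2

/-- The group `Pin(2) = S¹ ∪ j S¹`, as a subgroup of the unit quaternions: `a + b i` lies in `S¹`
and `j (a + b i) = a j - b k` lies in `j S¹`. -/
def pinTwo : Subgroup (Metric.sphere (0 : ℍ[ℝ]) 1) where
  carrier := {q | (q.1.imJ = 0 ∧ q.1.imK = 0) ∨ (q.1.re = 0 ∧ q.1.imI = 0)}
  one_mem' := Or.inl ⟨rfl, rfl⟩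
  mul_mem' := by
    rintro p q (⟨h₁, h₂⟩ | ⟨h₁, h₂⟩) (⟨h₃, h₄⟩ | ⟨h₃, h₄⟩) <;> simp [h₁, h₂, h₃, h₄]
  inv_mem' := by
    rintro p (⟨h₁, h₂⟩ | ⟨h₁, h₂⟩) <;> simp [Quaternion.inv_def, h₁, h₂]

/-- The type of elements of `Pin(2)`. -/
def Pin2 : Type := pinTwo

noncomputable instance : Group Pin2 := inferInstanceAs (Group pinTwo)

instance : TopologicalSpace Pin2 := inferInstanceAs (TopologicalSpace pinTwo)

instance : IsTopologicalGroup Pin2 := inferInstanceAs (IsTopologicalGroup pinTwo)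

namespace Pin2

/-- The unit quaternion underlying an element of `Pin(2)`. -/
def toQuat (g : Pin2) : ℍ[ℝ] := g.1.1

theorem continuous_toQuat : Continuous toQuat :=
  continuous_subtype_val.comp continuous_subtype_val

theorem toQuat_mul (g h : Pin2) : (g * h).toQuat = g.toQuat * h.toQuat := rfl

theorem toQuat_one : (1 : Pin2).toQuat = 1 := rfl

theorem normSq_toQuat (g : Pin2) :
    g.toQuat.re ^ 2 + g.toQuat.imI ^ 2 + g.toQuat.imJ ^ 2 + g.toQuat.imK ^ 2 = 1 := by
  have h : ‖g.toQuat‖ = 1 := by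
    have := g.1.2
    rwa [mem_sphere_zero_iff_norm] at this
  rw [← Quaternion.normSq_def', Quaternion.normSq_eq_norm_mul_self, h, one_mul]

/-- The condition for an element of `Pin(2)` to lie in `S¹`. -/
def InCircle (g : Pin2) : Prop := g.toQuat.imJ = 0 ∧ g.toQuat.imK = 0

theorem not_inCircle {g : Pin2} (h : ¬ g.InCircle) : g.toQuat.re = 0 ∧ g.toQuat.imI = 0 :=
  g.2.resolve_left h

theorem inCircle_mul (g h : Pin2) : (g * h).InCircle ↔ (g.InCircle ↔ h.InCircle) := by
  have hn := normSq_toQuat (g * h)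
  by_cases hg : g.InCircle <;> by_cases hh : h.InCircle
  · simp only [hg, hh, iff_true]
    exact ⟨by simp [toQuat_mul, hg.1, hg.2, hh.1, hh.2], by simp [toQuat_mul, hg.1, hg.2, hh.1, hh.2]⟩
  · simp only [hg, hh, iff_false, not_true]
    rintro ⟨h₁, h₂⟩
    have := not_inCircle hh
    simp [h₁, h₂] at hn
    simp [toQuat_mul, hg.1, hg.2, this.1, this.2] at hn
  · simp only [hg, hh, iff_true, iff_false]
    rintro ⟨h₁, h₂⟩
    have := not_inCircle hg
    simp [h₁, h₂] at hn
    simp [toQuat_mul, hh.1, hh.2, this.1, this.2] at hn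
  · simp only [hg, hh, iff_true]
    have h₁ := not_inCircle hg
    have h₂ := not_inCircle hh
    exact ⟨by simp [toQuat_mul, h₁.1, h₁.2, h₂.1, h₂.2], by simp [toQuat_mul, h₁.1, h₁.2, h₂.1, h₂.2]⟩

open Classical in
/-- The projection `Pin(2) → {±1}` with kernel `S¹`. -/
noncomputable def sign : Pin2 →* ℤˣ where
  toFun g := if g.InCircle then 1 else -1
  map_one' := if_pos ⟨rfl, rfl⟩
  map_mul' g h := by
    by_cases hg : g.InCircle <;> by_cases hh : h.InCircle <;> simp [inCircle_mul, hg, hh]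

/-- The sign as a complex number. -/
noncomputable def signC (g : Pin2) : ℂ := ((sign g : ℤ) : ℂ)

theorem signC_mul (g h : Pin2) : signC (g * h) = signC g * signC h := by simp [signC]

theorem signC_one : signC 1 = 1 := by simp [signC]

theorem signC_mul_self (g : Pin2) : signC g * signC g = 1 := by
  rw [signC, ← Int.cast_mul, Int.units_coe_mul_self, Int.cast_one]

theorem continuous_signC : Continuous signC := by
  have h : ∀ g : Pin2, signC g = ((g.toQuat.re ^ 2 + g.toQuat.imI ^ 2 - g.toQuat.imJ ^ 2 -
      g.toQuat.imK ^ 2 : ℝ) : ℂ) := by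
    intro g
    have hn := normSq_toQuat g
    by_cases hg : g.InCircle
    · have h₁ : signC g = 1 := by simp [signC, sign, hg]
      rw [h₁, ← Complex.ofReal_one, Complex.ofReal_inj]
      rw [hg.1, hg.2] at hn ⊢
      linarith
    · have h₁ : signC g = -1 := by simp [signC, sign, hg]
      have h₂ := not_inCircle hg
      rw [h₁, ← Complex.ofReal_one, ← Complex.ofReal_neg, Complex.ofReal_inj]
      rw [h₂.1, h₂.2] at hn ⊢
      linarith
  refine (continuous_congr h).2 (Complex.continuous_ofReal.comp ?_)
  have := continuous_toQuat
  have h₁ := Quaternion.continuous_re.comp this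
  have h₂ := Quaternion.continuous_imI.comp this
  have h₃ := Quaternion.continuous_imJ.comp this
  have h₄ := Quaternion.continuous_imK.comp this
  exact (((h₁.pow 2).add (h₂.pow 2)).sub (h₃.pow 2)).sub (h₄.pow 2)

end Pin2

/-- The complex representation of `Pin(2)` on `V` through the sign. -/
noncomputable def signRepHom (V : Type*) [AddCommGroup V] [Module ℂ V] :
    Pin2 →* (V →ₗ[ℂ] V) where
  toFun g := Pin2.signC g • LinearMap.id
  map_one' := by rw [Pin2.signC_one, one_smul]; rfl
  map_mul' g h := by
    ext v
    change Pin2.signC (g * h) • v = Pin2.signC g • Pin2.signC h • v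
    rw [Pin2.signC_mul, mul_smul]

theorem continuous_signRepHom {V : Type*} [AddCommGroup V] [Module ℂ V] (v : V) (l : V →ₗ[ℂ] ℂ) :
    Continuous fun g => l (signRepHom V g v) := by
  have h : ∀ g, l (signRepHom V g v) = Pin2.signC g * l v := fun g => by simp [signRepHom]
  exact (continuous_congr h).2 (Pin2.continuous_signC.mul continuous_const)

/-- The quaternions, as a complex vector space through right multiplication. -/
def QuatRep : Type := ℍ[ℝ]

noncomputable instance : AddCommGroup QuatRep := inferInstanceAs (AddCommGroup ℍ[ℝ])

noncomputable instance : SMul ℂ QuatRep :=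
  ⟨fun z (q : ℍ[ℝ]) => (q * Quaternion.coeComplex z : ℍ[ℝ])⟩

theorem QuatRep.smul_def (z : ℂ) (q : ℍ[ℝ]) :
    @HSMul.hSMul ℂ QuatRep QuatRep _ z q = (q * Quaternion.coeComplex z : ℍ[ℝ]) := rfl

noncomputable instance : Module ℂ QuatRep where
  one_smul (q : ℍ[ℝ]) := by
    rw [QuatRep.smul_def, Quaternion.coeComplex_one, mul_one]
  mul_smul z w (q : ℍ[ℝ]) := by
    rw [QuatRep.smul_def, QuatRep.smul_def, QuatRep.smul_def, mul_comm z w,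
      Quaternion.coeComplex_mul, mul_assoc]
  smul_zero z := zero_mul (Quaternion.coeComplex z)
  smul_add z (p q : ℍ[ℝ]) := add_mul p q (Quaternion.coeComplex z)
  add_smul z w (q : ℍ[ℝ]) := by
    rw [QuatRep.smul_def, QuatRep.smul_def, QuatRep.smul_def, Quaternion.coeComplex_add, mul_add]
    rfl
  zero_smul (q : ℍ[ℝ]) := by
    rw [QuatRep.smul_def, Quaternion.coeComplex_zero, mul_zero]
    rfl

theorem QuatRep.ofReal_smul (r : ℝ) (q : ℍ[ℝ]) :
    @HSMul.hSMul ℂ QuatRep QuatRep _ (r : ℂ) q = (r • q : ℍ[ℝ]) := by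
  rw [QuatRep.smul_def, Quaternion.coeComplex_coe, Quaternion.mul_coe_eq_smul]

instance : Module.Finite ℂ QuatRep := by
  obtain ⟨s, hs⟩ := (Module.finite_def (R := ℝ) (M := ℍ[ℝ])).1 inferInstance
  have key : ∀ S : Submodule ℂ QuatRep, (∀ p : ℍ[ℝ], p ∈ s → S.carrier p) →
      ∀ p : ℍ[ℝ], p ∈ Submodule.span ℝ (s : Set ℍ[ℝ]) → S.carrier p := by
    intro S hS p hp
    induction hp using Submodule.span_induction with
    | mem x hx => exact hS x hx
    | zero => exact S.zero_mem
    | add x y _ _ hx hy => exact S.add_mem hx hy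
    | smul r x _ hx =>
      have := S.smul_mem (r : ℂ) hx
      rwa [QuatRep.ofReal_smul] at this
  let s' : Finset QuatRep := s
  refine Module.finite_def.2 ⟨s', eq_top_iff.2 fun q _ => ?_⟩
  exact key (Submodule.span ℂ (s' : Set QuatRep))
    (fun p hp => Submodule.subset_span (s := (s' : Set QuatRep)) hp) q (hs ▸ Submodule.mem_top)

/-- The representation of `Pin(2)` on the quaternions by left multiplication. -/
noncomputable def quatRepHom : Pin2 →* (QuatRep →ₗ[ℂ] QuatRep) where
  toFun g :=
    { toFun := fun (q : ℍ[ℝ]) => (g.toQuat * q : ℍ[ℝ])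
      map_add' := fun (p q : ℍ[ℝ]) => mul_add g.toQuat p q
      map_smul' := fun z (q : ℍ[ℝ]) => (mul_assoc g.toQuat q (Quaternion.coeComplex z)).symm }
  map_one' := LinearMap.ext fun (q : ℍ[ℝ]) => one_mul q
  map_mul' g h := LinearMap.ext fun (q : ℍ[ℝ]) => mul_assoc g.toQuat h.toQuat q

theorem continuous_quatRepHom (v : QuatRep) (l : QuatRep →ₗ[ℂ] ℂ) :
    Continuous fun g => l (quatRepHom g v) := by
  let l' : ℍ[ℝ] →ₗ[ℝ] ℂ :=
    { toFun := fun q => l q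
      map_add' := fun p q => l.map_add p q
      map_smul' := fun r q => by
        rw [← QuatRep.ofReal_smul]
        exact (l.map_smul (r : ℂ) q).trans (by simp) }
  have h : Continuous l' := LinearMap.continuous_of_finiteDimensional l'
  exact h.comp (Pin2.continuous_toQuat.mul (continuous_const (y := (id v : ℍ[ℝ]))))

/-- `w = 1 - [ℂ̃]` in `R(Pin(2))`. -/
noncomputable def wClass : RepRing Pin2 :=
  1 - KG.mk (GVectorBundle.ofRep Unit ℂ (signRepHom ℂ) continuous_signRepHom)

/-- `z = 2 - [ℍ]` in `R(Pin(2))`. -/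
noncomputable def zClass : RepRing Pin2 :=
  2 - KG.mk (GVectorBundle.ofRep Unit QuatRep quatRepHom continuous_quatRepHom)

end Pin2

section Koszul

open scoped ComplexConjugate
open OnePoint

/-- The even (`i = 0`) or odd (`i = 1`) part of the exterior algebra of `ℂ^t`. -/
abbrev extPart (t : ℕ) (i : ZMod 2) : Submodule ℂ (ExteriorAlgebra ℂ (Fin t → ℂ)) :=
  CliffordAlgebra.evenOdd 0 i

theorem exteriorAlgebra_finite (t : ℕ) : Module.Finite ℂ (ExteriorAlgebra ℂ (Fin t → ℂ)) := by
  have hbot : ∀ n, t < n → (⋀[ℂ]^n (Fin t → ℂ)) = ⊥ := by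
    intro n hn
    have h := exteriorPower.finrank_eq (R := ℂ) (M := Fin t → ℂ) n
    rw [Module.finrank_fin_fun, Nat.choose_eq_zero_of_lt hn] at h
    exact Submodule.finrank_eq_zero.1 h
  have htop : (⨆ n ∈ Finset.range (t + 1), ⋀[ℂ]^n (Fin t → ℂ)) = ⊤ := by
    rw [eq_top_iff, ← CliffordAlgebra.iSup_ι_range_eq_top (0 : QuadraticForm ℂ (Fin t → ℂ))]
    refine iSup_le fun n => ?_
    by_cases hn : t < n
    · exact (hbot n hn).le.trans bot_le
    · exact le_iSup₂_of_le (f := fun n (_ : n ∈ Finset.range (t + 1)) => ⋀[ℂ]^n (Fin t → ℂ)) n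
        (Finset.mem_range.2 (by omega)) le_rfl
  rw [Module.finite_def, ← htop]
  exact Submodule.fg_biSup _ _ fun n _ => Module.Finite.iff_fg.1 inferInstance

instance (t : ℕ) (i : ZMod 2) : Module.Finite ℂ (extPart t i) :=
  haveI := exteriorAlgebra_finite t
  inferInstance

/-- The Hermitian dual `u ↦ ∑ conj(vₖ) uₖ` of a vector. -/
noncomputable def hermDual {t : ℕ} (v : Fin t → ℂ) : Module.Dual ℂ (Fin t → ℂ) :=
  ∑ k, conj (v k) • LinearMap.proj k

/-- The operator `x ↦ v ∧ x + v^* ⌟ x` on the exterior algebra of `ℂ^t`. -/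
noncomputable def koszul {t : ℕ} (v : Fin t → ℂ) :
    ExteriorAlgebra ℂ (Fin t → ℂ) →ₗ[ℂ] ExteriorAlgebra ℂ (Fin t → ℂ) :=
  LinearMap.mulLeft ℂ (ExteriorAlgebra.ι ℂ v) + CliffordAlgebra.contractLeft (hermDual v)

/-- `|v|²`. -/
noncomputable def herm {t : ℕ} (v : Fin t → ℂ) : ℂ := hermDual v v

theorem herm_ne_zero {t : ℕ} {v : Fin t → ℂ} (hv : v ≠ 0) : herm v ≠ 0 := by
  have h : herm v = ((∑ k, ‖v k‖ ^ 2 : ℝ) : ℂ) := by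
    simp [herm, hermDual, Complex.conj_mul']
  obtain ⟨k, hk⟩ := Function.ne_iff.1 hv
  rw [h, Complex.ofReal_ne_zero]
  refine (Finset.sum_pos' (fun _ _ => by positivity) ⟨k, Finset.mem_univ k, ?_⟩).ne'
  have : v k ≠ 0 := hk
  positivity

theorem koszul_koszul {t : ℕ} (v : Fin t → ℂ) (x : ExteriorAlgebra ℂ (Fin t → ℂ)) :
    koszul v (koszul v x) = herm v • x := by
  have h₁ : ∀ y : ExteriorAlgebra ℂ (Fin t → ℂ),
      koszul v y = ExteriorAlgebra.ι ℂ v * y + CliffordAlgebra.contractLeft (hermDual v) y :=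
    fun _ => rfl
  have h₂ : ∀ y : ExteriorAlgebra ℂ (Fin t → ℂ),
      CliffordAlgebra.contractLeft (hermDual v) (ExteriorAlgebra.ι ℂ v * y) =
      herm v • y - ExteriorAlgebra.ι ℂ v * CliffordAlgebra.contractLeft (hermDual v) y :=
    fun y => CliffordAlgebra.contractLeft_ι_mul (hermDual v) v y
  rw [h₁, h₁, map_add, h₂, mul_add, ← mul_assoc, ExteriorAlgebra.ι_sq_zero, zero_mul,
    CliffordAlgebra.contractLeft_contractLeft]
  abel

theorem ι_mul_mem_extPart {t : ℕ} (v : Fin t → ℂ) {i j : ZMod 2} (hij : i + 1 = j)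
    {x : ExteriorAlgebra ℂ (Fin t → ℂ)} (hx : x ∈ extPart t i) :
    ExteriorAlgebra.ι ℂ v * x ∈ extPart t j := by
  have h := SetLike.mul_mem_graded (A := extPart t)
    (CliffordAlgebra.ι_mem_evenOdd_one (0 : QuadraticForm ℂ (Fin t → ℂ)) v) hx
  rwa [add_comm, hij] at h

theorem contractLeft_mem_extPart {t : ℕ} (d : Module.Dual ℂ (Fin t → ℂ)) {i j : ZMod 2}
    (hij : i + 1 = j) {x : ExteriorAlgebra ℂ (Fin t → ℂ)} (hx : x ∈ extPart t i) :
    CliffordAlgebra.contractLeft d x ∈ extPart t j := by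
  have step : ∀ (i j : ZMod 2) (_ : i + 1 = j) (m₁ m₂ : Fin t → ℂ)
      (x : ExteriorAlgebra ℂ (Fin t → ℂ)), x ∈ extPart t i →
      CliffordAlgebra.contractLeft d x ∈ extPart t j →
      CliffordAlgebra.contractLeft d
        (CliffordAlgebra.ι (0 : QuadraticForm ℂ (Fin t → ℂ)) m₁ * CliffordAlgebra.ι 0 m₂ * x) ∈
        extPart t j := by
    intro i j hij m₁ m₂ x hx hdx
    have hji : j + 1 = i := by
      rw [← hij, add_assoc, show (1 : ZMod 2) + 1 = 0 from rfl, add_zero]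
    rw [mul_assoc, CliffordAlgebra.contractLeft_ι_mul, CliffordAlgebra.contractLeft_ι_mul]
    refine Submodule.sub_mem _ (Submodule.smul_mem _ _ (ι_mul_mem_extPart m₂ hij hx)) ?_
    refine ι_mul_mem_extPart m₁ hij (Submodule.sub_mem _ (Submodule.smul_mem _ _ hx) ?_)
    exact ι_mul_mem_extPart m₂ hji hdx
  obtain rfl | rfl : i = 0 ∨ i = 1 := by clear hx hij; revert i; decide
  · obtain rfl : j = 1 := by rw [← hij, zero_add]
    induction x, hx using CliffordAlgebra.even_induction with
    | algebraMap r =>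
      rw [CliffordAlgebra.contractLeft_algebraMap]
      exact Submodule.zero_mem _
    | add x y hx hy ihx ihy => rw [map_add]; exact Submodule.add_mem _ ihx ihy
    | ι_mul_ι_mul m₁ m₂ x hx ih => exact step 0 1 rfl m₁ m₂ x hx ih
  · obtain rfl : j = 0 := by rw [← hij]; rfl
    induction x, hx using CliffordAlgebra.odd_induction with
    | ι v =>
      rw [CliffordAlgebra.contractLeft_ι]
      exact SetLike.algebraMap_mem_graded _ _
    | add x y hx hy ihx ihy => rw [map_add]; exact Submodule.add_mem _ ihx ihy
    | ι_mul_ι_mul m₁ m₂ x hx ih => exact step 1 0 rfl m₁ m₂ x hx ih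

theorem koszul_mem {t : ℕ} (v : Fin t → ℂ) {i j : ZMod 2} (hij : i + 1 = j)
    {x : ExteriorAlgebra ℂ (Fin t → ℂ)} (hx : x ∈ extPart t i) : koszul v x ∈ extPart t j :=
  Submodule.add_mem _ (ι_mul_mem_extPart v hij hx) (contractLeft_mem_extPart _ hij hx)

/-- The restriction of `koszul v` to a map from one parity to the other. -/
noncomputable def koszulPart {t : ℕ} (v : Fin t → ℂ) {i j : ZMod 2} (hij : i + 1 = j) :
    extPart t i →ₗ[ℂ] extPart t j :=
  (koszul v).restrict fun _ hx => koszul_mem v hij hx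

/-- The map `x ↦ v ∧ x + v^* ⌟ x` from the even to the odd part. -/
noncomputable def koszulEO {t : ℕ} (v : Fin t → ℂ) : extPart t 0 →ₗ[ℂ] extPart t 1 :=
  koszulPart v (zero_add 1)

/-- The map `x ↦ v ∧ x + v^* ⌟ x` from the odd to the even part. -/
noncomputable def koszulOE {t : ℕ} (v : Fin t → ℂ) : extPart t 1 →ₗ[ℂ] extPart t 0 :=
  koszulPart v (show (1 : ZMod 2) + 1 = 0 from rfl)

/-- For `v ≠ 0`, the isomorphism `x ↦ v ∧ x + v^* ⌟ x` from the even to the odd part. -/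
noncomputable def koszulEquiv {t : ℕ} (v : Fin t → ℂ) (hv : v ≠ 0) :
    extPart t 0 ≃ₗ[ℂ] extPart t 1 :=
  LinearEquiv.ofLinearMap (koszulEO v) ((herm v)⁻¹ • koszulOE v)
    (LinearMap.ext fun y => Subtype.ext <| by
      change koszul v ((herm v)⁻¹ • koszul v y.1) = y.1
      rw [LinearMap.map_smul, koszul_koszul, smul_smul, inv_mul_cancel₀ (herm_ne_zero hv),
        one_smul])
    (LinearMap.ext fun x => Subtype.ext <| by
      change (herm v)⁻¹ • koszul v (koszul v x.1) = x.1
      rw [koszul_koszul, smul_smul, inv_mul_cancel₀ (herm_ne_zero hv), one_smul])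

theorem koszul_add {t : ℕ} (u v : Fin t → ℂ) : koszul (u + v) = koszul u + koszul v := by
  have h : hermDual (u + v) = hermDual u + hermDual v := by
    simp [hermDual, add_smul, Finset.sum_add_distrib]
  refine LinearMap.ext fun x => ?_
  change ExteriorAlgebra.ι ℂ (u + v) * x + CliffordAlgebra.contractLeft (hermDual (u + v)) x =
    (ExteriorAlgebra.ι ℂ u * x + CliffordAlgebra.contractLeft (hermDual u) x) +
    (ExteriorAlgebra.ι ℂ v * x + CliffordAlgebra.contractLeft (hermDual v) x)
  rw [h, map_add, map_add, add_mul, LinearMap.add_apply]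
  abel

theorem koszul_smul {t : ℕ} {c : ℂ} (hc : conj c = c) (v : Fin t → ℂ) :
    koszul (c • v) = c • koszul v := by
  have h : hermDual (c • v) = c • hermDual v := by
    simp [hermDual, mul_smul, Finset.smul_sum, hc]
  refine LinearMap.ext fun x => ?_
  change ExteriorAlgebra.ι ℂ (c • v) * x + CliffordAlgebra.contractLeft (hermDual (c • v)) x =
    c • (ExteriorAlgebra.ι ℂ v * x + CliffordAlgebra.contractLeft (hermDual v) x)
  rw [h, LinearMap.map_smul, LinearMap.map_smul, smul_add, smul_mul_assoc, LinearMap.smul_apply]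

theorem continuous_koszul {t : ℕ} {i j : ZMod 2} (hij : i + 1 = j) (x : extPart t i)
    (l : extPart t j →ₗ[ℂ] ℂ) : Continuous fun v : Fin t → ℂ => l (koszulPart v hij x) := by
  let l' : (Fin t → ℂ) →ₗ[ℝ] ℂ :=
    { toFun := fun v => l (koszulPart v hij x)
      map_add' := by
        intro u v
        rw [← l.map_add]
        refine congrArg l (Subtype.ext ?_)
        exact LinearMap.congr_fun (koszul_add u v) x.1
      map_smul' := by
        intro r v
        refine (congrArg l (Subtype.ext ?_)).trans (l.map_smul (r : ℂ) (koszulPart v hij x))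
        exact LinearMap.congr_fun (koszul_smul (Complex.conj_ofReal r) v) x.1 }
  exact LinearMap.continuous_of_finiteDimensional l'

theorem continuous_herm {t : ℕ} : Continuous (herm : (Fin t → ℂ) → ℂ) := by
  have h : ∀ v : Fin t → ℂ, herm v = ∑ k, conj (v k) * v k := fun v => by simp [herm, hermDual]
  exact (continuous_congr h).2 (by fun_prop)

end Koszul

section Spheres

open OnePoint

/-- The real vector space `V`, on which `Pin(2)` acts through the sign: `ℝ̃^s` for `V = ℝ^s` and
`ℂ̃^t` for `V = ℂ^t`. -/
def SignRep (V : Type) : Type := V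

instance (V : Type) [AddCommGroup V] : AddCommGroup (SignRep V) := inferInstanceAs (AddCommGroup V)

instance (V : Type) [TopologicalSpace V] : TopologicalSpace (SignRep V) :=
  inferInstanceAs (TopologicalSpace V)

noncomputable instance (V : Type) [AddCommGroup V] : MulAction Pin2 (SignRep V) where
  smul g v := (Pin2.sign g : ℤ) • v
  one_smul v := by
    change (Pin2.sign 1 : ℤ) • v = v
    simp
  mul_smul g h v := by
    change (Pin2.sign (g * h) : ℤ) • v = (Pin2.sign g : ℤ) • (Pin2.sign h : ℤ) • v
    rw [map_mul, Units.val_mul, mul_smul]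

/-- The one-point compactification of the sign representation on `V`; the base point is `∞`. -/
abbrev RepSphere (V : Type) : Type := OnePoint (SignRep V)

noncomputable instance (V : Type) [AddCommGroup V] : MulAction Pin2 (RepSphere V) where
  smul g x := x.map (g • ·)
  one_smul x := by
    cases x using OnePoint.rec with
    | infty => rfl
    | coe v => exact congrArg OnePoint.some (one_smul Pin2 v)
  mul_smul g h x := by
    cases x using OnePoint.rec with
    | infty => rfl
    | coe v => exact congrArg OnePoint.some (mul_smul g h v)

theorem RepSphere.smul_infty {V : Type} [AddCommGroup V] (g : Pin2) :
    g • (∞ : RepSphere V) = ∞ := rfl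

theorem RepSphere.smul_some {V : Type} [AddCommGroup V] (g : Pin2) (v : SignRep V) :
    g • (OnePoint.some v : RepSphere V) = OnePoint.some (g • v) := rfl

namespace Bott

/-- The parity of the fibre of the Bott bundle: even over `ℂ^t`, odd at `∞`. -/
def parity {t : ℕ} : RepSphere (Fin t → ℂ) → ZMod 2
  | OnePoint.infty => 1
  | OnePoint.some _ => 0

theorem parity_smul {t : ℕ} (g : Pin2) (x : RepSphere (Fin t → ℂ)) : parity (g • x) = parity x := by
  cases x using OnePoint.rec <;> rfl

/-- The domain of the chart at a point: `ℂ^t` for finite points, the complement of `0` for `∞`. -/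
def base {t : ℕ} : RepSphere (Fin t → ℂ) → Set (RepSphere (Fin t → ℂ))
  | OnePoint.infty => {OnePoint.some 0}ᶜ
  | OnePoint.some _ => {∞}ᶜ

/-- A basis of the even part. -/
noncomputable def evenBasis (t : ℕ) :
    Module.Basis (Fin (Module.finrank ℂ (extPart t 0))) ℂ (extPart t 0) :=
  Module.finBasis ℂ (extPart t 0)

/-- A basis of the odd part. -/
noncomputable def oddBasis (t : ℕ) :
    Module.Basis (Fin (Module.finrank ℂ (extPart t 1))) ℂ (extPart t 1) :=
  Module.finBasis ℂ (extPart t 1)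

/-- The local frames: a constant basis of the even part over `ℂ^t`; and near `∞` a constant basis
of the odd part, transported to the fibres over `v ≠ 0` by the inverse of `v ∧ · + v^* ⌟ ·`. -/
noncomputable def frame {t : ℕ} : ∀ a x : RepSphere (Fin t → ℂ), x ∈ base a →
    Module.Basis (Fin (Module.finrank ℂ (extPart t (parity a)))) ℂ (extPart t (parity x))
  | OnePoint.some _, OnePoint.some _, _ => evenBasis t
  | OnePoint.some _, OnePoint.infty, h => (h rfl).elim
  | OnePoint.infty, OnePoint.some v, h =>
    (oddBasis t).map (koszulEquiv v fun hv => h (congrArg OnePoint.some hv)).symm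
  | OnePoint.infty, OnePoint.infty, _ => oddBasis t

/-- `g` acts as the identity between the even fibres over `ℂ^t`, and by its sign on the odd fibre
at `∞`. -/
noncomputable def act {t : ℕ} (g : Pin2) : ∀ x y : RepSphere (Fin t → ℂ), g • x = y →
    (extPart t (parity x) →ₗ[ℂ] extPart t (parity y))
  | OnePoint.some _, OnePoint.some _, _ => LinearMap.id
  | OnePoint.infty, OnePoint.infty, _ => signRepHom (extPart t 1) g
  | OnePoint.some _, OnePoint.infty, h => (OnePoint.coe_ne_infty _ h).elim
  | OnePoint.infty, OnePoint.some _, h => (OnePoint.infty_ne_coe _ h).elim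

theorem continuous_elim {t : ℕ} {W : Type*} [TopologicalSpace W]
    {φ : W → RepSphere (Fin t → ℂ)} (hφ : Continuous φ) (hne : ∀ w, φ w ≠ ∞)
    {F : (Fin t → ℂ) → ℂ} (hF : ∀ w (v : Fin t → ℂ), φ w = OnePoint.some v → ContinuousAt F v) :
    Continuous fun w => (φ w).elim 0 F := by
  rw [continuous_iff_continuousAt]
  intro w
  obtain ⟨v, hv⟩ := OnePoint.ne_infty_iff_exists.1 (hne w)
  refine ContinuousAt.comp (f := φ) (g := fun x : RepSphere (Fin t → ℂ) => x.elim 0 F) ?_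
    hφ.continuousAt
  rw [← hv]
  exact OnePoint.continuousAt_coe.2 (hF w v hv.symm)

/-- The matrix coefficients of the clutching map. -/
noncomputable def coefEO {t : ℕ} (i : Fin (Module.finrank ℂ (extPart t 0)))
    (j : Fin (Module.finrank ℂ (extPart t 1))) (v : Fin t → ℂ) : ℂ :=
  (oddBasis t).coord j (koszulEO v (evenBasis t i))

/-- The matrix coefficients of the inverse of the clutching map. -/
noncomputable def coefOE {t : ℕ} (i : Fin (Module.finrank ℂ (extPart t 1)))
    (j : Fin (Module.finrank ℂ (extPart t 0))) (v : Fin t → ℂ) : ℂ :=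
  (evenBasis t).coord j ((herm v)⁻¹ • koszulOE v (oddBasis t i))

theorem continuousAt_coefEO {t : ℕ} (i : Fin (Module.finrank ℂ (extPart t 0)))
    (j : Fin (Module.finrank ℂ (extPart t 1))) (v : Fin t → ℂ) : ContinuousAt (coefEO i j) v :=
  (continuous_koszul (zero_add 1) (evenBasis t i) ((oddBasis t).coord j)).continuousAt

theorem continuousAt_coefOE {t : ℕ} (i : Fin (Module.finrank ℂ (extPart t 1)))
    (j : Fin (Module.finrank ℂ (extPart t 0))) {v : Fin t → ℂ} (hv : v ≠ 0) :
    ContinuousAt (coefOE i j) v := by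
  have h : ∀ v : Fin t → ℂ, coefOE i j v =
      (herm v)⁻¹ * (evenBasis t).coord j (koszulOE v (oddBasis t i)) :=
    fun v => LinearMap.map_smul _ _ _
  refine ContinuousAt.congr ?_ (Filter.Eventually.of_forall fun v => (h v).symm)
  exact (continuous_herm.continuousAt.inv₀ (herm_ne_zero hv)).mul
    (continuous_koszul (show (1 : ZMod 2) + 1 = 0 from rfl) (oddBasis t i)
      ((evenBasis t).coord j)).continuousAt

theorem isOpen_base {t : ℕ} (a : RepSphere (Fin t → ℂ)) : IsOpen (base a) := by
  cases a using OnePoint.rec with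
  | infty =>
    have h := (OnePoint.isClosed_image_coe.2
      ⟨isClosed_singleton (X := Fin t → ℂ) (x := 0), isCompact_singleton⟩).isOpen_compl
    rwa [Set.image_singleton] at h
  | coe v => exact OnePoint.isClosed_infty.isOpen_compl

theorem mem_base {t : ℕ} (a : RepSphere (Fin t → ℂ)) : a ∈ base a := by
  cases a using OnePoint.rec with
  | infty => exact OnePoint.infty_ne_coe _
  | coe v => exact OnePoint.coe_ne_infty _

theorem sign_smul_eq {t : ℕ} (g : Pin2) (v : Fin t → ℂ) :
    (g • (show SignRep (Fin t → ℂ) from v) : SignRep (Fin t → ℂ)) = Pin2.signC g • v :=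
  (Int.cast_smul_eq_zsmul ℂ _ v).symm

theorem koszulEO_sign {t : ℕ} (g : Pin2) (v : Fin t → ℂ) (x : extPart t 0) :
    koszulEO (Pin2.signC g • v) x = Pin2.signC g • koszulEO v x := by
  refine Subtype.ext ?_
  exact LinearMap.congr_fun (koszul_smul (by simp [Pin2.signC]) v) x.1

theorem koszulEO_symm {t : ℕ} (v : Fin t → ℂ) (hv : v ≠ 0) (x : extPart t 1) :
    koszulEO v ((koszulEquiv v hv).symm x) = x :=
  (koszulEquiv v hv).apply_symm_apply x

theorem repr_infty_smul {t : ℕ} (g : Pin2) (v : SignRep (Fin t → ℂ))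
    (h : g • (OnePoint.some v : RepSphere (Fin t → ℂ)) ∈ base ∞) (x : extPart t 0)
    (j : Fin (Module.finrank ℂ (extPart t 1))) :
    (frame ∞ (g • (OnePoint.some v : RepSphere (Fin t → ℂ))) h).repr
      (act g (OnePoint.some v) (g • (OnePoint.some v : RepSphere (Fin t → ℂ))) rfl x) j =
      Pin2.signC g * (oddBasis t).repr (koszulEO v x) j := by
  have h₁ : koszulEO (g • v : SignRep (Fin t → ℂ)) x = Pin2.signC g • koszulEO v x :=
    (congrArg (fun u => koszulEO u x) (sign_smul_eq g v)).trans (koszulEO_sign g v x)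
  refine (congrArg (fun u => (oddBasis t).repr u j) h₁).trans ?_
  rw [LinearEquiv.map_smul]
  rfl

theorem continuous_transition {t : ℕ} (a b : RepSphere (Fin t → ℂ)) (i j) : Continuous
    fun x : {x : RepSphere (Fin t → ℂ) // x ∈ base a ∧ x ∈ base b} =>
      (frame b x.1 x.2.2).repr (frame a x.1 x.2.1 i) j := by
  cases a using OnePoint.rec with
  | infty =>
    cases b using OnePoint.rec with
    | infty =>
      refine (continuous_congr ?_).2
        (continuous_const (y := Finsupp.single (M := ℂ) i 1 j))
      rintro ⟨x, h₁, h₂⟩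
      exact DFunLike.congr_fun ((frame ∞ x h₁).repr_self i) j
    | coe b =>
      refine (continuous_congr ?_).2 (continuous_elim (φ := Subtype.val) (F := coefOE i j)
        continuous_subtype_val (fun w => w.2.2) fun w v hw =>
          continuousAt_coefOE i j fun hv => w.2.1 (hw.trans (congrArg OnePoint.some hv)))
      rintro ⟨x, h₁, h₂⟩
      cases x using OnePoint.rec with
      | infty => exact (h₂ rfl).elim
      | coe v => rfl
  | coe a =>
    cases b using OnePoint.rec with
    | infty =>
      refine (continuous_congr ?_).2 (continuous_elim (φ := Subtype.val) (F := coefEO i j)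
        continuous_subtype_val (fun w => w.2.1) fun w v hw =>
          continuousAt_coefEO i j v)
      rintro ⟨x, h₁, h₂⟩
      cases x using OnePoint.rec with
      | infty => exact (h₁ rfl).elim
      | coe v => rfl
    | coe b =>
      refine (continuous_congr ?_).2
        (continuous_const (y := Finsupp.single (M := ℂ) i 1 j))
      rintro ⟨x, h₁, h₂⟩
      cases x using OnePoint.rec with
      | infty => exact (h₁ rfl).elim
      | coe v => exact DFunLike.congr_fun ((evenBasis t).repr_self i) j

theorem act_one {t : ℕ} (x : RepSphere (Fin t → ℂ)) (v : extPart t (parity x)) :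
    act 1 x x (one_smul Pin2 x) v = v := by
  cases x using OnePoint.rec with
  | infty => exact DFunLike.congr_fun (map_one (signRepHom (extPart t 1))) v
  | coe x => rfl

theorem act_mul {t : ℕ} (g h : Pin2) (x y z : RepSphere (Fin t → ℂ)) (hxy : g • x = y)
    (hyz : h • y = z) (hxz : (h * g) • x = z) (v : extPart t (parity x)) :
    act (h * g) x z hxz v = act h y z hyz (act g x y hxy v) := by
  subst hxy hyz
  cases x using OnePoint.rec with
  | infty => exact DFunLike.congr_fun (map_mul (signRepHom (extPart t 1)) h g) v
  | coe x => rfl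

theorem continuous_act {t : ℕ} (a b : RepSphere (Fin t → ℂ)) (i j) : Continuous
    fun p : {p : Pin2 × RepSphere (Fin t → ℂ) // p.2 ∈ base a ∧ p.1 • p.2 ∈ base b} =>
      (frame b (p.1.1 • p.1.2) p.2.2).repr
        (act p.1.1 p.1.2 (p.1.1 • p.1.2) rfl (frame a p.1.2 p.2.1 i)) j := by
  have hs : Continuous
      fun p : {p : Pin2 × RepSphere (Fin t → ℂ) // p.2 ∈ base a ∧ p.1 • p.2 ∈ base b} =>
        Pin2.signC p.1.1 :=
    Pin2.continuous_signC.comp (continuous_fst.comp continuous_subtype_val)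
  have hφ : Continuous
      fun p : {p : Pin2 × RepSphere (Fin t → ℂ) // p.2 ∈ base a ∧ p.1 • p.2 ∈ base b} => p.1.2 :=
    continuous_snd.comp continuous_subtype_val
  cases a using OnePoint.rec with
  | infty =>
    cases b using OnePoint.rec with
    | infty =>
      refine (continuous_congr ?_).2
        (hs.mul (continuous_const (y := Finsupp.single (M := ℂ) i 1 j)))
      rintro ⟨⟨g, x⟩, h₁, h₂⟩
      cases x using OnePoint.rec with
      | infty =>
        refine (DFunLike.congr_fun ((oddBasis t).repr.map_smul (Pin2.signC g)
          (oddBasis t i)) j).trans ?_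
        exact congrArg (fun c : Fin (Module.finrank ℂ (extPart t 1)) →₀ ℂ => Pin2.signC g * c j)
          ((oddBasis t).repr_self i)
      | coe v =>
        refine (repr_infty_smul g v h₂ _ j).trans ?_
        refine congrArg (fun c : Fin (Module.finrank ℂ (extPart t 1)) →₀ ℂ => Pin2.signC g * c j) ?_
        exact (congrArg (oddBasis t).repr (koszulEO_symm v (fun hv => h₁ (congrArg OnePoint.some hv))
          (oddBasis t i))).trans
          ((oddBasis t).repr_self i)
    | coe b =>
      refine (continuous_congr ?_).2 (continuous_elim (F := coefOE i j) hφ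
        (fun w hw => w.2.2 (by rw [hw]; rfl)) fun w v hw =>
          continuousAt_coefOE i j fun hv => w.2.1 (hw.trans (congrArg OnePoint.some hv)))
      rintro ⟨⟨g, x⟩, h₁, h₂⟩
      cases x using OnePoint.rec with
      | infty => exact (h₂ rfl).elim
      | coe v => rfl
  | coe a =>
    cases b using OnePoint.rec with
    | infty =>
      refine (continuous_congr ?_).2 (hs.mul (continuous_elim (F := coefEO i j) hφ
        (fun w => w.2.1) fun w v hw => continuousAt_coefEO i j v))
      rintro ⟨⟨g, x⟩, h₁, h₂⟩
      cases x using OnePoint.rec with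
      | infty => exact (h₁ rfl).elim
      | coe v =>
        exact repr_infty_smul g v h₂ _ j
    | coe b =>
      refine (continuous_congr ?_).2
        (continuous_const (y := Finsupp.single (M := ℂ) i 1 j))
      rintro ⟨⟨g, x⟩, h₁, h₂⟩
      cases x using OnePoint.rec with
      | infty => exact (h₁ rfl).elim
      | coe v => exact DFunLike.congr_fun ((evenBasis t).repr_self i) j

/-- The bundle on `(ℂ̃^t)^+` obtained by clutching the even part of the exterior algebra of `ℂ̃^t`,
over `ℂ̃^t`, with the odd part, over a neighbourhood of `∞`, through `v ∧ · + v^* ⌟ ·`. -/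
noncomputable def bundle (t : ℕ) : GVectorBundle Pin2 (RepSphere (Fin t → ℂ)) where
  Fiber x := extPart t (parity x)
  base := base
  isOpen_base := isOpen_base
  mem_base := mem_base
  Idx a := Fin (Module.finrank ℂ (extPart t (parity a)))
  frame := frame
  continuous_transition := continuous_transition
  act := act
  act_one := act_one
  act_mul := act_mul
  continuous_act := continuous_act

end Bott

/-- The Bott class `b ∈ K_G((ℂ̃^t)^+)`: the class of the Koszul complex of `ℂ̃^t`, that is, the
difference of the clutched bundle and the product bundle with fibre the odd exterior powers of
`ℂ̃^t`. It restricts to `0` at `∞` and to `∑ (-1)^i [Λ^i ℂ̃^t]` at the origin. -/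
noncomputable def bottClass (t : ℕ) : KG Pin2 (RepSphere (Fin t → ℂ)) :=
  KG.mk (Bott.bundle t) -
    KG.mk (GVectorBundle.ofRep _ (extPart t 1) (signRepHom (extPart t 1)) continuous_signRepHom)

end Spheres

section SWF

open OnePoint

/-- A finite `G`-CW structure on a Hausdorff `G`-space `X`: finitely many equivariant cells
`G/H × D^n`, with `H ⊆ G` closed, with equivariant characteristic maps that are injective on
`G/H × int D^n`, whose open cells partition `X`, and such that the boundary of every `n`-cell is
contained in the union of the cells of dimension less than `n`. (For finitely many cells and a
compact group the topology of `X` is then automatically the one of the attached cells.) -/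
structure FiniteGCWStructure (G : Type v) (X : Type u) [Group G] [TopologicalSpace G]
    [TopologicalSpace X] [MulAction G X] where
  Cell : Type
  [finite : Finite Cell]
  dim : Cell → ℕ
  stab : Cell → Subgroup G
  isClosed_stab : ∀ c, IsClosed (stab c : Set G)
  char : ∀ c, C((G ⧸ stab c) × Metric.closedBall (0 : EuclideanSpace ℝ (Fin (dim c))) 1, X)
  char_smul : ∀ c (g : G) p d, char c (g • p, d) = g • char c (p, d)
  injective : ∀ c p d p' d', ‖d.1‖ < 1 → ‖d'.1‖ < 1 → char c (p, d) = char c (p', d') →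
    p = p' ∧ d = d'
  disjoint : ∀ c c' p d p' d', ‖d.1‖ < 1 → ‖d'.1‖ < 1 → char c (p, d) = char c' (p', d') → c = c'
  covers : ∀ x, ∃ c p d, ‖d.1‖ < 1 ∧ char c (p, d) = x
  boundary : ∀ c p d, ‖d.1‖ = 1 → ∃ c' p' d', dim c' < dim c ∧ char c' (p', d') = char c (p, d)

/-- The fixed point set `X^{S¹}` of the circle subgroup of `Pin(2)`. -/
def CircleFixed (X : Type u) [MulAction Pin2 X] : Type u :=
  {x : X // ∀ g : Pin2, g.sign = 1 → g • x = x}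

instance (X : Type u) [MulAction Pin2 X] [TopologicalSpace X] : TopologicalSpace (CircleFixed X) :=
  inferInstanceAs (TopologicalSpace {x : X // ∀ g : Pin2, g.sign = 1 → g • x = x})

instance (X : Type u) [MulAction Pin2 X] : MulAction Pin2 (CircleFixed X) where
  smul g x := ⟨g • x.1, fun h hh => by
    have h₁ : (g⁻¹ * h * g).sign = 1 := by simp [hh]
    have h₂ := x.2 _ h₁
    rw [mul_assoc, mul_smul, inv_smul_eq_iff, mul_smul] at h₂
    exact h₂⟩
  one_smul x := Subtype.ext (one_smul Pin2 x.1)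
  mul_smul g h x := Subtype.ext (mul_smul g h x.1)

variable {X : Type u} [TopologicalSpace X] [MulAction Pin2 X]

/-- The inclusion `X^{S¹} → X`. -/
def CircleFixed.incl (X : Type u) [TopologicalSpace X] [MulAction Pin2 X] :
    GMap Pin2 (CircleFixed X) X :=
  ⟨⟨fun x => x.1, continuous_subtype_val⟩, fun _ _ => rfl⟩

/-- A base point preserving map from `X^{S¹}` to the representation sphere of the sign
representation on `V` which is a `G`-homotopy equivalence. -/
structure SphereFraming (x₀ : X) (V : Type) [AddCommGroup V] [TopologicalSpace V] where
  fixed_base : ∀ g : Pin2, g • x₀ = x₀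
  toGMap : GMap Pin2 (CircleFixed X) (RepSphere V)
  map_base : toGMap ⟨x₀, fun g _ => fixed_base g⟩ = ∞
  isHomotopyEquiv : toGMap.IsHomotopyEquiv

/-- A linear homeomorphism `V ≃ W` turns framings by `V` into framings by `W`. -/
noncomputable def SphereFraming.congr {x₀ : X} {V W : Type} [AddCommGroup V] [TopologicalSpace V]
    [AddCommGroup W] [TopologicalSpace W] (e : V ≃ₜ+ W) (φ : SphereFraming x₀ V) :
    SphereFraming x₀ W := by
  let h : RepSphere V ≃ₜ RepSphere W :=
    Homeomorph.onePointCongr (X := SignRep V) (Y := SignRep W) e.toHomeomorph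
  have hh : ∀ (g : Pin2) x, h (g • x) = g • h x := by
    intro g x
    cases x using OnePoint.rec with
    | infty => rfl
    | coe v => exact congrArg OnePoint.some (map_zsmul e (g.sign : ℤ) v)
  have hs : ∀ (g : Pin2) y, h.symm (g • y) = g • h.symm y := fun g y => by
    rw [Homeomorph.symm_apply_eq, hh, Homeomorph.apply_symm_apply]
  refine ⟨φ.fixed_base, (⟨⟨h, h.continuous⟩, hh⟩ : GMap Pin2 _ _).comp φ.toGMap,
    (congrArg h φ.map_base).trans rfl, ?_⟩
  obtain ⟨ψ, ⟨H, hH⟩, K, hK⟩ := φ.isHomotopyEquiv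
  refine ⟨ψ.comp ⟨⟨h.symm, h.symm.continuous⟩, hs⟩, ⟨⟨⟨H, H.continuous⟩, fun x => ?_, fun x => ?_⟩,
    hH⟩, ⟨⟨fun p => h (K (p.1, h.symm p.2)), by fun_prop⟩, fun x => ?_, fun x => ?_⟩, ?_⟩
  · refine (H.apply_zero x).trans ?_
    exact congrArg ψ (h.symm_apply_apply (φ.toGMap x)).symm
  · exact H.apply_one x
  · exact congrArg h (K.apply_zero (h.symm x))
  · exact (congrArg h (K.apply_one (h.symm x))).trans (h.apply_symm_apply x)
  · intro s g y
    change h (K (s, h.symm (g • y))) = g • h (K (s, h.symm y))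
    rw [hs, hK, hh]

/-- `X`, with base point `x₀`, is a space of type `SWF` at level `s`. -/
structure IsSWF (x₀ : X) (s : ℕ) : Prop where
  hausdorff : T2Space X
  cellular : Nonempty (FiniteGCWStructure Pin2 X)
  circleFixed : Nonempty (SphereFraming x₀ (Fin s → ℝ))
  free : ∀ x : X, (¬ ∀ g : Pin2, g.sign = 1 → g • x = x) → ∀ g : Pin2, g • x = x → g = 1

/-- For a space of type `SWF` at level `2 t`, the fixed point set `X^{S¹}` is `G`-homotopy
equivalent to `(ℂ̃^t)^+`. -/
theorem IsSWF.nonempty_framing {x₀ : X} {t : ℕ} (h : IsSWF x₀ (2 * t)) :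
    Nonempty (SphereFraming x₀ (Fin t → ℂ)) := by
  obtain ⟨φ⟩ := h.circleFixed
  have e : (Fin (2 * t) → ℝ) ≃L[ℝ] (Fin t → ℂ) := ContinuousLinearEquiv.ofFinrankEq (by
    simp [Module.finrank_pi_fintype, mul_comm])
  exact ⟨φ.congr e.toContinuousAddEquiv⟩

/-- The reduced equivariant K-theory `K̃_G(X)`, as a subset of `K_G(X)`. -/
noncomputable def reducedKG {G : Type v} {Y : Type w} [Group G] [TopologicalSpace G]
    [TopologicalSpace Y] [MulAction G Y] (y₀ : Y) (h₀ : ∀ g : G, g • y₀ = y₀) : Ideal (KG G Y) :=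
  RingHom.ker (KG.pullback (GMap.ofFixedPoint y₀ h₀))

theorem KG.pullback_of {G : Type v} {Y : Type u} {Z : Type w} [Group G] [TopologicalSpace G]
    [TopologicalSpace Y] [MulAction G Y] [TopologicalSpace Z] [MulAction G Z] (f : GMap G Y Z)
    (b : GVectorBundle.IsoClass G Z) : KG.pullback f (GrothendieckRing.of b) =
      GrothendieckRing.of (GVectorBundle.IsoClass.pullback f.toContinuousMap f.map_smul' b) :=
  GrothendieckRing.map_of _ _

theorem KG.pullback_toPoint {G : Type v} {Y : Type u} {Z : Type w} [Group G] [TopologicalSpace G]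
    [TopologicalSpace Y] [MulAction G Y] [TopologicalSpace Z] [MulAction G Z] (f : GMap G Y Z)
    (a : RepRing G) :
    KG.pullback f (KG.pullback (GMap.toPoint G Z) a) = KG.pullback (GMap.toPoint G Y) a := by
  obtain ⟨b, c, rfl⟩ := GrothendieckRing.exists_sub a
  have h : ∀ b : GVectorBundle.IsoClass G Unit,
      KG.pullback f (KG.pullback (GMap.toPoint G Z) (GrothendieckRing.of b)) =
        KG.pullback (GMap.toPoint G Y) (GrothendieckRing.of b) := by
    intro b
    rw [KG.pullback_of, KG.pullback_of, KG.pullback_of]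
    refine congrArg GrothendieckRing.of ?_
    obtain ⟨E⟩ := b
    rfl
  simp only [map_sub, h]

/-- The ideal `𝔍(X) ⊆ R(G)` with `ι^* K̃_G(X) = 𝔍(X) · b`, where `ι : X^{S¹} → X` is the inclusion
and `b ∈ K̃_G(X^{S¹})` is the Bott class, transported to `X^{S¹}` by the given equivalence with
`(ℂ̃^t)^+`. -/
noncomputable def fixedIdeal {x₀ : X} {t : ℕ} (φ : SphereFraming x₀ (Fin t → ℂ)) :
    Ideal (RepRing Pin2) where
  carrier := {a | ∃ ξ ∈ reducedKG x₀ φ.fixed_base, KG.pullback (CircleFixed.incl X) ξ =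
    KG.pullback (GMap.toPoint Pin2 (CircleFixed X)) a * KG.pullback φ.toGMap (bottClass t)}
  zero_mem' := ⟨0, Ideal.zero_mem _, by simp⟩
  add_mem' := by
    rintro a b ⟨ξ, hξ, h⟩ ⟨η, hη, h'⟩
    exact ⟨ξ + η, Ideal.add_mem _ hξ hη, by simp only [map_add, add_mul, h, h']⟩
  smul_mem' := by
    rintro c a ⟨ξ, hξ, h⟩
    refine ⟨KG.pullback (GMap.toPoint Pin2 X) c * ξ, Ideal.mul_mem_left _ _ hξ, ?_⟩
    rw [map_mul, h, KG.pullback_toPoint, smul_eq_mul, map_mul, mul_assoc]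

/-- The set of those `k ≥ 0` for which there is `x ∈ 𝔍(X)` with `w x = 2^k w`. -/
def kSet {x₀ : X} {t : ℕ} (φ : SphereFraming x₀ (Fin t → ℂ)) : Set ℕ :=
  {k | ∃ x ∈ fixedIdeal φ, wClass * x = 2 ^ k * wClass}

/-- The invariant `k(X) = min {k ≥ 0 | ∃ x ∈ 𝔍(X), w x = 2^k w}`. -/
noncomputable def kInvariant {x₀ : X} {t : ℕ} (φ : SphereFraming x₀ (Fin t → ℂ)) : ℕ :=
  sInf (kSet φ)

/-- `X` is `K_G`-split: the ideal `𝔍(X)` is of the form `(z^k)`. -/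
def IsKGSplit {x₀ : X} {t : ℕ} (φ : SphereFraming x₀ (Fin t → ℂ)) : Prop :=
  ∃ k : ℕ, fixedIdeal φ = Ideal.span {zClass ^ k}

/-- The `G`-fixed point map of `f` is a homotopy equivalence. -/
def GMap.IsHomotopyEquivOnFixedPoints {G : Type v} {Y : Type u} {Z : Type w} [Group G]
    [TopologicalSpace Y] [MulAction G Y] [TopologicalSpace Z] [MulAction G Z]
    (f : GMap G Y Z) : Prop :=
  ∃ e : ContinuousMap.HomotopyEquiv (MulAction.fixedPoints G Y) (MulAction.fixedPoints G Z),
    e.toFun = f.onFixedPoints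

end SWF

/-!
The Bott class is represented by Clifford multiplication. A nowhere vanishing equivariant map `q`
from a `Pin(2)`-space to `ℝ ⊕ ℂ̃^t` acts on `Λ(ℂ^t)` by operators with square `|q|²`, and the bundle
of its positive eigenspaces has a class `SignMap.cls`. This class depends on the homotopy class of
`q` only, is compatible with pullback, and for the unit sphere of `ℝ ⊕ ℂ̃^t` gives the Bott class up
to the class of a product bundle (`exists_bottClass_eq`). Classes of product bundles may be ignored
throughout, because every relation can be corrected by its value at the base point
(`mem_fixedIdeal_of_eq_add_const`). So no exact sequence and no periodicity theorem is used. All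
bundles other than the given ones are bundles of ranges of families of idempotent matrices, whose
isomorphisms are given by matrices.

*The sets are non-empty.* The map to `ℝ ⊕ ℂ̃^t` which represents the Bott class on `X^{S¹}` extends
to an equivariant map `q` on `X`, by the Tietze theorem and averaging over the group. The zeros of
`q` lie in free orbits, so finitely many equivariant maps from `X` to `ℍ` have no common zero with
`q`; they vanish on `X^{S¹}`, since `-1 ∈ S¹` acts on `ℍ` as `-1`. Clifford multiplication by `q`
and these maps together is invertible on `X`, and each of them multiplies the class on `X^{S¹}` by
`z`, up to a product bundle (`exists_quatSteps`). Hence `z^n ∈ 𝔍(X)` for some `n`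
(`exists_zClass_pow_mem`), and `w z^n = 2^n w`.

*The first inequality.* Put `n = t' - t > 0`. The map `f` induces an equivariant map of spheres
`(ℂ̃^t)^+ → (ℂ̃^{t'})^+` which takes the two fixed points to different fixed points, as `f` is a
homotopy equivalence on fixed points (`re_mul_re_neg`). By a count of dimensions, a generic
perturbation of its vector part avoids the real multiples of a linear injection, so that the
map is homotopic to that injection, possibly with the opposite sign on the real coordinate
(`SignMap.exists_perturbation`, `SignMap.cls_eq_linear`). The pullback of the Bott class is
therefore `± w^n` times the Bott class, and `x ∈ 𝔍(X')` implies `w^n x ∈ 𝔍(X)`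
(`wClass_pow_mul_mem_fixedIdeal`). If `w x = 2^k w`, then `w (w^n x) = 2^{k + n} w`, because
`w² = 2w`.

*The split case.* If `𝔍(X) = (z^k)`, then `z^k` divides `w^n x = 2^{k(X') + n - 1} w`. Characters
show that this forces `k ≤ k(X') + n - 1` (`le_of_zClass_pow_dvd`), and `z^k ∈ 𝔍(X)` gives
`k(X) ≤ k`.
-/

open Matrix
set_option linter.unusedSectionVars false

/-! ### Bundles of ranges of idempotent matrices -/

section ProjectionBundles

variable {G : Type v} {X : Type u} {Y : Type w} [Group G] [TopologicalSpace G]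
  [TopologicalSpace X] [MulAction G X] [TopologicalSpace Y] [MulAction G Y]

/-- A continuous complex matrix representation of `G`. -/
structure MatRep (G : Type v) [Group G] [TopologicalSpace G] (ι : Type) [Fintype ι]
    [DecidableEq ι] where
  toHom : G →* Matrix ι ι ℂ
  continuous_toHom : Continuous toHom

/-- A continuous family of idempotent matrices over `X` that is equivariant with respect to a
matrix representation. -/
structure ProjFamily (X : Type u) [TopologicalSpace X] [MulAction G X] {ι : Type} [Fintype ι]
    [DecidableEq ι] (ρ : MatRep G ι) where
  proj : X → Matrix ι ι ℂ
  continuous_proj : Continuous proj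
  idem : ∀ x, proj x * proj x = proj x
  equivariant : ∀ g x, ρ.toHom g * proj x = proj (g • x) * ρ.toHom g

variable {ι κ : Type} [Fintype ι] [DecidableEq ι] [Fintype κ] [DecidableEq κ]

/-- The space of fixed vectors of a matrix; for an idempotent matrix this is its range. -/
def fixedVec (P : Matrix ι ι ℂ) : Submodule ℂ (ι → ℂ) := LinearMap.eqLocus P.mulVecLin LinearMap.id

theorem mem_fixedVec {P : Matrix ι ι ℂ} {v : ι → ℂ} : v ∈ fixedVec P ↔ P *ᵥ v = v := Iff.rfl

/-- The projection onto the fixed vectors. -/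
def toFixedVec (P : Matrix ι ι ℂ) (h : P * P = P) : (ι → ℂ) →ₗ[ℂ] fixedVec P :=
  P.mulVecLin.codRestrict _ fun v => by
    rw [mem_fixedVec, mulVecLin_apply, mulVec_mulVec, h]

theorem toFixedVec_coe (P : Matrix ι ι ℂ) (h : P * P = P) (v : fixedVec P) :
    toFixedVec P h v.1 = v := Subtype.ext v.2

/-- A matrix intertwining `P` and `Q` on the range of `P` maps fixed vectors to fixed vectors. -/
def fixedVecMap (P : Matrix ι ι ℂ) (Q : Matrix κ κ ℂ) (T : Matrix κ ι ℂ) (h : Q * T * P = T * P) :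
    fixedVec P →ₗ[ℂ] fixedVec Q :=
  (T.mulVecLin ∘ₗ (fixedVec P).subtype).codRestrict _ fun v => by
    have hv : P *ᵥ v.1 = v.1 := v.2
    rw [mem_fixedVec, LinearMap.comp_apply, Submodule.subtype_apply, mulVecLin_apply, ← hv,
      mulVec_mulVec, mulVec_mulVec, h, ← mulVec_mulVec, hv]

theorem fixedVecMap_coe (P : Matrix ι ι ℂ) (Q : Matrix κ κ ℂ) (T : Matrix κ ι ℂ)
    (h : Q * T * P = T * P) (v : fixedVec P) : (fixedVecMap P Q T h v).1 = T *ᵥ v.1 := rfl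

/-- Mutually inverse intertwiners give an isomorphism of the spaces of fixed vectors. -/
def fixedVecEquiv (P : Matrix ι ι ℂ) (Q : Matrix κ κ ℂ) (T : Matrix κ ι ℂ) (T' : Matrix ι κ ℂ)
    (h : Q * T * P = T * P) (h' : P * T' * Q = T' * Q) (h₁ : T' * T * P = P)
    (h₂ : T * T' * Q = Q) : fixedVec P ≃ₗ[ℂ] fixedVec Q :=
  LinearEquiv.ofLinearMap (fixedVecMap P Q T h) (fixedVecMap Q P T' h')
    (LinearMap.ext fun v => Subtype.ext <| by
      have hv : Q *ᵥ v.1 = v.1 := v.2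
      change T *ᵥ T' *ᵥ v.1 = v.1
      conv_lhs => rw [← hv]
      rw [mulVec_mulVec, mulVec_mulVec, h₂, hv])
    (LinearMap.ext fun v => Subtype.ext <| by
      have hv : P *ᵥ v.1 = v.1 := v.2
      change T' *ᵥ T *ᵥ v.1 = v.1
      conv_lhs => rw [← hv]
      rw [mulVec_mulVec, mulVec_mulVec, h₁, hv])

/-- The standard comparison `Q P + (1 - Q) (1 - P)` of two idempotents; where it is invertible, it
maps the range of `P` isomorphically to the range of `Q`. -/
def transport (P Q : Matrix ι ι ℂ) : Matrix ι ι ℂ := Q * P + (1 - Q) * (1 - P)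

theorem transport_self {P : Matrix ι ι ℂ} (h : P * P = P) : transport P P = 1 := by
  simp only [transport, mul_sub, sub_mul, h, mul_one, one_mul]
  abel

theorem transport_mul {P Q : Matrix ι ι ℂ} (hP : P * P = P) (hQ : Q * Q = Q) :
    transport P Q * P = Q * transport P Q := by
  have h₁ : Q * P * P = Q * P := by rw [mul_assoc, hP]
  have h₂ : Q * (Q * P) = Q * P := by rw [← mul_assoc, hQ]
  simp only [transport, mul_sub, sub_mul, add_mul, mul_add, h₁, h₂, hP, hQ, mul_one, one_mul]
  abel

theorem inv_transport_mul {P Q : Matrix ι ι ℂ} (hP : P * P = P) (hQ : Q * Q = Q)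
    (hU : (transport P Q).det ≠ 0) :
    (transport P Q)⁻¹ * Q = P * (transport P Q)⁻¹ := by
  have hU' : IsUnit (transport P Q).det := isUnit_iff_ne_zero.2 hU
  calc (transport P Q)⁻¹ * Q = (transport P Q)⁻¹ * (Q * transport P Q) * (transport P Q)⁻¹ := by
        rw [mul_assoc, mul_assoc, mul_nonsing_inv _ hU', mul_one]
    _ = P * (transport P Q)⁻¹ := by
        rw [← transport_mul hP hQ, ← mul_assoc, nonsing_inv_mul _ hU', one_mul]

/-- The isomorphism of ranges given by the standard comparison of two idempotents. -/
noncomputable def transportEquiv (P Q : Matrix ι ι ℂ) (hP : P * P = P) (hQ : Q * Q = Q)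
    (hU : (transport P Q).det ≠ 0) : fixedVec P ≃ₗ[ℂ] fixedVec Q :=
  fixedVecEquiv P Q (transport P Q) (transport P Q)⁻¹
    (by rw [mul_assoc, transport_mul hP hQ, ← mul_assoc, hQ])
    (by rw [mul_assoc, inv_transport_mul hP hQ hU, ← mul_assoc, hP])
    (by rw [nonsing_inv_mul _ (isUnit_iff_ne_zero.2 hU), one_mul])
    (by rw [mul_nonsing_inv _ (isUnit_iff_ne_zero.2 hU), one_mul])

theorem continuous_matrix_inv {W : Type*} [TopologicalSpace W] {A : W → Matrix ι ι ℂ}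
    (hA : Continuous A) (h : ∀ w, (A w).det ≠ 0) : Continuous fun w => (A w)⁻¹ := by
  simp only [Matrix.inv_def, Ring.inverse_eq_inv']
  exact (hA.matrix_det.inv₀ h).smul hA.matrix_adjugate

theorem continuous_linearMap_apply {W : Type*} [TopologicalSpace W] {v : W → ι → ℂ}
    (hv : Continuous v) (l : (ι → ℂ) →ₗ[ℂ] ℂ) : Continuous fun w => l (v w) :=
  (LinearMap.continuous_of_finiteDimensional l).comp hv

theorem MatRep.mul_inv (ρ : MatRep G ι) (g : G) : ρ.toHom g * ρ.toHom g⁻¹ = 1 := by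
  rw [← map_mul, mul_inv_cancel, map_one]

namespace ProjFamily

variable {ρ : MatRep G ι} {ρ' : MatRep G κ} (P : ProjFamily X ρ) (Q : ProjFamily X ρ')

theorem proj_smul (g : G) (x : X) : P.proj (g • x) = ρ.toHom g * P.proj x * ρ.toHom g⁻¹ := by
  rw [P.equivariant, mul_assoc, ρ.mul_inv, mul_one]

/-- The neighbourhood of `a` over which the local frame at `a` is defined. -/
def nhd (a : X) : Set X := {x | (transport (P.proj a) (P.proj x)).det ≠ 0}

theorem continuous_transport (a : X) : Continuous fun x => transport (P.proj a) (P.proj x) := by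
  have := P.continuous_proj
  unfold transport
  fun_prop

/-- The local frame at `a`. -/
noncomputable def localFrame (a x : X) (hx : x ∈ P.nhd a) :
    Module.Basis (Fin (Module.finrank ℂ (fixedVec (P.proj a)))) ℂ (fixedVec (P.proj x)) :=
  (Module.finBasis ℂ (fixedVec (P.proj a))).map
    (transportEquiv (P.proj a) (P.proj x) (P.idem a) (P.idem x) hx)

theorem continuous_repr {W : Type*} [TopologicalSpace W] {v : W → ι → ℂ} (hv : Continuous v)
    (b : X) {p : W → Matrix ι ι ℂ} (hp : Continuous p) {φ : W → X} (hpφ : ∀ w, P.proj (φ w) = p w)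
    (hb : ∀ w, φ w ∈ P.nhd b) (hm : ∀ w, v w ∈ fixedVec (P.proj (φ w))) (j) :
    Continuous fun w => (P.localFrame b (φ w) (hb w)).repr ⟨v w, hm w⟩ j := by
  let l : (ι → ℂ) →ₗ[ℂ] ℂ := (Module.finBasis ℂ (fixedVec (P.proj b))).coord j ∘ₗ
    toFixedVec (P.proj b) (P.idem b)
  have hU : ∀ w, (transport (P.proj b) (p w)).det ≠ 0 := fun w => by rw [← hpφ]; exact hb w
  have h : ∀ w, (P.localFrame b (φ w) (hb w)).repr ⟨v w, hm w⟩ j =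
      l ((transport (P.proj b) (p w))⁻¹ *ᵥ v w) := by
    intro w
    have h₁ : (transport (P.proj b) (p w))⁻¹ *ᵥ v w = ((transportEquiv (P.proj b) (P.proj (φ w))
      (P.idem b) (P.idem _) (hb w)).symm ⟨v w, hm w⟩).1 := by rw [← hpφ]; rfl
    rw [h₁]
    change _ = (Module.finBasis ℂ (fixedVec (P.proj b))).coord j (toFixedVec _ _ _)
    rw [toFixedVec_coe]
    rfl
  refine (continuous_congr h).2 (continuous_linearMap_apply ?_ l)
  refine (continuous_matrix_inv ?_ hU).matrix_mulVec hv
  unfold transport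
  fun_prop

theorem continuous_localFrame {W : Type*} [TopologicalSpace W] (a : X) {φ : W → X}
    (hφ : Continuous φ) (ha : ∀ w, φ w ∈ P.nhd a) (i) :
    Continuous fun w => (P.localFrame a (φ w) (ha w) i).1 :=
  ((P.continuous_transport a).comp hφ).matrix_mulVec continuous_const

variable [IsTopologicalGroup G]

/-- The vector bundle of the ranges of a family of idempotents. -/
noncomputable def bundle : GVectorBundle G X where
  Fiber x := fixedVec (P.proj x)
  base := P.nhd
  isOpen_base a := isOpen_ne_fun (P.continuous_transport a).matrix_det continuous_const
  mem_base a := by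
    change (transport (P.proj a) (P.proj a)).det ≠ 0
    rw [transport_self (P.idem a), det_one]
    exact one_ne_zero
  Idx a := Fin (Module.finrank ℂ (fixedVec (P.proj a)))
  frame := P.localFrame
  continuous_transition a b i j :=
    P.continuous_repr (P.continuous_localFrame a continuous_subtype_val (fun x => x.2.1) i) b
      (P.continuous_proj.comp continuous_subtype_val) (fun _ => rfl) (fun x => x.2.2)
      (fun x => (P.localFrame a x.1 x.2.1 i).2) j
  act g x y h := fixedVecMap _ _ (ρ.toHom g) (by
    subst h
    rw [← P.equivariant, mul_assoc, P.idem])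
  act_one x v := Subtype.ext <| by rw [fixedVecMap_coe, map_one, one_mulVec]
  act_mul g h x y z hxy hyz hxz v := Subtype.ext <| by
    simp only [fixedVecMap_coe]
    rw [map_mul, mulVec_mulVec]
  continuous_act a b i j := by
    have h₁ : Continuous fun p : {p : G × X // p.2 ∈ P.nhd a ∧ p.1 • p.2 ∈ P.nhd b} => p.1.1 :=
      continuous_fst.comp continuous_subtype_val
    have h₂ : Continuous fun p : {p : G × X // p.2 ∈ P.nhd a ∧ p.1 • p.2 ∈ P.nhd b} => p.1.2 :=
      continuous_snd.comp continuous_subtype_val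
    refine P.continuous_repr (v := fun p : {p : G × X // p.2 ∈ P.nhd a ∧ p.1 • p.2 ∈ P.nhd b} =>
        ρ.toHom p.1.1 *ᵥ (P.localFrame a p.1.2 p.2.1 i).1)
      ((ρ.continuous_toHom.comp h₁).matrix_mulVec
        (P.continuous_localFrame a h₂ (fun x => x.2.1) i)) b
      (p := fun p => ρ.toHom p.1.1 * P.proj p.1.2 * ρ.toHom p.1.1⁻¹)
      (((ρ.continuous_toHom.comp h₁).matrix_mul (P.continuous_proj.comp h₂)).matrix_mul
        (ρ.continuous_toHom.comp h₁.inv)) (fun p => P.proj_smul _ _) (fun x => x.2.2) ?_ j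

/-- A family of linear maps into a bundle of ranges is continuous when the images of the local
frames are continuous as vectors of the ambient space. -/
theorem continuousFamily_to {E : GVectorBundle G X}
    {T : ∀ x, E.Fiber x →ₗ[ℂ] fixedVec (P.proj x)}
    (hT : ∀ a i, Continuous fun x : {x : X // x ∈ E.base a} => (T x.1 (E.frame a x.1 x.2 i)).1) :
    GVectorBundle.ContinuousFamily E P.bundle T := by
  intro a b i j
  exact P.continuous_repr (v := fun x : {x : X // x ∈ E.base a ∧ x ∈ P.nhd b} =>
      (T x.1 (E.frame a x.1 x.2.1 i)).1)
    ((hT a i).comp (f := fun x : {x : X // x ∈ E.base a ∧ x ∈ P.nhd b} =>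
      (⟨x.1, x.2.1⟩ : {x : X // x ∈ E.base a})) (by fun_prop)) b
    (P.continuous_proj.comp continuous_subtype_val) (fun _ => rfl) (fun x => x.2.2)
    (fun x => (T x.1 (E.frame a x.1 x.2.1 i)).2) j

end ProjFamily

end ProjectionBundles

namespace GVectorBundle

variable {G : Type v} {X : Type u} [Group G] [TopologicalSpace G]
  [TopologicalSpace X] [MulAction G X]

/-- An equivariant continuous family of bijective linear maps is an isomorphism of bundles:
the inverse is continuous because inversion of matrices is. -/
noncomputable def Iso.ofContinuousFamily {E F : GVectorBundle G X} (T : ∀ x, E.Fiber x ≃ₗ[ℂ] F.Fiber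
    x)
    (map_act : ∀ (g : G) (x y : X) (h : g • x = y) v, T y (E.act g x y h v) = F.act g x y h (T x v))
    (hT : ContinuousFamily E F fun x => (T x).toLinearMap) : Iso E F where
  equiv := T
  map_act := map_act
  continuous_toFun := hT
  continuous_invFun a b i j := by
    classical
    rw [continuous_iff_continuousAt]
    intro x₀
    -- The index types of the two frames have the same cardinality over the common domain, which is
    -- non-empty as it contains `x₀`; a bijection turns the matrices into square ones.
    have e : F.Idx a ≃ E.Idx b :=
      ((F.frame a x₀.1 x₀.2.1).indexEquiv ((E.frame b x₀.1 x₀.2.2).map (T x₀.1)))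
    refine Continuous.continuousAt ?_
    let M : {x : X // x ∈ F.base a ∧ x ∈ E.base b} → Matrix (F.Idx a) (F.Idx a) ℂ := fun x =>
      (LinearMap.toMatrix (E.frame b x.1 x.2.2) (F.frame a x.1 x.2.1) (T x.1).toLinearMap).submatrix
        id e
    let N : {x : X // x ∈ F.base a ∧ x ∈ E.base b} → Matrix (F.Idx a) (F.Idx a) ℂ := fun x =>
      (LinearMap.toMatrix (F.frame a x.1 x.2.1) (E.frame b x.1 x.2.2)
        (T x.1).symm.toLinearMap).submatrix e id
    have hMN : ∀ x, N x * M x = 1 := by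
      intro x
      change Matrix.submatrix _ _ _ * Matrix.submatrix _ _ _ = 1
      rw [Matrix.submatrix_mul _ _ _ _ _ Function.bijective_id |>.symm, ← LinearMap.toMatrix_comp]
      simp
    have hM : Continuous M := by
      refine continuous_matrix fun k l => ?_
      have := hT b a (e l) k
      refine (continuous_congr fun x => ?_).2 (this.comp
        (f := fun x : {x : X // x ∈ F.base a ∧ x ∈ E.base b} => ⟨x.1, x.2.2, x.2.1⟩) (by fun_prop))
      simp [M, LinearMap.toMatrix_apply]
    have hN : ∀ x, N x = (M x)⁻¹ := fun x => (Matrix.inv_eq_left_inv (hMN x)).symm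
    have hdet : ∀ x, (M x).det ≠ 0 := fun x =>
      (isUnit_iff_ne_zero.1 (Matrix.isUnit_det_of_left_inverse (hMN x)))
    have hc : Continuous N := (continuous_congr hN).2 (continuous_matrix_inv hM hdet)
    refine (continuous_congr fun x => ?_).2 (hc.matrix_elem (e.symm j) i)
    simp [N, LinearMap.toMatrix_apply]

theorem KG_mk_eq {E F : GVectorBundle G X} (e : Iso E F) : KG.mk E = KG.mk F :=
  congrArg GrothendieckRing.of (Quotient.sound ⟨e⟩)

theorem KG_mk_sum (E F : GVectorBundle G X) : KG.mk (sum E F) = KG.mk E + KG.mk F :=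
  GrothendieckRing.of.map_add (show IsoClass G X from Quotient.mk _ E) (Quotient.mk _ F)

theorem KG_mk_tensor (E F : GVectorBundle G X) : KG.mk (tensor E F) = KG.mk E * KG.mk F :=
  (GrothendieckRing.of_mul_of (show IsoClass G X from Quotient.mk _ E) (Quotient.mk _ F)).symm

end GVectorBundle

/-! ### Operations on classes of families of idempotents -/

section ProjectionClasses

open GVectorBundle
open scoped Kronecker

variable {G : Type v} {X : Type u} {Y : Type w} [Group G] [TopologicalSpace G]
  [TopologicalSpace X] [MulAction G X] [TopologicalSpace Y] [MulAction G Y]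

variable {ι κ : Type} [Fintype ι] [DecidableEq ι] [Fintype κ] [DecidableEq κ]

namespace MatRep

/-- The direct sum of two matrix representations. -/
def sum (ρ : MatRep G ι) (ρ' : MatRep G κ) : MatRep G (ι ⊕ κ) where
  toHom :=
    { toFun := fun g => fromBlocks (ρ.toHom g) 0 0 (ρ'.toHom g)
      map_one' := by rw [map_one, map_one, fromBlocks_one]
      map_mul' := fun g h => by simp [fromBlocks_multiply] }
  continuous_toHom := ρ.continuous_toHom.matrix_fromBlocks continuous_const continuous_const
    ρ'.continuous_toHom

theorem continuous_kronecker {W : Type*} [TopologicalSpace W] {A : W → Matrix ι ι ℂ}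
    {B : W → Matrix κ κ ℂ} (hA : Continuous A) (hB : Continuous B) :
    Continuous fun w => A w ⊗ₖ B w :=
  continuous_matrix fun _ _ => (hA.matrix_elem _ _).mul (hB.matrix_elem _ _)

/-- The tensor product of two matrix representations. -/
def kron (ρ : MatRep G ι) (ρ' : MatRep G κ) : MatRep G (ι × κ) where
  toHom :=
    { toFun := fun g => ρ.toHom g ⊗ₖ ρ'.toHom g
      map_one' := by rw [map_one, map_one, one_kronecker_one]
      map_mul' := fun g h => by simp [mul_kronecker_mul] }
  continuous_toHom := continuous_kronecker ρ.continuous_toHom ρ'.continuous_toHom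

variable (G ι) in
/-- The trivial matrix representation. -/
def triv : MatRep G ι where
  toHom := 1
  continuous_toHom := continuous_const

end MatRep

namespace ProjFamily

variable {ρ : MatRep G ι} {ρ' : MatRep G κ}

/-- The pullback of a family of idempotents. -/
def comp (P : ProjFamily X ρ) (f : GMap G Y X) : ProjFamily Y ρ where
  proj y := P.proj (f y)
  continuous_proj := P.continuous_proj.comp f.continuous
  idem y := P.idem (f y)
  equivariant g y := (P.equivariant g (f y)).trans
    (congrArg (fun x => P.proj x * ρ.toHom g) (f.map_smul' g y).symm)

/-- The family of complementary idempotents. -/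
def compl (P : ProjFamily X ρ) : ProjFamily X ρ where
  proj x := 1 - P.proj x
  continuous_proj := continuous_const.sub P.continuous_proj
  idem x := by simp [mul_sub, sub_mul, P.idem]
  equivariant g x := by rw [mul_sub, sub_mul, P.equivariant, mul_one, one_mul]

variable (X ρ) in
/-- The constant family of identity matrices. -/
def one : ProjFamily X ρ where
  proj _ := 1
  continuous_proj := continuous_const
  idem _ := mul_one 1
  equivariant g _ := by rw [mul_one, one_mul]

/-- The direct sum of two families of idempotents. -/
def sum (P : ProjFamily X ρ) (Q : ProjFamily X ρ') : ProjFamily X (ρ.sum ρ') where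
  proj x := fromBlocks (P.proj x) 0 0 (Q.proj x)
  continuous_proj := P.continuous_proj.matrix_fromBlocks continuous_const continuous_const
    Q.continuous_proj
  idem x := by simp [fromBlocks_multiply, P.idem, Q.idem]
  equivariant g x := by simp [MatRep.sum, fromBlocks_multiply, P.equivariant, Q.equivariant]

/-- The tensor product of two families of idempotents. -/
def kron (P : ProjFamily X ρ) (Q : ProjFamily X ρ') : ProjFamily X (ρ.kron ρ') where
  proj x := P.proj x ⊗ₖ Q.proj x
  continuous_proj := MatRep.continuous_kronecker P.continuous_proj Q.continuous_proj
  idem x := by rw [← mul_kronecker_mul, P.idem, Q.idem]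
  equivariant g x := by
    change (_ ⊗ₖ _) * (_ ⊗ₖ _) = (_ ⊗ₖ _) * (_ ⊗ₖ _)
    rw [← mul_kronecker_mul, P.equivariant, Q.equivariant, mul_kronecker_mul]

variable [IsTopologicalGroup G]

/-- The class in equivariant K-theory of the bundle of ranges. -/
noncomputable def cls (P : ProjFamily X ρ) : KG G X := KG.mk P.bundle

theorem pullback_cls (P : ProjFamily X ρ) (f : GMap G Y X) :
    KG.pullback f P.cls = (P.comp f).cls :=
  GrothendieckRing.map_of _ _

/-- Families of matrices that restrict to mutually inverse equivariant isomorphisms of the ranges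
give equal classes. -/
theorem cls_eq_of_intertwine (P : ProjFamily X ρ) (Q : ProjFamily X ρ') {T : X → Matrix κ ι ℂ}
    {T' : X → Matrix ι κ ℂ} (hT : Continuous T)
    (h : ∀ x, Q.proj x * T x * P.proj x = T x * P.proj x)
    (h' : ∀ x, P.proj x * T' x * Q.proj x = T' x * Q.proj x)
    (h₁ : ∀ x, T' x * T x * P.proj x = P.proj x) (h₂ : ∀ x, T x * T' x * Q.proj x = Q.proj x)
    (hρ : ∀ g x, ρ'.toHom g * T x = T (g • x) * ρ.toHom g) : P.cls = Q.cls := by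
  refine KG_mk_eq (E := P.bundle) (F := Q.bundle) (Iso.ofContinuousFamily
    (fun x => fixedVecEquiv (P.proj x) (Q.proj x) (T x) (T' x) (h x) (h' x) (h₁ x) (h₂ x)) ?_ ?_)
  · rintro g x _ rfl (v : fixedVec (P.proj x))
    refine Subtype.ext ?_
    change T (g • x) *ᵥ ρ.toHom g *ᵥ v.1 = ρ'.toHom g *ᵥ T x *ᵥ v.1
    rw [mulVec_mulVec, mulVec_mulVec, hρ]
  · exact Q.continuousFamily_to fun a i => (hT.comp continuous_subtype_val).matrix_mulVec
      (P.continuous_localFrame a continuous_subtype_val (fun x => x.2) i)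

/-- Constant mutually inverse matrices that intertwine the families give equal classes. -/
theorem cls_eq_of_conj (P : ProjFamily X ρ) (Q : ProjFamily X ρ') (T : Matrix κ ι ℂ)
    (T' : Matrix ι κ ℂ) (h₁ : T' * T = 1) (h₂ : T * T' = 1)
    (h : ∀ x, T * P.proj x = Q.proj x * T) (hρ : ∀ g, ρ'.toHom g * T = T * ρ.toHom g) :
    P.cls = Q.cls := by
  refine P.cls_eq_of_intertwine Q (T := fun _ => T) (T' := fun _ => T') continuous_const
    (fun x => ?_) (fun x => ?_) (fun x => by rw [h₁, one_mul]) (fun x => by rw [h₂, one_mul])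
    fun g _ => hρ g
  · rw [← h, Matrix.mul_assoc, P.idem]
  · have h' : T' * Q.proj x = P.proj x * T' := by
      calc T' * Q.proj x = T' * (Q.proj x * T) * T' := by
            rw [Matrix.mul_assoc, Matrix.mul_assoc, h₂, Matrix.mul_one]
        _ = P.proj x * T' := by rw [← h, ← Matrix.mul_assoc, h₁, Matrix.one_mul]
    rw [← h', Matrix.mul_assoc, Q.idem]

theorem cls_sum (P : ProjFamily X ρ) (Q : ProjFamily X ρ') :
    (P.sum Q).cls = P.cls + Q.cls := by
  refine Eq.symm ((KG_mk_sum _ _).symm.trans ?_)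
  let toFun : ∀ x, (fixedVec (P.proj x) × fixedVec (Q.proj x)) ≃ₗ[ℂ] fixedVec ((P.sum Q).proj x) :=
    fun x =>
    { toFun := fun v => ⟨Sum.elim v.1.1 v.2.1, by
        have h₁ : P.proj x *ᵥ v.1.1 = v.1.1 := v.1.2
        have h₂ : Q.proj x *ᵥ v.2.1 = v.2.1 := v.2.2
        rw [mem_fixedVec]
        change fromBlocks _ _ _ _ *ᵥ _ = _
        simp [fromBlocks_mulVec, h₁, h₂]⟩
      map_add' := fun v w => Subtype.ext (by ext (i | i) <;> rfl)
      map_smul' := fun c v => Subtype.ext (by ext (i | i) <;> rfl)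
      invFun := fun v => (⟨v.1 ∘ Sum.inl, by
          have h : fromBlocks (P.proj x) 0 0 (Q.proj x) *ᵥ v.1 = v.1 := v.2
          rw [fromBlocks_mulVec] at h
          have := congrArg (fun w => w ∘ Sum.inl) h
          simpa [mem_fixedVec] using this⟩, ⟨v.1 ∘ Sum.inr, by
          have h : fromBlocks (P.proj x) 0 0 (Q.proj x) *ᵥ v.1 = v.1 := v.2
          rw [fromBlocks_mulVec] at h
          have := congrArg (fun w => w ∘ Sum.inr) h
          simpa [mem_fixedVec] using this⟩)
      left_inv := fun v => rfl
      right_inv := fun v => Subtype.ext (by ext (i | i) <;> rfl) }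
  refine KG_mk_eq (E := GVectorBundle.sum P.bundle Q.bundle) (F := (P.sum Q).bundle)
    (Iso.ofContinuousFamily toFun ?_ ?_)
  · rintro g x _ rfl ⟨v, w⟩
    refine Subtype.ext ?_
    change Sum.elim (ρ.toHom g *ᵥ v.1) (ρ'.toHom g *ᵥ w.1) =
      fromBlocks _ _ _ _ *ᵥ (Sum.elim v.1 w.1)
    simp [fromBlocks_mulVec]
  · refine (P.sum Q).continuousFamily_to ?_
    rintro a (i | i)
    · have hc := P.continuous_localFrame (W := {x // x ∈ P.nhd a ∩ Q.nhd a}) a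
        continuous_subtype_val (fun x => x.2.1) i
      refine Continuous.congr (f := fun x : {x // x ∈ P.nhd a ∩ Q.nhd a} =>
        Sum.elim (P.localFrame a x.1 x.2.1 i).1 (0 : κ → ℂ)) ?_ fun x => ?_
      rotate_left
      · exact Eq.symm <| congrArg (fun v => (toFun x.1 v).1) (sum_frame_inl P.bundle Q.bundle a x.1
          x.2 i)
      · refine continuous_pi ?_
        rintro (j | j)
        · exact (continuous_apply j).comp hc
        · exact continuous_const
    · have hc := Q.continuous_localFrame (W := {x // x ∈ P.nhd a ∩ Q.nhd a}) a
        continuous_subtype_val (fun x => x.2.2) i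
      refine Continuous.congr (f := fun x : {x // x ∈ P.nhd a ∩ Q.nhd a} =>
        Sum.elim (0 : ι → ℂ) (Q.localFrame a x.1 x.2.2 i).1) ?_ fun x => ?_
      rotate_left
      · exact Eq.symm <| congrArg (fun v => (toFun x.1 v).1) (sum_frame_inr P.bundle Q.bundle a x.1
          x.2 i)
      · refine continuous_pi ?_
        rintro (j | j)
        · exact continuous_const
        · exact (continuous_apply j).comp hc

theorem cls_add_cls_compl (P : ProjFamily X ρ) : P.cls + P.compl.cls = (one X ρ).cls := by
  rw [← cls_sum]
  refine cls_eq_of_intertwine _ _ (T := fun _ => fromCols 1 1)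
    (T' := fun x => fromRows (P.proj x) (1 - P.proj x)) continuous_const ?_ ?_ ?_ ?_ ?_
  · intro x
    simp [one]
  · intro x
    simp only [sum, one, compl, fromBlocks_mul_fromRows]
    simp [mul_sub, sub_mul, P.idem]
  · intro x
    simp only [sum, compl, fromRows_mul_fromCols, fromBlocks_multiply]
    simp [mul_sub, sub_mul, P.idem]
  · intro x
    simp [one, fromCols_mul_fromRows]
  · intro g x
    simp [MatRep.sum, fromCols_mul_fromBlocks, mul_fromCols]

end ProjFamily

theorem kronecker_mulVec (P : Matrix ι ι ℂ) (Q : Matrix κ κ ℂ) (v : ι → ℂ) (w : κ → ℂ) :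
    (P ⊗ₖ Q) *ᵥ (fun ij => v ij.1 * w ij.2) = fun ij => (P *ᵥ v) ij.1 * (Q *ᵥ w) ij.2 := by
  ext ⟨k, l⟩
  simp only [mulVec, dotProduct, Fintype.sum_prod_type, kroneckerMap_apply,
    Finset.sum_mul_sum]
  exact Finset.sum_congr rfl fun i _ => Finset.sum_congr rfl fun j _ => by ring

/-- The range of a Kronecker product of idempotents is the tensor product of the ranges. -/
noncomputable def fixedVecTensor (P : Matrix ι ι ℂ) (Q : Matrix κ κ ℂ) (hP : P * P = P)
    (hQ : Q * Q = Q) : fixedVec P ⊗[ℂ] fixedVec Q ≃ₗ[ℂ] fixedVec (P ⊗ₖ Q) :=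
  LinearEquiv.ofLinearMap
    (TensorProduct.lift (LinearMap.mk₂ ℂ (fun v w => (⟨fun ij => v.1 ij.1 * w.1 ij.2, by
        have h₁ : P *ᵥ v.1 = v.1 := v.2
        have h₂ : Q *ᵥ w.1 = w.1 := w.2
        rw [mem_fixedVec, kronecker_mulVec, h₁, h₂]⟩ : fixedVec (P ⊗ₖ Q)))
      (fun _ _ _ => Subtype.ext (funext fun _ => add_mul _ _ _))
      (fun _ _ _ => Subtype.ext (funext fun _ => mul_assoc _ _ _))
      (fun _ _ _ => Subtype.ext (funext fun _ => mul_add _ _ _))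
      (fun _ _ _ => Subtype.ext (funext fun _ => mul_left_comm _ _ _))))
    ((Fintype.linearCombination ℂ fun ij : ι × κ => toFixedVec P hP (Pi.single ij.1 1) ⊗ₜ[ℂ]
      toFixedVec Q hQ (Pi.single ij.2 1)) ∘ₗ (fixedVec (P ⊗ₖ Q)).subtype)
    (LinearMap.ext fun u => Subtype.ext <| by
      have hu : (P ⊗ₖ Q) *ᵥ u.1 = u.1 := u.2
      rw [LinearMap.comp_apply, LinearMap.comp_apply, Submodule.subtype_apply,
        Fintype.linearCombination_apply, map_sum, LinearMap.id_apply]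
      conv_rhs => rw [← hu]
      ext ⟨k, l⟩
      rw [Submodule.coe_sum, Finset.sum_apply]
      refine Finset.sum_congr rfl fun ij _ => ?_
      rw [map_smul, TensorProduct.lift.tmul, LinearMap.mk₂_apply]
      change u.1 ij * ((P *ᵥ Pi.single ij.1 1) k * (Q *ᵥ Pi.single ij.2 1) l) = _
      simp [mul_comm])
    (TensorProduct.ext' fun v w => by
      rw [LinearMap.comp_apply, LinearMap.comp_apply, Submodule.subtype_apply,
        TensorProduct.lift.tmul, LinearMap.mk₂_apply, Fintype.linearCombination_apply,
        LinearMap.id_apply]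
      have h : ∀ (ν : Type) [Fintype ν] [DecidableEq ν] (R : Matrix ν ν ℂ) (hR : R * R = R)
          (r : fixedVec R), r = ∑ i, r.1 i • toFixedVec R hR (Pi.single i 1) := by
        intro ν _ _ R hR r
        conv_lhs => rw [← toFixedVec_coe R hR r, pi_eq_sum_univ' r.1]
        simp [map_sum, map_smul]
      conv_rhs => rw [h ι P hP v, h κ Q hQ w, TensorProduct.sum_tmul]
      rw [Fintype.sum_prod_type]
      refine Finset.sum_congr rfl fun i _ => ?_
      rw [TensorProduct.tmul_sum]
      refine Finset.sum_congr rfl fun j _ => ?_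
      rw [TensorProduct.smul_tmul_smul])

namespace ProjFamily

variable {ρ : MatRep G ι} {ρ' : MatRep G κ} [IsTopologicalGroup G]

theorem cls_kron (P : ProjFamily X ρ) (Q : ProjFamily X ρ') :
    (P.kron Q).cls = P.cls * Q.cls := by
  refine Eq.symm ((KG_mk_tensor _ _).symm.trans ?_)
  refine KG_mk_eq (E := GVectorBundle.tensor P.bundle Q.bundle) (F := (P.kron Q).bundle)
    (Iso.ofContinuousFamily
      (fun x => fixedVecTensor (P.proj x) (Q.proj x) (P.idem x) (Q.idem x)) ?_ ?_)
  · rintro g x _ rfl v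
    refine LinearMap.congr_fun (f := (fixedVecTensor (P.proj (g • x)) (Q.proj (g • x))
      (P.idem _) (Q.idem _)).toLinearMap ∘ₗ TensorProduct.map (P.bundle.act g x _ rfl)
        (Q.bundle.act g x _ rfl)) (g := (P.kron Q).bundle.act g x _ rfl ∘ₗ
        (fixedVecTensor (P.proj x) (Q.proj x) (P.idem x) (Q.idem x)).toLinearMap)
      (TensorProduct.ext' ?_) v
    intro v w
    refine Subtype.ext ?_
    exact (kronecker_mulVec (ρ.toHom g) (ρ'.toHom g) v.1 w.1).symm
  · refine (P.kron Q).continuousFamily_to ?_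
    rintro a ⟨i, j⟩
    refine Continuous.congr (f := fun x : {x // x ∈ P.nhd a ∩ Q.nhd a} => fun ij : ι × κ =>
      (P.localFrame a x.1 x.2.1 i).1 ij.1 * (Q.localFrame a x.1 x.2.2 j).1 ij.2) ?_ fun x => ?_
    rotate_left
    · exact Eq.symm <| congrArg (fun v => (fixedVecTensor (P.proj x.1) (Q.proj x.1) (P.idem _)
        (Q.idem _)
        v).1) (tensor_frame P.bundle Q.bundle a x.1 x.2 i j)
    · have h₁ := P.continuous_localFrame (W := {x // x ∈ P.nhd a ∩ Q.nhd a}) a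
        continuous_subtype_val (fun x => x.2.1) i
      have h₂ := Q.continuous_localFrame (W := {x // x ∈ P.nhd a ∩ Q.nhd a}) a
        continuous_subtype_val (fun x => x.2.2) j
      exact continuous_pi fun ij => ((continuous_apply ij.1).comp h₁).mul
        ((continuous_apply ij.2).comp h₂)

end ProjFamily

variable [IsTopologicalGroup G]

/-- The class of a matrix representation in the representation ring. -/
noncomputable def MatRep.cls (ρ : MatRep G ι) : RepRing G := (ProjFamily.one Unit ρ).cls

variable (X) in
/-- The classes of product bundles. -/
noncomputable abbrev constClass : RepRing G →+* KG G X := KG.pullback (GMap.toPoint G X)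

theorem ProjFamily.cls_one (ρ : MatRep G ι) :
    (ProjFamily.one X ρ).cls = constClass X ρ.cls :=
  (pullback_cls (ProjFamily.one Unit ρ) (GMap.toPoint G X)).symm

/-- A product bundle is the bundle of ranges of a constant family, for the matrices of the
representation in a basis. -/
theorem mk_ofRep {V : Type} [AddCommGroup V] [Module ℂ V] [Module.Finite ℂ V]
    (α : G →* (V →ₗ[ℂ] V)) (hα : ∀ (v : V) (l : V →ₗ[ℂ] ℂ), Continuous fun g => l (α g v))
    (ρ : MatRep G ι) (b : Module.Basis ι ℂ V) (h : ∀ g, ρ.toHom g = LinearMap.toMatrix b b (α g)) :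
    KG.mk (ofRep X V α hα) = (ProjFamily.one X ρ).cls := by
  refine KG_mk_eq (E := ofRep X V α hα) (F := (ProjFamily.one X ρ).bundle)
    (Iso.ofContinuousFamily (fun x => b.equivFun.trans (LinearEquiv.ofTop (fixedVec _)
      (eq_top_iff.2 fun v _ => one_mulVec v)).symm) ?_ ?_)
  · intro g x y _ v
    refine Subtype.ext ?_
    change b.equivFun (α g v) = ρ.toHom g *ᵥ b.equivFun v
    rw [h]
    exact (LinearMap.toMatrix_mulVec_repr b b (α g) v).symm
  · exact (ProjFamily.one X ρ).continuousFamily_to fun a i =>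
      continuous_const (y := b.equivFun (Module.finBasis ℂ V i))

theorem mk_ofRep_unit {V : Type} [AddCommGroup V] [Module ℂ V] [Module.Finite ℂ V]
    (α : G →* (V →ₗ[ℂ] V)) (hα : ∀ (v : V) (l : V →ₗ[ℂ] ℂ), Continuous fun g => l (α g v))
    (ρ : MatRep G ι) (b : Module.Basis ι ℂ V) (h : ∀ g, ρ.toHom g = LinearMap.toMatrix b b (α g)) :
    KG.mk (ofRep Unit V α hα) = ρ.cls :=
  mk_ofRep α hα ρ b h

end ProjectionClasses

/-! ### Homotopy invariance, and Clifford families -/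

section CliffordFamilies

open GVectorBundle
open scoped Kronecker

variable {G : Type v} {X : Type u} {Y : Type w} [Group G] [TopologicalSpace G]
  [IsTopologicalGroup G]
  [TopologicalSpace X] [MulAction G X] [TopologicalSpace Y] [MulAction G Y]

variable {ι κ : Type} [Fintype ι] [DecidableEq ι] [Fintype κ] [DecidableEq κ]

namespace ProjFamily

variable {ρ : MatRep G ι} {ρ' : MatRep G κ}

theorem cls_congr {P Q : ProjFamily X ρ} (h : ∀ x, P.proj x = Q.proj x) : P.cls = Q.cls := by
  obtain ⟨p, _, _, _⟩ := P
  obtain ⟨q, _, _, _⟩ := Q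
  obtain rfl : p = q := funext h
  rfl

/-- Homotopy invariance: over a compact base, the comparison of nearby members of a homotopy of
idempotents is invertible everywhere, so the class is locally constant along the homotopy. -/
theorem cls_eq_of_homotopy [CompactSpace X] (F : unitInterval → ProjFamily X ρ)
    (hF : Continuous fun p : unitInterval × X => (F p.1).proj p.2) : (F 0).cls = (F 1).cls := by
  have hc : IsLocallyConstant fun s => (F s).cls := by
    rw [IsLocallyConstant.iff_eventually_eq]
    intro s
    have hd : Continuous fun p : unitInterval × X =>
        (transport ((F s).proj p.2) ((F p.1).proj p.2)).det := by
      have h₁ : Continuous fun p : unitInterval × X => (F s).proj p.2 :=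
        (F s).continuous_proj.comp continuous_snd
      refine Continuous.matrix_det ?_
      unfold transport
      fun_prop
    have hev : ∀ᶠ s' in nhds s, ∀ x ∈ (Set.univ : Set X),
        (transport ((F s).proj x) ((F s').proj x)).det ≠ 0 := by
      refine isCompact_univ.eventually_forall_of_forall_eventually fun x _ => ?_
      refine hd.continuousAt.eventually_ne ?_
      rw [transport_self ((F s).idem x), det_one]
      exact one_ne_zero
    filter_upwards [hev] with s' hs'
    have hU : ∀ x, IsUnit (transport ((F s).proj x) ((F s').proj x)).det :=
      fun x => isUnit_iff_ne_zero.2 (hs' x trivial)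
    have h₁ := fun x => transport_mul ((F s).idem x) ((F s').idem x)
    have h₂ := fun x => inv_transport_mul ((F s).idem x) ((F s').idem x) (hs' x trivial)
    refine Eq.symm (cls_eq_of_intertwine (F s) (F s')
      (T := fun x => transport ((F s).proj x) ((F s').proj x))
      (T' := fun x => (transport ((F s).proj x) ((F s').proj x))⁻¹) ?_ ?_ ?_ ?_ ?_ ?_)
    · have h₁ := (F s).continuous_proj
      have h₂ := (F s').continuous_proj
      unfold transport
      fun_prop
    · intro x
      rw [mul_assoc, h₁, ← mul_assoc, (F s').idem]
    · intro x
      rw [mul_assoc, h₂, ← mul_assoc, (F s).idem]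
    · intro x
      rw [nonsing_inv_mul _ (hU x), one_mul]
    · intro x
      rw [mul_nonsing_inv _ (hU x), one_mul]
    · intro g x
      have e₁ := (F s).equivariant g x
      have e₂ := (F s').equivariant g x
      have e₃ : ρ.toHom g * (1 - (F s).proj x) = (1 - (F s).proj (g • x)) * ρ.toHom g := by
        rw [mul_sub, sub_mul, e₁, mul_one, one_mul]
      have e₄ : ρ.toHom g * (1 - (F s').proj x) = (1 - (F s').proj (g • x)) * ρ.toHom g := by
        rw [mul_sub, sub_mul, e₂, mul_one, one_mul]
      unfold transport
      rw [mul_add, add_mul, ← mul_assoc, ← mul_assoc, e₂, e₄, mul_assoc, mul_assoc, e₁, e₃,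
        mul_assoc, mul_assoc]
  exact hc.apply_eq_of_isPreconnected isPreconnected_univ trivial trivial

end ProjFamily

/-- A continuous equivariant family of matrices whose squares are scalars, as is Clifford
multiplication whose square is a non-negative function `sq`. -/
structure CliffordFamily (X : Type u) [TopologicalSpace X] [MulAction G X] (ρ : MatRep G ι) where
  op : X → Matrix ι ι ℂ
  continuous_op : Continuous op
  sq : X → ℝ
  continuous_sq : Continuous sq
  sq_nonneg : ∀ x, 0 ≤ sq x
  op_mul_op : ∀ x, op x * op x = (sq x : ℂ) • 1
  equivariant : ∀ g x, ρ.toHom g * op x = op (g • x) * ρ.toHom g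
  sq_smul : ∀ (g : G) x, sq (g • x) = sq x

namespace CliffordFamily

variable {ρ : MatRep G ι} {ν₀ ν₁ : MatRep G κ}

/-- The projections to the positive eigenspaces of an invertible Clifford family. -/
noncomputable def toProj (A : CliffordFamily X ρ) (hA : ∀ x, 0 < A.sq x) : ProjFamily X ρ where
  proj x := (2⁻¹ : ℂ) • (1 + ((√(A.sq x) : ℝ) : ℂ)⁻¹ • A.op x)
  continuous_proj := by
    have h₁ := A.continuous_op
    have h₂ : Continuous fun x => ((√(A.sq x) : ℝ) : ℂ)⁻¹ :=
      (Complex.continuous_ofReal.comp (Real.continuous_sqrt.comp A.continuous_sq)).inv₀ fun x => by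
        exact Complex.ofReal_ne_zero.2 (Real.sqrt_pos.2 (hA x)).ne'
    fun_prop
  idem x := by
    have h : ((√(A.sq x) : ℝ) : ℂ)⁻¹ * ((√(A.sq x) : ℝ) : ℂ)⁻¹ * A.sq x = 1 := by
      have h₁ : (√(A.sq x))⁻¹ * (√(A.sq x))⁻¹ * A.sq x = 1 := by
        rw [← mul_inv, Real.mul_self_sqrt (hA x).le, inv_mul_cancel₀ (hA x).ne']
      exact_mod_cast h₁
    have h₂ : (((√(A.sq x) : ℝ) : ℂ)⁻¹ • A.op x) * (((√(A.sq x) : ℝ) : ℂ)⁻¹ • A.op x) = 1 := by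
      rw [smul_mul_smul_comm, A.op_mul_op, smul_smul, h, one_smul]
    rw [smul_mul_smul_comm, mul_add, add_mul, add_mul, h₂, one_mul, mul_one, one_mul]
    module
  equivariant g x := by
    rw [A.sq_smul, mul_smul_comm, smul_mul_assoc, mul_add, add_mul, mul_smul_comm,
      smul_mul_assoc, A.equivariant, mul_one, one_mul]

/-- The pullback of a Clifford family. -/
def comp (A : CliffordFamily X ρ) (f : GMap G Y X) : CliffordFamily Y ρ where
  op y := A.op (f y)
  continuous_op := A.continuous_op.comp f.continuous
  sq y := A.sq (f y)
  continuous_sq := A.continuous_sq.comp f.continuous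
  sq_nonneg y := A.sq_nonneg (f y)
  op_mul_op y := A.op_mul_op (f y)
  equivariant g y := (A.equivariant g (f y)).trans
    (congrArg (fun x => A.op x * ρ.toHom g) (f.map_smul' g y).symm)
  sq_smul g y := (congrArg A.sq (f.map_smul' g y)).trans (A.sq_smul g (f y))

/-- The graded tensor product of a Clifford family with an odd Clifford family
`c : N₀ → N₁`, `c' : N₁ → N₀` on a graded representation. -/
def step (A : CliffordFamily X ρ) (c c' : X → Matrix κ κ ℂ) (hc : Continuous c)
    (hc' : Continuous c') (q : X → ℝ) (hq : Continuous q) (hq₀ : ∀ x, 0 ≤ q x)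
    (h₁ : ∀ x, c' x * c x = (q x : ℂ) • 1) (h₂ : ∀ x, c x * c' x = (q x : ℂ) • 1)
    (e₁ : ∀ g x, ν₁.toHom g * c x = c (g • x) * ν₀.toHom g)
    (e₂ : ∀ g x, ν₀.toHom g * c' x = c' (g • x) * ν₁.toHom g)
    (hqs : ∀ (g : G) x, q (g • x) = q x) :
    CliffordFamily X ((ρ.kron ν₀).sum (ρ.kron ν₁)) where
  op x := fromBlocks (A.op x ⊗ₖ 1) (1 ⊗ₖ c' x) (1 ⊗ₖ c x) (-(A.op x ⊗ₖ 1))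
  continuous_op := by
    have h := MatRep.continuous_kronecker (κ := κ) A.continuous_op continuous_const (B := fun _ =>
        1)
    exact h.matrix_fromBlocks (MatRep.continuous_kronecker continuous_const hc')
      (MatRep.continuous_kronecker continuous_const hc) h.neg
  sq x := A.sq x + q x
  continuous_sq := A.continuous_sq.add hq
  sq_nonneg x := add_nonneg (A.sq_nonneg x) (hq₀ x)
  op_mul_op x := by
    have hs : ∀ (a : ℂ) , (a • (1 : Matrix ι ι ℂ)) ⊗ₖ (1 : Matrix κ κ ℂ) = a • 1 := fun a => by
      rw [smul_kronecker, one_kronecker_one]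
    have hs' : ∀ (a : ℂ) , (1 : Matrix ι ι ℂ) ⊗ₖ (a • (1 : Matrix κ κ ℂ)) = a • 1 := fun a => by
      rw [kronecker_smul, one_kronecker_one]
    rw [fromBlocks_multiply]
    simp only [neg_mul, mul_neg, neg_neg, ← mul_kronecker_mul, one_mul, mul_one, A.op_mul_op, h₁,
      h₂, hs, hs', ← sub_eq_add_neg, sub_self]
    rw [← fromBlocks_one, fromBlocks_smul, ← add_smul, ← add_smul, smul_zero,
      add_comm (q x : ℂ), Complex.ofReal_add]
  equivariant g x := by
    change fromBlocks (_ ⊗ₖ _) 0 0 (_ ⊗ₖ _) * fromBlocks _ _ _ _ =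
      fromBlocks _ _ _ _ * fromBlocks (_ ⊗ₖ _) 0 0 (_ ⊗ₖ _)
    simp only [fromBlocks_multiply, Matrix.zero_mul, Matrix.mul_zero, add_zero, zero_add, mul_neg,
      neg_mul, ← mul_kronecker_mul, A.equivariant, e₁, e₂, one_mul, mul_one, neg_zero]
  sq_smul g x := by rw [A.sq_smul, hqs]

/-- Where the odd Clifford family vanishes, the class of a graded tensor product is determined by
the classes of its factors. -/
theorem cls_fromBlocks (P : ProjFamily X ρ) (Q : ProjFamily X ((ρ.kron ν₀).sum (ρ.kron ν₁)))
    (h : ∀ x, Q.proj x = fromBlocks (P.proj x ⊗ₖ 1) 0 0 ((1 - P.proj x) ⊗ₖ 1)) :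
    Q.cls = P.cls * constClass X (ν₀.cls - ν₁.cls) + constClass X (ρ.cls * ν₁.cls) := by
  have h₁ : Q.cls = ((P.kron (ProjFamily.one X ν₀)).sum
      (P.compl.kron (ProjFamily.one X ν₁))).cls := ProjFamily.cls_congr h
  rw [h₁, ProjFamily.cls_sum, ProjFamily.cls_kron, ProjFamily.cls_kron,
    eq_sub_of_add_eq' P.cls_add_cls_compl, ProjFamily.cls_one, ProjFamily.cls_one,
    ProjFamily.cls_one, map_sub, map_mul]
  ring

variable {ρ' : MatRep G κ}

theorem pullback_cls (A : CliffordFamily X ρ) (hA : ∀ x, 0 < A.sq x) (f : GMap G Y X) :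
    KG.pullback f (A.toProj hA).cls = ((A.comp f).toProj fun y => hA (f y)).cls :=
  ProjFamily.pullback_cls _ f

theorem cls_eq_of_conj (A : CliffordFamily X ρ) (B : CliffordFamily X ρ') (hA : ∀ x, 0 < A.sq x)
    (hB : ∀ x, 0 < B.sq x) (hAB : ∀ x, A.sq x = B.sq x) (T : Matrix κ ι ℂ)
    (T' : Matrix ι κ ℂ) (h₁ : T' * T = 1) (h₂ : T * T' = 1)
    (h : ∀ x, T * A.op x = B.op x * T) (hρ : ∀ g, ρ'.toHom g * T = T * ρ.toHom g) :
    (A.toProj hA).cls = (B.toProj hB).cls := by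
  refine ProjFamily.cls_eq_of_conj _ _ T T' h₁ h₂ (fun x => ?_) hρ
  simp only [toProj, Matrix.mul_smul, Matrix.smul_mul, Matrix.mul_add, Matrix.add_mul, h, hAB,
    Matrix.mul_one, Matrix.one_mul]

/-- Where the odd family vanishes, a graded tensor product with `ν₀ ⊕ ν₁` is `A ⊕ -A`, so its class
    is
that of `A` times `[ν₀] - [ν₁]`, up to a product bundle. -/
theorem cls_of_fromBlocks (A : CliffordFamily X ρ)
    (B : CliffordFamily X ((ρ.kron ν₀).sum (ρ.kron ν₁))) (hA : ∀ x, 0 < A.sq x)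
    (hB : ∀ x, 0 < B.sq x) (hAB : ∀ x, B.sq x = A.sq x)
    (h : ∀ x, B.op x = fromBlocks (A.op x ⊗ₖ 1) 0 0 (-(A.op x ⊗ₖ 1))) :
    (B.toProj hB).cls = (A.toProj hA).cls * constClass X (ν₀.cls - ν₁.cls) +
      constClass X (ρ.cls * ν₁.cls) := by
  refine cls_fromBlocks _ _ fun x => ?_
  have h₁ : (1 : Matrix ι ι ℂ) - (2⁻¹ : ℂ) • (1 + ((√(A.sq x) : ℝ) : ℂ)⁻¹ • A.op x) =
      (2⁻¹ : ℂ) • (1 + (-((√(A.sq x) : ℝ) : ℂ)⁻¹) • A.op x) := by module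
  simp only [toProj, h, hAB, h₁, smul_kronecker, add_kronecker, one_kronecker_one]
  rw [← fromBlocks_one, fromBlocks_smul, fromBlocks_add, fromBlocks_smul]
  simp

end CliffordFamily

theorem MatRep.cls_triv_unit : (MatRep.triv G Unit).cls = 1 := by
  refine Eq.symm (KG_mk_eq (E := (GVectorBundle.one : GVectorBundle G Unit))
    (F := (ProjFamily.one Unit (MatRep.triv G Unit)).bundle) (Iso.ofContinuousFamily
      (fun x => (LinearEquiv.funUnique Unit ℂ ℂ).symm.trans (LinearEquiv.ofTop (fixedVec _)
      (eq_top_iff.2 fun v _ => one_mulVec v)).symm) ?_ ?_))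
  · intro g x y _ v
    refine Subtype.ext ?_
    change _ = (1 : Matrix Unit Unit ℂ) *ᵥ _
    rw [one_mulVec]
    rfl
  · exact (ProjFamily.one Unit (MatRep.triv G Unit)).continuousFamily_to fun a i => continuous_const
      (y := fun _ => (Module.Basis.singleton Unit ℂ i))

theorem MatRep.cls_triv_two : (MatRep.triv G (Unit ⊕ Unit)).cls = 2 := by
  have h : (ProjFamily.one Unit (MatRep.triv G (Unit ⊕ Unit))).cls =
      ((ProjFamily.one Unit (MatRep.triv G Unit)).sum
        (ProjFamily.one Unit (MatRep.triv G Unit))).cls := by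
    refine ProjFamily.cls_eq_of_conj _ _ 1 1 (one_mul 1) (one_mul 1) (fun x => ?_) fun g => ?_
    · simp [ProjFamily.one, ProjFamily.sum]
    · simp [MatRep.triv, MatRep.sum]
  refine h.trans ?_
  rw [ProjFamily.cls_sum, ← one_add_one_eq_two]
  exact congrArg₂ _ MatRep.cls_triv_unit MatRep.cls_triv_unit

end CliffordFamilies

/-! ### Clifford multiplication on the exterior algebra -/

section ExteriorAlgebra

open GVectorBundle
open scoped Kronecker

variable {t : ℕ}

/-- The exterior algebra of `ℂ^t`. -/
abbrev ExtAlg (t : ℕ) : Type := ExteriorAlgebra ℂ (Fin t → ℂ)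

instance : Module.Finite ℂ (ExtAlg t) := exteriorAlgebra_finite t

/-- The grading operator of the exterior algebra. -/
noncomputable def extSign (t : ℕ) : ExtAlg t →ₗ[ℂ] ExtAlg t :=
  (CliffordAlgebra.involute (Q := (0 : QuadraticForm ℂ (Fin t → ℂ)))).toLinearMap

theorem extSign_extSign (x : ExtAlg t) : extSign t (extSign t x) = x :=
  CliffordAlgebra.involute_involute x

theorem extSign_ι_mul (v : Fin t → ℂ) (x : ExtAlg t) :
    extSign t (ExteriorAlgebra.ι ℂ v * x) = -(ExteriorAlgebra.ι ℂ v * extSign t x) := by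
  change CliffordAlgebra.involute (CliffordAlgebra.ι 0 v * x) =
    -(CliffordAlgebra.ι 0 v * CliffordAlgebra.involute x)
  rw [map_mul, CliffordAlgebra.involute_ι, neg_mul]

theorem extSign_contractLeft (d : Module.Dual ℂ (Fin t → ℂ)) (x : ExtAlg t) :
    extSign t (CliffordAlgebra.contractLeft d x) =
      -CliffordAlgebra.contractLeft d (extSign t x) := by
  induction x using CliffordAlgebra.left_induction with
  | algebraMap r =>
    have h : extSign t (algebraMap ℂ _ r) = algebraMap ℂ _ r :=
      (CliffordAlgebra.involute (Q := (0 : QuadraticForm ℂ (Fin t → ℂ)))).commutes r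
    erw [h, CliffordAlgebra.contractLeft_algebraMap, map_zero, neg_zero]
  | add x y hx hy => rw [map_add, map_add, map_add, map_add, hx, hy, neg_add]
  | ι_mul x v hx =>
    have h₁ := extSign_ι_mul v x
    have h₂ := extSign_ι_mul v (CliffordAlgebra.contractLeft d x)
    unfold ExteriorAlgebra.ι at h₁ h₂
    rw [CliffordAlgebra.contractLeft_ι_mul, map_sub, map_smul, h₂, hx, h₁, map_neg,
      CliffordAlgebra.contractLeft_ι_mul, mul_neg]
    abel

theorem extSign_koszul (v : Fin t → ℂ) (x : ExtAlg t) :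
    extSign t (koszul v x) = -koszul v (extSign t x) := by
  change extSign t (ExteriorAlgebra.ι ℂ v * x + CliffordAlgebra.contractLeft (hermDual v) x) =
    -(ExteriorAlgebra.ι ℂ v * extSign t x + CliffordAlgebra.contractLeft (hermDual v) (extSign t x))
  rw [map_add, extSign_ι_mul, extSign_contractLeft, neg_add]

/-- The squared Euclidean norm on `ℂ^t`. -/
noncomputable def sqNorm (v : Fin t → ℂ) : ℝ := ∑ k, ‖v k‖ ^ 2

theorem sqNorm_nonneg (v : Fin t → ℂ) : 0 ≤ sqNorm v := Finset.sum_nonneg fun _ _ => by positivity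

theorem continuous_sqNorm : Continuous (sqNorm : (Fin t → ℂ) → ℝ) := by
  unfold sqNorm; fun_prop

theorem sqNorm_eq_zero {v : Fin t → ℂ} : sqNorm v = 0 ↔ v = 0 := by
  rw [sqNorm, Finset.sum_eq_zero_iff_of_nonneg fun _ _ => by positivity, funext_iff]
  simp

theorem sqNorm_smul (c : ℂ) (v : Fin t → ℂ) : sqNorm (c • v) = ‖c‖ ^ 2 * sqNorm v := by
  simp [sqNorm, mul_pow, Finset.mul_sum]

theorem herm_eq_sqNorm (v : Fin t → ℂ) : herm v = (sqNorm v : ℂ) := by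
  simp [herm, hermDual, sqNorm, Complex.conj_mul']

/-- Clifford multiplication by a vector `(s, v)` of `ℝ ⊕ ℂ^t` on the exterior algebra. -/
noncomputable def cliff (s : ℝ) (v : Fin t → ℂ) : ExtAlg t →ₗ[ℂ] ExtAlg t :=
  (s : ℂ) • extSign t + koszul v

theorem cliff_apply (s : ℝ) (v : Fin t → ℂ) (x : ExtAlg t) :
    cliff s v x = (s : ℂ) • extSign t x + koszul v x := rfl

/-- Wedge and contraction anticommute with the grading operator, so `(s, v)` has square
`s² + |v|²`. -/
theorem cliff_cliff (s : ℝ) (v : Fin t → ℂ) (x : ExtAlg t) :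
    cliff s v (cliff s v x) = ((s ^ 2 + sqNorm v : ℝ) : ℂ) • x := by
  simp only [cliff_apply, map_add, map_smul, extSign_koszul, extSign_extSign, koszul_koszul,
    herm_eq_sqNorm]
  push_cast
  module

variable (t) in
/-- A basis of the exterior algebra. -/
noncomputable def extBasis : Module.Basis (Fin (Module.finrank ℂ (ExtAlg t))) ℂ (ExtAlg t) :=
  Module.finBasis ℂ (ExtAlg t)

variable (t) in
/-- The matrix of an operator on the exterior algebra. -/
noncomputable def extMat : (ExtAlg t →ₗ[ℂ] ExtAlg t) ≃ₐ[ℂ]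
    Matrix (Fin (Module.finrank ℂ (ExtAlg t))) (Fin (Module.finrank ℂ (ExtAlg t))) ℂ :=
  LinearMap.toMatrixAlgEquiv (extBasis t)

theorem extMat_sign_mul_sign : extMat t (extSign t) * extMat t (extSign t) = 1 := by
  rw [← map_mul, ← map_one (extMat t)]
  exact congrArg _ (LinearMap.ext extSign_extSign)

theorem continuous_extMat_koszul : Continuous fun v : Fin t → ℂ => extMat t (koszul v) := by
  let l : (Fin t → ℂ) →ₗ[ℝ] Matrix (Fin (Module.finrank ℂ (ExtAlg t)))
      (Fin (Module.finrank ℂ (ExtAlg t))) ℂ :=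
    { toFun := fun v => extMat t (koszul v)
      map_add' := fun u v => by rw [koszul_add, map_add]
      map_smul' := fun r v => by
        have h : r • v = (r : ℂ) • v := (Complex.coe_smul r v).symm
        rw [h, koszul_smul (Complex.conj_ofReal r), map_smul]
        exact Complex.coe_smul r _ }
  exact LinearMap.continuous_of_finiteDimensional l

theorem signC_eq (g : Pin2) : Pin2.signC g = 1 ∨ Pin2.signC g = -1 := by
  rcases Int.units_eq_one_or (Pin2.sign g) with h | h <;> simp [Pin2.signC, h]

variable (t) in
/-- The action of `Pin(2)` on the exterior algebra of `ℂ̃^t`. -/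
noncomputable def extRep : MatRep Pin2 (Fin (Module.finrank ℂ (ExtAlg t))) where
  toHom :=
    { toFun := fun g => ((1 + Pin2.signC g) / 2) • 1 +
        ((1 - Pin2.signC g) / 2) • extMat t (extSign t)
      map_one' := by simp [Pin2.signC_one]
      map_mul' := fun g h => by
        rw [Pin2.signC_mul]
        rcases signC_eq g with hg | hg <;> rcases signC_eq h with hh | hh <;>
          simp [hg, hh, extMat_sign_mul_sign] }
  continuous_toHom := by
    have := Pin2.continuous_signC
    change Continuous fun g => ((1 + Pin2.signC g) / 2) • (1 : Matrix _ _ ℂ) +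
        ((1 - Pin2.signC g) / 2) • extMat t (extSign t)
    fun_prop

variable (t) in
/-- The operator by which an element of `Pin(2)` acts on the exterior algebra of `ℂ̃^t`. -/
noncomputable def extAct (g : Pin2) : ExtAlg t →ₗ[ℂ] ExtAlg t :=
  ((1 + Pin2.signC g) / 2) • 1 + ((1 - Pin2.signC g) / 2) • extSign t

theorem extRep_apply (g : Pin2) : (extRep t).toHom g = extMat t (extAct t g) := by
  simp [extRep, extAct]

theorem extAct_of_one {g : Pin2} (hg : Pin2.signC g = 1) : extAct t g = 1 := by
  simp [extAct, hg]

theorem extAct_of_neg_one {g : Pin2} (hg : Pin2.signC g = -1) : extAct t g = extSign t := by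
  simp [extAct, hg]

theorem extAct_cliff (g : Pin2) (s : ℝ) (v : Fin t → ℂ) :
    extAct t g * cliff s v = cliff s (Pin2.signC g • v) * extAct t g := by
  rcases signC_eq g with hg | hg
  · rw [extAct_of_one hg, hg, one_smul, mul_one, one_mul]
  · rw [extAct_of_neg_one hg, hg]
    refine LinearMap.ext fun x => ?_
    have h : koszul ((-1 : ℂ) • v) = (-1 : ℂ) • koszul v := koszul_smul (by simp) v
    simp only [Module.End.mul_apply, cliff_apply, map_add, map_smul, extSign_extSign,
      extSign_koszul, h]
    simp

end ExteriorAlgebra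

/-! ### Classes of maps to `ℝ ⊕ ℂ̃^t` -/

/-- A continuous equivariant map from a `Pin(2)`-space to `ℝ ⊕ ℂ̃^t`. -/
structure SignMap (Y : Type u) [TopologicalSpace Y] [MulAction Pin2 Y] (t : ℕ) where
  re : Y → ℝ
  vec : Y → Fin t → ℂ
  continuous_re : Continuous re
  continuous_vec : Continuous vec
  re_smul : ∀ (g : Pin2) y, re (g • y) = re y
  vec_smul : ∀ (g : Pin2) y, vec (g • y) = Pin2.signC g • vec y

namespace SignMap

open GVectorBundle
open scoped Kronecker

variable {X : Type u} {Y : Type w} [TopologicalSpace X] [MulAction Pin2 X] [TopologicalSpace Y]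
  [MulAction Pin2 Y] {t : ℕ}

/-- The squared norm of the value at `y`. -/
noncomputable def sq (q : SignMap Y t) (y : Y) : ℝ := q.re y ^ 2 + sqNorm (q.vec y)

theorem sq_pos_iff (q : SignMap Y t) (y : Y) : 0 < q.sq y ↔ q.re y ≠ 0 ∨ q.vec y ≠ 0 := by
  have h₁ := sq_nonneg (q.re y)
  have h₂ := sqNorm_nonneg (q.vec y)
  rw [sq, (add_nonneg h₁ h₂).lt_iff_ne', ne_eq, add_eq_zero_iff_of_nonneg h₁ h₂, sqNorm_eq_zero,
    pow_eq_zero_iff two_ne_zero]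
  tauto

/-- Clifford multiplication by the values of an equivariant map. -/
noncomputable def clifford (q : SignMap Y t) : CliffordFamily Y (extRep t) where
  op y := extMat t (cliff (q.re y) (q.vec y))
  continuous_op := by
    have h₁ := continuous_extMat_koszul.comp q.continuous_vec
    have h₂ := Complex.continuous_ofReal.comp q.continuous_re
    have h : ∀ y, extMat t (cliff (q.re y) (q.vec y)) =
        (q.re y : ℂ) • extMat t (extSign t) + extMat t (koszul (q.vec y)) := fun y => by
      rw [cliff, map_add, map_smul]
    exact (continuous_congr h).2 ((h₂.smul continuous_const).add h₁)
  sq := q.sq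
  continuous_sq := (q.continuous_re.pow 2).add (continuous_sqNorm.comp q.continuous_vec)
  sq_nonneg y := add_nonneg (sq_nonneg _) (sqNorm_nonneg _)
  op_mul_op y := by
    rw [← map_mul, ← map_one (extMat t), ← map_smul]
    exact congrArg _ (LinearMap.ext fun x => cliff_cliff _ _ x)
  equivariant g y := by
    rw [extRep_apply, ← map_mul, extAct_cliff, map_mul, q.re_smul, q.vec_smul]
  sq_smul g y := by
    have : ‖Pin2.signC g‖ = 1 := by rcases signC_eq g with h | h <;> simp [h]
    rw [sq, sq, q.re_smul, q.vec_smul, sqNorm_smul, this, one_pow, one_mul]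

/-- The K-theory class of a nowhere vanishing equivariant map to `ℝ ⊕ ℂ̃^t`: the bundle of positive
eigenspaces of Clifford multiplication on the exterior algebra. -/
noncomputable def cls (q : SignMap Y t) (h : ∀ y, 0 < q.sq y) : KG Pin2 Y :=
  (q.clifford.toProj h).cls

/-- The composition with an equivariant map. -/
def comp (q : SignMap X t) (f : GMap Pin2 Y X) : SignMap Y t where
  re y := q.re (f y)
  vec y := q.vec (f y)
  continuous_re := q.continuous_re.comp f.continuous
  continuous_vec := q.continuous_vec.comp f.continuous
  re_smul g y := (congrArg q.re (f.map_smul' g y)).trans (q.re_smul g (f y))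
  vec_smul g y := (congrArg q.vec (f.map_smul' g y)).trans (q.vec_smul g (f y))

theorem pullback_cls (q : SignMap X t) (h : ∀ x, 0 < q.sq x) (f : GMap Pin2 Y X) :
    KG.pullback f (q.cls h) = (q.comp f).cls fun y => h (f y) :=
  q.clifford.pullback_cls h f

theorem cls_eq_of_homotopy [CompactSpace Y] (F : unitInterval → SignMap Y t)
    (hre : Continuous fun p : unitInterval × Y => (F p.1).re p.2)
    (hvec : Continuous fun p : unitInterval × Y => (F p.1).vec p.2)
    (h : ∀ s y, 0 < (F s).sq y) : (F 0).cls (h 0) = (F 1).cls (h 1) := by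
  refine ProjFamily.cls_eq_of_homotopy (fun s => (F s).clifford.toProj (h s)) ?_
  have h₁ : Continuous fun p : unitInterval × Y => extMat t (koszul ((F p.1).vec p.2)) :=
    continuous_extMat_koszul.comp hvec
  have h₂ : Continuous fun p : unitInterval × Y => ((F p.1).re p.2 : ℂ) :=
    Complex.continuous_ofReal.comp hre
  have h₃ : Continuous fun p : unitInterval × Y => ((√((F p.1).sq p.2) : ℝ) : ℂ)⁻¹ := by
    refine (Complex.continuous_ofReal.comp (Real.continuous_sqrt.comp
      ((hre.pow 2).add (continuous_sqNorm.comp hvec)))).inv₀ fun p => ?_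
    exact Complex.ofReal_ne_zero.2 (Real.sqrt_pos.2 (h p.1 p.2)).ne'
  have e : ∀ p : unitInterval × Y, ((F p.1).clifford.toProj (h p.1)).proj p.2 =
      (2⁻¹ : ℂ) • (1 + ((√((F p.1).sq p.2) : ℝ) : ℂ)⁻¹ • (((F p.1).re p.2 : ℂ) •
        extMat t (extSign t) + extMat t (koszul ((F p.1).vec p.2)))) := fun p => by
    rw [← map_smul, ← map_add]
    rfl
  refine (continuous_congr e).2 ?_
  fun_prop

/-- Reflection in the real coordinate. -/
def reflect (q : SignMap Y t) : SignMap Y t where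
  re y := -q.re y
  vec := q.vec
  continuous_re := q.continuous_re.neg
  continuous_vec := q.continuous_vec
  re_smul g y := congrArg Neg.neg (q.re_smul g y)
  vec_smul := q.vec_smul

theorem sq_reflect (q : SignMap Y t) (y : Y) : q.reflect.sq y = q.sq y := by
  simp [sq, reflect]

/-- Conjugation by the grading operator turns the Clifford multiplication of the reflected map into
the negative of the original one. -/
theorem cls_reflect (q : SignMap Y t) (h : ∀ y, 0 < q.sq y) (h' : ∀ y, 0 < q.reflect.sq y) :
    q.reflect.cls h' = constClass Y (extRep t).cls - q.cls h := by
  have e : q.reflect.cls h' = (q.clifford.toProj h).compl.cls := by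
    refine ProjFamily.cls_eq_of_conj _ _ (extMat t (extSign t)) (extMat t (extSign t))
      extMat_sign_mul_sign extMat_sign_mul_sign (fun y => ?_) fun g => ?_
    · have h₁ : extSign t * cliff (-q.re y) (q.vec y) = -(cliff (q.re y) (q.vec y) * extSign t) :=
        by
        refine LinearMap.ext fun x => ?_
        simp only [Module.End.mul_apply, LinearMap.neg_apply, cliff_apply, map_add, map_smul,
          extSign_extSign, extSign_koszul]
        push_cast
        module
      have h₂ : extMat t (extSign t) * q.reflect.clifford.op y =
          -(q.clifford.op y * extMat t (extSign t)) := by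
        change extMat t _ * extMat t (cliff (-q.re y) (q.vec y)) = -(extMat t _ * extMat t _)
        rw [← map_mul, h₁, map_neg, map_mul]
      change _ * ((2⁻¹ : ℂ) • (1 + ((√(q.reflect.sq y) : ℝ) : ℂ)⁻¹ • q.reflect.clifford.op y)) =
        (1 - (2⁻¹ : ℂ) • (1 + ((√(q.sq y) : ℝ) : ℂ)⁻¹ • q.clifford.op y)) * _
      rw [sq_reflect, Matrix.mul_smul, Matrix.mul_add, Matrix.mul_smul, h₂, sub_mul,
        Matrix.smul_mul, Matrix.add_mul, Matrix.smul_mul, Matrix.mul_one, Matrix.one_mul]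
      module
    · rw [extRep_apply, ← map_mul, ← map_mul]
      congr 1
      simp [extAct, mul_add, add_mul]
  rw [e, cls, ← ProjFamily.cls_one, ← (q.clifford.toProj h).cls_add_cls_compl]
  ring

end SignMap

/-! ### The exterior algebra in one more dimension -/

section ExteriorStep

variable {t : ℕ}

variable (t) in
/-- The inclusion of `ℂ^t` in `ℂ^(t+1)` with last coordinate zero. -/
def snocZero : (Fin t → ℂ) →ₗ[ℂ] (Fin (t + 1) → ℂ) where
  toFun v := Fin.snoc (α := fun _ => ℂ) v 0
  map_add' u v := by
    ext i
    refine Fin.lastCases ?_ (fun i => ?_) i <;> simp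
  map_smul' c v := by
    ext i
    refine Fin.lastCases ?_ (fun i => ?_) i <;> simp

theorem snocZero_castSucc (v : Fin t → ℂ) (i : Fin t) : snocZero t v i.castSucc = v i :=
  Fin.snoc_castSucc (α := fun _ => ℂ) _ _ _

theorem snocZero_last (v : Fin t → ℂ) : snocZero t v (Fin.last t) = 0 :=
  Fin.snoc_last (α := fun _ => ℂ) _ _

theorem sqNorm_snocZero (v : Fin t → ℂ) : sqNorm (snocZero t v) = sqNorm v := by
  simp [sqNorm, Fin.sum_univ_castSucc, snocZero_castSucc, snocZero_last]

theorem snocZero_injective : Function.Injective (snocZero t) := by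
  refine LinearMap.ker_eq_bot.1 (LinearMap.ker_eq_bot'.2 fun v hv => ?_)
  rw [← sqNorm_eq_zero, ← sqNorm_snocZero, hv]
  simp [sqNorm]

variable (t) in
/-- The inclusion of exterior algebras. -/
noncomputable def extIncl : ExtAlg t →ₐ[ℂ] ExtAlg (t + 1) := ExteriorAlgebra.map (snocZero t)

theorem extIncl_ι (v : Fin t → ℂ) :
    extIncl t (ExteriorAlgebra.ι ℂ v) = ExteriorAlgebra.ι ℂ (snocZero t v) :=
  ExteriorAlgebra.map_apply_ι _ _

theorem extIncl_injective : Function.Injective (extIncl t) :=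
  ExteriorAlgebra.map_injective ((snocZero t).exists_leftInverse_of_injective
    (LinearMap.ker_eq_bot.2 snocZero_injective))

theorem contractLeft_extIncl (d : Module.Dual ℂ (Fin (t + 1) → ℂ)) (x : ExtAlg t) :
    CliffordAlgebra.contractLeft d (extIncl t x) =
      extIncl t (CliffordAlgebra.contractLeft (d ∘ₗ snocZero t) x) := by
  induction x using CliffordAlgebra.left_induction with
  | algebraMap r =>
    rw [AlgHom.commutes, CliffordAlgebra.contractLeft_algebraMap]
    erw [CliffordAlgebra.contractLeft_algebraMap]
    rw [map_zero]
  | add x y hx hy => rw [map_add, map_add, map_add, map_add, hx, hy]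
  | ι_mul x v hx =>
    have h := extIncl_ι v
    unfold ExteriorAlgebra.ι at h
    rw [map_mul, h, CliffordAlgebra.contractLeft_ι_mul, CliffordAlgebra.contractLeft_ι_mul, hx,
      map_sub, map_mul, h, map_smul]
    rfl

theorem extSign_extIncl (x : ExtAlg t) : extSign (t + 1) (extIncl t x) = extIncl t (extSign t x) :=
    by
  induction x using CliffordAlgebra.left_induction with
  | algebraMap r =>
    have h : ∀ t, extSign t (algebraMap ℂ _ r) = algebraMap ℂ _ r := fun t =>
      (CliffordAlgebra.involute (Q := (0 : QuadraticForm ℂ (Fin t → ℂ)))).commutes r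
    erw [AlgHom.commutes, h, h, AlgHom.commutes]
  | add x y hx hy => rw [map_add, map_add, map_add, map_add, hx, hy]
  | ι_mul x v hx =>
    have h := extIncl_ι v
    have h₁ := extSign_ι_mul v x
    have h₂ := extSign_ι_mul (snocZero t v) (extIncl t x)
    unfold ExteriorAlgebra.ι at h h₁ h₂
    rw [map_mul (extIncl t), h, h₁, h₂, map_neg, map_mul, h, hx]

variable (t) in
/-- The last standard basis vector. -/
noncomputable def lastVec : Fin (t + 1) → ℂ := Pi.single (Fin.last t) 1

variable (t) in
/-- The decomposition `Λ(ℂ^(t+1)) = Λ(ℂ^t) ⊕ e ∧ Λ(ℂ^t)`, with `e` the last standard basis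
vector. -/
noncomputable def extSplit : (ExtAlg t × ExtAlg t) →ₗ[ℂ] ExtAlg (t + 1) :=
  (extIncl t).toLinearMap.coprod
    (LinearMap.mulLeft ℂ (ExteriorAlgebra.ι ℂ (lastVec t)) ∘ₗ (extIncl t).toLinearMap)

theorem extSplit_apply (x y : ExtAlg t) : extSplit t (x, y) =
    extIncl t x + ExteriorAlgebra.ι ℂ (lastVec t) * extIncl t y := by
  simp [extSplit]

theorem contractLeft_last_mul (d : Module.Dual ℂ (Fin (t + 1) → ℂ)) (y : ExtAlg t) :
    CliffordAlgebra.contractLeft d (ExteriorAlgebra.ι ℂ (lastVec t) * extIncl t y) =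
      d (lastVec t) • extIncl t y - ExteriorAlgebra.ι ℂ (lastVec t) *
        extIncl t (CliffordAlgebra.contractLeft (d ∘ₗ snocZero t) y) := by
  rw [← contractLeft_extIncl]
  exact CliffordAlgebra.contractLeft_ι_mul _ _ _

theorem extSplit_bijective : Function.Bijective (extSplit t) := by
  constructor
  · refine LinearMap.ker_eq_bot.1 (LinearMap.ker_eq_bot'.2 ?_)
    rintro ⟨x, y⟩ h
    rw [extSplit_apply] at h
    have hd : (LinearMap.proj (Fin.last t) : (Fin (t + 1) → ℂ) →ₗ[ℂ] ℂ) ∘ₗ snocZero t = 0 :=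
      LinearMap.ext fun v => snocZero_last v
    have h₁ := congrArg (CliffordAlgebra.contractLeft
      (LinearMap.proj (Fin.last t) : (Fin (t + 1) → ℂ) →ₗ[ℂ] ℂ)) h
    rw [map_add, contractLeft_extIncl, contractLeft_last_mul, hd, map_zero] at h₁
    simp only [LinearMap.zero_apply, map_zero, mul_zero, sub_zero, zero_add, LinearMap.proj_apply,
      lastVec, Pi.single_eq_same, one_smul] at h₁
    have hy : y = 0 := extIncl_injective (h₁.trans (map_zero _).symm)
    rw [hy, map_zero, mul_zero, add_zero] at h
    have hx : x = 0 := extIncl_injective (h.trans (map_zero _).symm)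
    rw [hx, hy, Prod.mk_zero_zero]
  · rw [← LinearMap.range_eq_top, eq_top_iff]
    rintro z -
    induction z using CliffordAlgebra.left_induction with
    | algebraMap r => exact ⟨(algebraMap ℂ _ r, 0), by rw [extSplit_apply, AlgHom.commutes]; simp⟩
    | add x y hx hy => exact Submodule.add_mem _ hx hy
    | ι_mul z v hz =>
      obtain ⟨⟨x, y⟩, rfl⟩ := hz
      have hv : v = snocZero t (Fin.init v) + v (Fin.last t) • lastVec t := by
        ext i
        refine Fin.lastCases ?_ (fun i => ?_) i
        · simp [snocZero_last, lastVec]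
        · simp [snocZero_castSucc, lastVec, Fin.init, Fin.castSucc_ne_last]
      refine ⟨(ExteriorAlgebra.ι ℂ (Fin.init v) * x, v (Fin.last t) • x -
        ExteriorAlgebra.ι ℂ (Fin.init v) * y), ?_⟩
      have hac := ExteriorAlgebra.ι_add_mul_swap (R := ℂ) (snocZero t (Fin.init v)) (lastVec t)
      have hac' : ExteriorAlgebra.ι ℂ (lastVec t) * ExteriorAlgebra.ι ℂ (snocZero t (Fin.init v)) =
        -(ExteriorAlgebra.ι ℂ (snocZero t (Fin.init v)) * ExteriorAlgebra.ι ℂ (lastVec t)) :=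
        eq_neg_of_add_eq_zero_right hac
      change _ = ExteriorAlgebra.ι ℂ v * _
      rw [extSplit_apply, extSplit_apply]
      conv_rhs => rw [hv]
      rw [map_add, map_smul, map_mul, map_sub, map_mul, map_smul, extIncl_ι, mul_sub, ← mul_assoc,
        hac', add_mul, mul_add, mul_add, smul_mul_assoc, smul_mul_assoc, ← mul_assoc, ← mul_assoc,
        ExteriorAlgebra.ι_sq_zero, mul_smul_comm]
      simp only [neg_mul, zero_mul, smul_zero]
      abel

/-- Clifford multiplication anticommutes with `e ∧ ·`, if the vector is orthogonal to `e`. -/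
theorem cliff_extSplit (a : ℝ) (p : Fin t → ℂ) (x y : ExtAlg t) :
    cliff a (snocZero t p) (extSplit t (x, y)) = extSplit t (cliff a p x, -cliff a p y) := by
  have hd : hermDual (snocZero t p) ∘ₗ snocZero t = hermDual p := by
    refine LinearMap.ext fun v => ?_
    simp [hermDual, Fin.sum_univ_castSucc, snocZero_castSucc, snocZero_last]
  have he : hermDual (snocZero t p) (lastVec t) = 0 := by
    simp [hermDual, Fin.sum_univ_castSucc, snocZero_last, lastVec, Fin.castSucc_ne_last]
  have hac : ExteriorAlgebra.ι ℂ (snocZero t p) * ExteriorAlgebra.ι ℂ (lastVec t) =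
      -(ExteriorAlgebra.ι ℂ (lastVec t) * ExteriorAlgebra.ι ℂ (snocZero t p)) :=
    eq_neg_of_add_eq_zero_left (ExteriorAlgebra.ι_add_mul_swap _ _)
  have h₁ : ∀ z : ExtAlg (t + 1), koszul (snocZero t p) z = ExteriorAlgebra.ι ℂ (snocZero t p) * z +
    CliffordAlgebra.contractLeft (hermDual (snocZero t p)) z := fun _ => rfl
  have h₂ : ∀ z : ExtAlg t, koszul p z = ExteriorAlgebra.ι ℂ p * z +
    CliffordAlgebra.contractLeft (hermDual p) z := fun _ => rfl
  rw [extSplit_apply, extSplit_apply, cliff_apply, cliff_apply, cliff_apply, h₁, h₂, h₂, map_add,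
    map_add (CliffordAlgebra.contractLeft _), extSign_extIncl, extSign_ι_mul, extSign_extIncl,
    contractLeft_extIncl, contractLeft_last_mul, hd, he, mul_add, ← mul_assoc, hac]
  simp only [map_add, map_smul, map_mul, map_neg, extIncl_ι, mul_add, mul_neg, mul_smul_comm,
    zero_smul, neg_mul, mul_assoc, smul_add, smul_neg]
  abel

theorem extAct_extSplit (g : Pin2) (x y : ExtAlg t) : extAct (t + 1) g (extSplit t (x, y)) =
    extSplit t (extAct t g x, Pin2.signC g • extAct t g y) := by
  rcases signC_eq g with hg | hg
  · rw [extAct_of_one hg, extAct_of_one hg, hg, one_smul]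
    rfl
  · rw [extAct_of_neg_one hg, extAct_of_neg_one hg, hg, extSplit_apply, extSplit_apply, map_add,
      extSign_extIncl, extSign_ι_mul, extSign_extIncl]
    simp

end ExteriorStep

/-! ### Stabilisation by `ℂ̃` -/

section SignStep

open scoped Kronecker

/-- The sign representation of `Pin(2)` as a matrix representation. -/
noncomputable def signRep : MatRep Pin2 Unit where
  toHom :=
    { toFun := fun g => Pin2.signC g • 1
      map_one' := by rw [Pin2.signC_one, one_smul]
      map_mul' := fun g h => by rw [Pin2.signC_mul, smul_mul_smul_comm, one_mul] }
  continuous_toHom := Pin2.continuous_signC.smul continuous_const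

theorem wClass_eq : wClass = 1 - signRep.cls := by
  refine congrArg (1 - ·) (mk_ofRep_unit _ _ _ (Module.Basis.singleton Unit ℂ) fun g => ?_)
  ext i j
  simp [signRep, signRepHom, LinearMap.toMatrix_apply]

namespace SignMap

variable {Y : Type w} [TopologicalSpace Y] [MulAction Pin2 Y] {t : ℕ}

/-- The composition of a map to `ℝ ⊕ ℂ̃^t` with the inclusion in `ℝ ⊕ ℂ̃^(t+1)`. -/
noncomputable def snoc (q : SignMap Y t) : SignMap Y (t + 1) where
  re := q.re
  vec y := snocZero t (q.vec y)
  continuous_re := q.continuous_re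
  continuous_vec := (LinearMap.continuous_of_finiteDimensional (snocZero t)).comp q.continuous_vec
  re_smul := q.re_smul
  vec_smul g y := by rw [q.vec_smul, map_smul]

theorem sq_snoc (q : SignMap Y t) (y : Y) : q.snoc.sq y = q.sq y := by
  simp only [sq, snoc, sqNorm_snocZero]

variable (t) in
/-- A basis of `Λ(ℂ^t) ⊕ Λ(ℂ^t)`. -/
noncomputable def pairBasis : Module.Basis (Fin (Module.finrank ℂ (ExtAlg t)) × Unit ⊕
    Fin (Module.finrank ℂ (ExtAlg t)) × Unit) ℂ (ExtAlg t × ExtAlg t) :=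
  ((extBasis t).reindex (Equiv.prodPUnit _).symm).prod
    ((extBasis t).reindex (Equiv.prodPUnit _).symm)

theorem toMatrix_pairBasis (a b : ExtAlg t →ₗ[ℂ] ExtAlg t) :
    LinearMap.toMatrix (pairBasis t) (pairBasis t) (a.prodMap b) =
      fromBlocks (extMat t a ⊗ₖ 1) 0 0 (extMat t b ⊗ₖ 1) := by
  ext (i | i) (j | j) <;>
  simp [LinearMap.toMatrix_apply, pairBasis, extMat, LinearMap.toMatrixAlgEquiv_apply]

/-- Stabilisation by a further `ℂ̃` multiplies the class by `w`, up to a product bundle: on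
`Λ(ℂ^(t+1)) = Λ(ℂ^t) ⊕ e ∧ Λ(ℂ^t)`, Clifford multiplication is `A ⊕ -A` with `A` that on `Λ(ℂ^t)`,
and the second summand is twisted by the sign of `Pin(2)`. -/
theorem cls_snoc (q : SignMap Y t) (h : ∀ y, 0 < q.sq y) (h' : ∀ y, 0 < q.snoc.sq y) :
    q.snoc.cls h' = q.cls h * constClass Y wClass +
      constClass Y ((extRep t).cls * signRep.cls) := by
  let B : CliffordFamily Y (((extRep t).kron (MatRep.triv Pin2 Unit)).sum
      ((extRep t).kron signRep)) := q.clifford.step (fun _ => 0) (fun _ => 0) continuous_const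
    continuous_const (fun _ => 0) continuous_const (fun _ => le_rfl) (by simp) (by simp) (by simp)
    (by simp) (by simp)
  have hBq : ∀ y, B.sq y = q.clifford.sq y := fun y => add_zero _
  have hB : ∀ y, 0 < B.sq y := fun y => by rw [hBq]; exact h y
  have hop : ∀ y, B.op y =
      fromBlocks (q.clifford.op y ⊗ₖ 1) 0 0 (-(q.clifford.op y ⊗ₖ 1)) := by
    intro y
    change fromBlocks _ (_ ⊗ₖ 0) (_ ⊗ₖ 0) _ = _
    rw [kronecker_zero]
  have e := q.clifford.cls_of_fromBlocks B h hB hBq hop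
  rw [MatRep.cls_triv_unit, ← wClass_eq] at e
  refine Eq.trans (Eq.symm ?_) e
  let J : (ExtAlg t × ExtAlg t) ≃ₗ[ℂ] ExtAlg (t + 1) :=
    LinearEquiv.ofBijective (extSplit t) extSplit_bijective
  have hJ : ∀ x, J x = extSplit t x := fun _ => rfl
  refine CliffordFamily.cls_eq_of_conj _ _ hB h' (fun y => ?_)
    (LinearMap.toMatrix (pairBasis t) (extBasis (t + 1)) J.toLinearMap)
    (LinearMap.toMatrix (extBasis (t + 1)) (pairBasis t) J.symm.toLinearMap) ?_ ?_ ?_ ?_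
  · rw [hBq]
    exact (q.sq_snoc y).symm
  · rw [← LinearMap.toMatrix_comp]
    simp
  · rw [← LinearMap.toMatrix_comp]
    simp
  · intro y
    have h₁ : B.op y = LinearMap.toMatrix (pairBasis t) (pairBasis t)
        ((cliff (q.re y) (q.vec y)).prodMap (-cliff (q.re y) (q.vec y))) := by
      rw [hop, toMatrix_pairBasis, map_neg]
      congr 1
      ext i j
      simp [clifford]
    have h₂ : q.snoc.clifford.op y = LinearMap.toMatrix (extBasis (t + 1)) (extBasis (t + 1))
        (cliff (q.re y) (snocZero t (q.vec y))) := rfl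
    rw [h₁, h₂, ← LinearMap.toMatrix_comp, ← LinearMap.toMatrix_comp]
    refine congrArg _ (LinearMap.ext ?_)
    rintro ⟨x, y⟩
    exact (cliff_extSplit _ _ x y).symm
  · intro g
    have h₁ : (((extRep t).kron (MatRep.triv Pin2 Unit)).sum ((extRep t).kron signRep)).toHom g =
        LinearMap.toMatrix (pairBasis t) (pairBasis t)
          ((extAct t g).prodMap (Pin2.signC g • extAct t g)) := by
      rw [toMatrix_pairBasis, map_smul, smul_kronecker, ← kronecker_smul, ← extRep_apply]
      rfl
    have h₂ : (extRep (t + 1)).toHom g = LinearMap.toMatrix (extBasis (t + 1)) (extBasis (t + 1))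
        (extAct (t + 1) g) := extRep_apply g
    rw [h₁, h₂, ← LinearMap.toMatrix_comp, ← LinearMap.toMatrix_comp]
    refine congrArg _ (LinearMap.ext ?_)
    rintro ⟨x, y⟩
    exact extAct_extSplit g x y

end SignMap

end SignStep

/-! ### The Bott class by Clifford multiplication -/

section BottClass

open GVectorBundle OnePoint

variable {t : ℕ}

instance : T2Space (SignRep (Fin t → ℂ)) := inferInstanceAs (T2Space (Fin t → ℂ))

theorem norm_sq_le_sqNorm (v : Fin t → ℂ) (k : Fin t) : ‖v k‖ ^ 2 ≤ sqNorm v :=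
  Finset.single_le_sum (f := fun k => ‖v k‖ ^ 2) (fun _ _ => by positivity) (Finset.mem_univ k)

theorem tendsto_sqNorm_cocompact :
    Filter.Tendsto (sqNorm : (Fin t → ℂ) → ℝ) (Filter.cocompact _) Filter.atTop := by
  have h : ∀ v : Fin t → ℂ, ‖v‖ ≤ 1 + sqNorm v := by
    intro v
    have h₀ := sqNorm_nonneg v
    refine (pi_norm_le_iff_of_nonneg (by linarith)).2 fun k => ?_
    have := norm_sq_le_sqNorm v k
    nlinarith [sq_nonneg (‖v k‖ - 1)]
  have h₁ := Filter.tendsto_atTop_mono h (tendsto_norm_cocompact_atTop (E := Fin t → ℂ))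
  have h₂ := Filter.tendsto_atTop_add_const_left _ (-1) h₁
  simpa using h₂

/-- The real coordinate of inverse stereographic projection. -/
noncomputable def stereoRe (v : Fin t → ℂ) : ℝ := (1 - sqNorm v) / (1 + sqNorm v)

/-- The vector coordinate of inverse stereographic projection. -/
noncomputable def stereoVec (v : Fin t → ℂ) : Fin t → ℂ := ((2 / (1 + sqNorm v) : ℝ) : ℂ) • v

theorem one_add_sqNorm_pos (v : Fin t → ℂ) : 0 < 1 + sqNorm v := by
  have := sqNorm_nonneg v
  linarith

theorem stereo_sq (v : Fin t → ℂ) : stereoRe v ^ 2 + sqNorm (stereoVec v) = 1 := by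
  have := (one_add_sqNorm_pos v).ne'
  rw [stereoVec, sqNorm_smul, Complex.norm_real, Real.norm_eq_abs, sq_abs, stereoRe]
  field_simp
  ring

theorem continuous_stereoRe : Continuous (stereoRe : (Fin t → ℂ) → ℝ) := by
  have := continuous_sqNorm (t := t)
  unfold stereoRe
  exact Continuous.div (by fun_prop) (by fun_prop) fun v => (one_add_sqNorm_pos v).ne'

theorem continuous_stereoVec : Continuous (stereoVec : (Fin t → ℂ) → _) := by
  have := continuous_sqNorm (t := t)
  have h : Continuous fun v : Fin t → ℂ => 2 / (1 + sqNorm v) :=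
    Continuous.div (by fun_prop) (by fun_prop) fun v => (one_add_sqNorm_pos v).ne'
  exact (Complex.continuous_ofReal.comp h).smul continuous_id

theorem tendsto_stereoRe :
    Filter.Tendsto (stereoRe : (Fin t → ℂ) → ℝ) (Filter.cocompact _) (nhds (-1)) := by
  have h : ∀ v : Fin t → ℂ, stereoRe v = 2 * (1 + sqNorm v)⁻¹ - 1 := fun v => by
    have := (one_add_sqNorm_pos v).ne'
    rw [stereoRe]
    field_simp
    ring
  have h₁ : Filter.Tendsto (fun v : Fin t → ℂ => (1 + sqNorm v)⁻¹) (Filter.cocompact _) (nhds 0) :=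
    (Filter.tendsto_atTop_add_const_left _ 1 tendsto_sqNorm_cocompact).inv_tendsto_atTop
  have h₂ := (h₁.const_mul 2).sub_const 1
  rw [mul_zero, zero_sub] at h₂
  exact h₂.congr fun v => (h v).symm

theorem tendsto_stereoVec :
    Filter.Tendsto (stereoVec : (Fin t → ℂ) → _) (Filter.cocompact _) (nhds 0) := by
  have h₁ : Filter.Tendsto (fun v : Fin t → ℂ => 1 - stereoRe v ^ 2) (Filter.cocompact _)
      (nhds 0) := by
    have := (tendsto_stereoRe (t := t).pow 2).const_sub 1
    simpa using this
  rw [tendsto_pi_nhds]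
  intro k
  rw [Pi.zero_apply, tendsto_zero_iff_norm_tendsto_zero]
  have h₂ : Filter.Tendsto (fun v : Fin t → ℂ => ‖stereoVec v k‖ ^ 2) (Filter.cocompact _)
      (nhds 0) := by
    refine squeeze_zero (fun _ => by positivity) (fun v => ?_) h₁
    have := norm_sq_le_sqNorm (stereoVec v) k
    linarith [stereo_sq v]
  have h₃ := (Real.continuous_sqrt.tendsto 0).comp h₂
  rw [Real.sqrt_zero] at h₃
  exact h₃.congr fun v => Real.sqrt_sq (norm_nonneg _)

theorem norm_signC (g : Pin2) : ‖Pin2.signC g‖ = 1 := by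
  rcases signC_eq g with h | h <;> simp [h]

theorem sqNorm_sign_smul (g : Pin2) (v : Fin t → ℂ) : sqNorm (Pin2.signC g • v) = sqNorm v := by
  rw [sqNorm_smul, norm_signC, one_pow, one_mul]

theorem stereoRe_sign_smul (g : Pin2) (v : Fin t → ℂ) :
    stereoRe (Pin2.signC g • v) = stereoRe v := by
  rw [stereoRe, stereoRe, sqNorm_sign_smul]

theorem stereoVec_sign_smul (g : Pin2) (v : Fin t → ℂ) :
    stereoVec (Pin2.signC g • v) = Pin2.signC g • stereoVec v := by
  rw [stereoVec, stereoVec, sqNorm_sign_smul, smul_comm]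

theorem continuous_onePoint_elim {Z : Type*} [TopologicalSpace Z] {F : (Fin t → ℂ) → Z} {z : Z}
    (hF : Continuous F) (hz : Filter.Tendsto F (Filter.cocompact _) (nhds z)) :
    Continuous fun x : RepSphere (Fin t → ℂ) => x.elim z F := by
  rw [OnePoint.continuous_iff]
  refine ⟨?_, hF⟩
  rw [Filter.coclosedCompact_eq_cocompact]
  exact hz

/-- The identification of the representation sphere of `ℂ̃^t` with the unit sphere of `ℝ ⊕ ℂ̃^t`;
the origin and the point at infinity correspond to `(1, 0)` and `(-1, 0)`. -/
noncomputable def sphereMap (t : ℕ) : SignMap (RepSphere (Fin t → ℂ)) t where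
  re x := x.elim (-1) (stereoRe (t := t))
  vec x := x.elim 0 (stereoVec (t := t))
  continuous_re := continuous_onePoint_elim continuous_stereoRe tendsto_stereoRe
  continuous_vec := continuous_onePoint_elim continuous_stereoVec tendsto_stereoVec
  re_smul g x := by
    cases x using OnePoint.rec with
    | infty => rfl
    | coe v =>
      exact (congrArg stereoRe (Bott.sign_smul_eq g v)).trans (stereoRe_sign_smul g v)
  vec_smul g x := by
    cases x using OnePoint.rec with
    | infty => exact (smul_zero _).symm
    | coe v =>
      exact (congrArg stereoVec (Bott.sign_smul_eq g v)).trans (stereoVec_sign_smul g v)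

theorem sphereMap_sq (x : RepSphere (Fin t → ℂ)) : (sphereMap t).sq x = 1 := by
  cases x using OnePoint.rec with
  | infty => change (-1 : ℝ) ^ 2 + sqNorm (0 : Fin t → ℂ) = 1; simp [sqNorm]
  | coe v => exact stereo_sq v

theorem sphereMap_sq_pos (x : RepSphere (Fin t → ℂ)) : 0 < (sphereMap t).sq x := by
  rw [sphereMap_sq]; exact one_pos

theorem extSign_of_even {y : ExtAlg t} (hy : y ∈ extPart t 0) : extSign t y = y :=
  CliffordAlgebra.involute_eq_of_mem_even hy

theorem extSign_of_odd {y : ExtAlg t} (hy : y ∈ extPart t 1) : extSign t y = -y :=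
  CliffordAlgebra.involute_eq_of_mem_odd hy

theorem exists_even_add_odd (y : ExtAlg t) : ∃ a ∈ extPart t 0, ∃ b ∈ extPart t 1, a + b = y := by
  have h := (CliffordAlgebra.evenOdd_isCompl (0 : QuadraticForm ℂ (Fin t → ℂ))).codisjoint.eq_top
  exact Submodule.mem_sup.1 (h ▸ Submodule.mem_top : y ∈ _)

theorem mem_even_of_extSign {y : ExtAlg t} (hy : extSign t y = y) : y ∈ extPart t 0 := by
  obtain ⟨a, ha, b, hb, rfl⟩ := exists_even_add_odd y
  rw [map_add, extSign_of_even ha, extSign_of_odd hb, add_right_inj] at hy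
  have h : (2 : ℂ) • b = 0 := by rw [two_smul]; nth_rewrite 1 [← hy]; exact neg_add_cancel b
  rwa [(smul_eq_zero.1 h).resolve_left two_ne_zero, add_zero]

theorem mem_odd_of_extSign {y : ExtAlg t} (hy : extSign t y = -y) : y ∈ extPart t 1 := by
  obtain ⟨a, ha, b, hb, rfl⟩ := exists_even_add_odd y
  rw [map_add, extSign_of_even ha, extSign_of_odd hb, neg_add, add_left_inj] at hy
  have h : (2 : ℂ) • a = 0 := by rw [two_smul]; nth_rewrite 1 [hy]; exact neg_add_cancel a
  rwa [(smul_eq_zero.1 h).resolve_left two_ne_zero, zero_add]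

/-- The fibre of the Bott bundle over `v`, as the graph of the clutching map; over `∞`, the limit
of these graphs. -/
noncomputable def bottGraph : ∀ x : RepSphere (Fin t → ℂ),
    extPart t (Bott.parity x) →ₗ[ℂ] ExtAlg t
  | OnePoint.infty => (extPart t 1).subtype
  | OnePoint.some v => (1 + koszul (t := t) v) ∘ₗ (extPart t 0).subtype

theorem stereo_smul (v : Fin t → ℂ) : koszul (stereoVec v) = (1 + stereoRe v : ℂ) • koszul v := by
  rw [stereoVec, koszul_smul (Complex.conj_ofReal _)]
  have h : 2 / (1 + sqNorm v) = 1 + stereoRe v := by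
    have := (one_add_sqNorm_pos v).ne'
    rw [stereoRe]
    field_simp
    ring
  rw [h, Complex.ofReal_add, Complex.ofReal_one]

theorem one_add_stereoRe_ne_zero (v : Fin t → ℂ) : (1 + stereoRe v : ℂ) ≠ 0 := by
  have h : 1 + stereoRe v = 2 / (1 + sqNorm v) := by
    have := (one_add_sqNorm_pos v).ne'
    rw [stereoRe]
    field_simp
    ring
  rw [← Complex.ofReal_one, ← Complex.ofReal_add, h, Complex.ofReal_ne_zero]
  exact (div_pos two_pos (one_add_sqNorm_pos v)).ne'

theorem one_add_stereoRe_mul (v : Fin t → ℂ) :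
    (1 + stereoRe v : ℂ) * sqNorm v = 1 - stereoRe v := by
  have h : (1 + stereoRe v) * sqNorm v = 1 - stereoRe v := by
    have := (one_add_sqNorm_pos v).ne'
    rw [stereoRe]
    field_simp
    ring
  exact_mod_cast h

/-- Clifford multiplication at a point of the sphere. -/
noncomputable def sphereCliff (x : RepSphere (Fin t → ℂ)) : ExtAlg t →ₗ[ℂ] ExtAlg t :=
  cliff ((sphereMap t).re x) ((sphereMap t).vec x)

theorem sphereCliff_bottGraph (x : RepSphere (Fin t → ℂ)) (y : extPart t (Bott.parity x)) :
    sphereCliff x (bottGraph x y) = bottGraph x y := by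
  cases x using OnePoint.rec with
  | infty =>
    change cliff (-1) 0 y.1 = y.1
    have h : koszul (0 : Fin t → ℂ) = 0 := by
      have := koszul_smul (t := t) (c := 0) (by simp) 0
      simpa using this
    have hy : extSign t y.1 = -y.1 := extSign_of_odd y.2
    rw [cliff_apply, hy, h]
    simp
  | coe v =>
    let v' : Fin t → ℂ := v
    change cliff (stereoRe v') (stereoVec v') (y.1 + koszul v' y.1) = y.1 + koszul v' y.1
    have hy : extSign t y.1 = y.1 := extSign_of_even y.2
    rw [cliff_apply, stereo_smul, LinearMap.smul_apply, map_add, map_add, koszul_koszul,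
      extSign_koszul, hy, herm_eq_sqNorm, smul_add (1 + _ : ℂ), smul_smul, one_add_stereoRe_mul]
    module

/-- The graph of the clutching map fills the positive eigenspace: an eigenvector is recovered from
    its
even part, or at `∞` is itself odd. -/
theorem bottGraph_bijective (x : RepSphere (Fin t → ℂ)) :
    Function.Injective (bottGraph x) ∧
      ∀ z, sphereCliff x z = z → ∃ y, bottGraph x y = z := by
  cases x using OnePoint.rec with
  | infty =>
    refine ⟨Subtype.val_injective, fun z hz => ?_⟩
    change cliff (-1) 0 z = z at hz
    have h : koszul (0 : Fin t → ℂ) = 0 := by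
      have := koszul_smul (t := t) (c := 0) (by simp) 0
      simpa using this
    rw [cliff_apply, h] at hz
    refine ⟨⟨z, mem_odd_of_extSign ?_⟩, rfl⟩
    conv_rhs => rw [← hz]
    simp
  | coe v =>
    let v' : Fin t → ℂ := v
    constructor
    · refine LinearMap.ker_eq_bot.1 (LinearMap.ker_eq_bot'.2 fun y hy => ?_)
      have hy' : y.1 + koszul v' y.1 = 0 := hy
      have he : extSign t y.1 = y.1 := extSign_of_even y.2
      have h := congrArg (extSign t) hy'
      rw [map_add, extSign_koszul, he, map_zero] at h
      have h₂ : (2 : ℂ) • y.1 = 0 := by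
        rw [two_smul]
        calc y.1 + y.1 = (y.1 + koszul v' y.1) + (y.1 + -koszul v' y.1) := by abel
          _ = 0 := by rw [hy', h, add_zero]
      exact Subtype.ext ((smul_eq_zero.1 h₂).resolve_left two_ne_zero)
    · intro z hz
      change cliff (stereoRe v') (stereoVec v') z = z at hz
      rw [cliff_apply, stereo_smul, LinearMap.smul_apply] at hz
      have he := congrArg (extSign t) hz
      rw [map_add, _root_.map_smul, _root_.map_smul, extSign_extSign, extSign_koszul] at he
      refine ⟨⟨(2⁻¹ : ℂ) • (z + extSign t z), mem_even_of_extSign (by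
        rw [_root_.map_smul, map_add, extSign_extSign, add_comm])⟩, ?_⟩
      change (2⁻¹ : ℂ) • (z + extSign t z) + koszul v' ((2⁻¹ : ℂ) • (z + extSign t z)) = z
      have h₁ : (1 + stereoRe v' : ℂ) • (koszul v' (z + extSign t z)) =
          (1 + stereoRe v' : ℂ) • (z - extSign t z) := by
        rw [map_add]
        calc _ = ((stereoRe v' : ℂ) • extSign t z + (1 + stereoRe v' : ℂ) • koszul v' z) -
              ((stereoRe v' : ℂ) • z + (1 + stereoRe v' : ℂ) • -koszul v' (extSign t z)) +
              (stereoRe v' : ℂ) • (z - extSign t z) := by module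
          _ = _ := by rw [hz, he]; module
      have h₂ := smul_right_injective _ (one_add_stereoRe_ne_zero v') h₁
      rw [_root_.map_smul, h₂]
      module

theorem extMat_mulVec (a : ExtAlg t →ₗ[ℂ] ExtAlg t) (z : ExtAlg t) :
    extMat t a *ᵥ (extBasis t).equivFun z = (extBasis t).equivFun (a z) :=
  LinearMap.toMatrix_mulVec_repr (extBasis t) (extBasis t) a z

theorem mem_fixedVec_sphere (x : RepSphere (Fin t → ℂ)) (z : ExtAlg t) :
    (extBasis t).equivFun z ∈ fixedVec (((sphereMap t).clifford.toProj sphereMap_sq_pos).proj x) ↔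
      sphereCliff x z = z := by
  have h : ((sphereMap t).clifford.toProj sphereMap_sq_pos).proj x =
      (2⁻¹ : ℂ) • (1 + extMat t (sphereCliff x)) := by
    change (2⁻¹ : ℂ) • (1 + ((√((sphereMap t).sq x) : ℝ) : ℂ)⁻¹ • extMat t _) = _
    rw [sphereMap_sq, Real.sqrt_one, Complex.ofReal_one, inv_one, one_smul]
    rfl
  rw [mem_fixedVec, h, smul_mulVec, add_mulVec, one_mulVec, extMat_mulVec, ← map_add, ←
      _root_.map_smul,
    (extBasis t).equivFun.injective.eq_iff]
  constructor
  · intro h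
    calc sphereCliff x z = (2 : ℂ) • ((2⁻¹ : ℂ) • (z + sphereCliff x z)) - z := by module
      _ = z := by rw [h]; module
  · intro h
    rw [h]
    module

/-- The fibrewise identification of the Bott bundle with the bundle of positive eigenspaces of
Clifford multiplication. -/
noncomputable def bottEquiv (x : RepSphere (Fin t → ℂ)) : extPart t (Bott.parity x) ≃ₗ[ℂ]
    fixedVec (((sphereMap t).clifford.toProj sphereMap_sq_pos).proj x) :=
  LinearEquiv.ofBijective
    (((extBasis t).equivFun.toLinearMap ∘ₗ bottGraph x).codRestrict _ fun y =>
      (mem_fixedVec_sphere x _).2 (sphereCliff_bottGraph x y)) <| by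
    constructor
    · intro y y' h
      exact (bottGraph_bijective x).1 ((extBasis t).equivFun.injective (congrArg Subtype.val h))
    · intro z
      obtain ⟨z', hz'⟩ := (extBasis t).equivFun.surjective z.1
      obtain ⟨y, hy⟩ := (bottGraph_bijective x).2 z'
        ((mem_fixedVec_sphere x z').1 (hz' ▸ z.2))
      exact ⟨y, Subtype.ext ((congrArg (extBasis t).equivFun hy).trans hz')⟩

theorem bottGraph_act (g : Pin2) (x : RepSphere (Fin t → ℂ)) (y : extPart t (Bott.parity x)) :
    bottGraph (g • x) (Bott.act g x (g • x) rfl y) = extAct t g (bottGraph x y) := by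
  cases x using OnePoint.rec with
  | infty =>
    change Pin2.signC g • y.1 = extAct t g y.1
    have hy : extSign t y.1 = -y.1 := extSign_of_odd y.2
    rcases signC_eq g with hg | hg
    · rw [extAct_of_one hg, hg, one_smul]; rfl
    · rw [extAct_of_neg_one hg, hg, hy, neg_one_smul]
  | coe v =>
    let v' : Fin t → ℂ := v
    have hy : extSign t y.1 = y.1 := extSign_of_even y.2
    have h : koszul (t := t) (g • v : SignRep (Fin t → ℂ)) = Pin2.signC g • koszul v' :=
      (congrArg koszul (Bott.sign_smul_eq g v')).trans (koszul_smul (by simp [Pin2.signC]) v')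
    change y.1 + koszul (t := t) (g • v : SignRep (Fin t → ℂ)) y.1 =
      extAct t g (y.1 + koszul v' y.1)
    rw [h]
    rcases signC_eq g with hg | hg
    · rw [extAct_of_one hg, hg, one_smul]; rfl
    · rw [extAct_of_neg_one hg, hg, map_add, hy, extSign_koszul, hy, LinearMap.smul_apply,
        neg_one_smul]

theorem continuous_add_koszul {W : Type*} [TopologicalSpace W] {c : W → ℂ} {v : W → Fin t → ℂ}
    (hc : Continuous c) (hv : Continuous v) (y : ExtAlg t) :
    Continuous fun w => (extBasis t).equivFun (y + c w • koszul (v w) y) := by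
  have h : ∀ w, (extBasis t).equivFun (y + c w • koszul (v w) y) =
      (extBasis t).equivFun y + c w • (extMat t (koszul (v w)) *ᵥ (extBasis t).equivFun y) := by
    intro w
    rw [extMat_mulVec, map_add, _root_.map_smul]
  exact (continuous_congr h).2 (continuous_const.add
    (hc.smul ((continuous_extMat_koszul.comp hv).matrix_mulVec continuous_const)))

theorem sphereMap_re_ne_neg_one {x : RepSphere (Fin t → ℂ)} (hx : x ≠ ∞) :
    (1 + (sphereMap t).re x : ℂ) ≠ 0 := by
  cases x using OnePoint.rec with
  | infty => exact (hx rfl).elim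
  | coe v => exact one_add_stereoRe_ne_zero (t := t) v

theorem sphereMap_re_ne_one {x : RepSphere (Fin t → ℂ)} (hx : x ≠ OnePoint.some 0) :
    (1 - (sphereMap t).re x : ℂ) ≠ 0 := by
  cases x using OnePoint.rec with
  | infty => change (1 - ((-1 : ℝ) : ℂ)) ≠ 0; norm_num
  | coe v =>
    refine (one_add_stereoRe_mul (t := t) v).symm.trans_ne ?_
    refine mul_ne_zero (one_add_stereoRe_ne_zero _) (Complex.ofReal_ne_zero.2 fun h => ?_)
    exact hx (congrArg OnePoint.some (sqNorm_eq_zero.1 h))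

/-- The clutched bundle is the bundle of positive eigenspaces of Clifford multiplication. -/
theorem mk_bottBundle : KG.mk (Bott.bundle t) = (sphereMap t).cls sphereMap_sq_pos := by
  refine KG_mk_eq (E := Bott.bundle t)
    (F := ((sphereMap t).clifford.toProj sphereMap_sq_pos).bundle)
    (Iso.ofContinuousFamily bottEquiv ?_ ?_)
  · rintro g x _ rfl y
    refine Subtype.ext ?_
    change (extBasis t).equivFun (bottGraph (g • x) (Bott.act g x (g • x) rfl y)) =
      (extRep t).toHom g *ᵥ (extBasis t).equivFun (bottGraph x y)
    refine (congrArg (extBasis t).equivFun (bottGraph_act g x y)).trans ?_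
    rw [extRep_apply, extMat_mulVec]
  · refine ProjFamily.continuousFamily_to _ fun a i => ?_
    have hr : Continuous fun x : {x : RepSphere (Fin t → ℂ) // x ∈ Bott.base a} =>
        ((sphereMap t).re x.1 : ℂ) :=
      Complex.continuous_ofReal.comp ((sphereMap t).continuous_re.comp continuous_subtype_val)
    have hv := (sphereMap t).continuous_vec.comp
      (continuous_subtype_val (p := fun x : RepSphere (Fin t → ℂ) => x ∈ Bott.base a))
    cases a using OnePoint.rec with
    | infty =>
      refine Continuous.congr (continuous_add_koszul (c := fun x : {x // x ∈ Bott.base ∞} =>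
        (1 - (sphereMap t).re x.1 : ℂ)⁻¹) ((continuous_const.sub hr).inv₀ fun x =>
          sphereMap_re_ne_one x.2) hv (Bott.oddBasis t i).1) ?_
      rintro ⟨x, hx⟩
      refine congrArg (extBasis t).equivFun ?_
      cases x using OnePoint.rec with
      | infty =>
        change _ + _ • koszul 0 _ = (Bott.oddBasis t i).1
        have h : koszul (0 : Fin t → ℂ) = 0 := by
          have := koszul_smul (t := t) (c := 0) (by simp) 0
          simpa using this
        rw [h, LinearMap.zero_apply, smul_zero, add_zero]
      | coe v =>
        let v' : Fin t → ℂ := v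
        have hv' : v' ≠ 0 := fun h => hx (congrArg OnePoint.some h)
        have hn : (sqNorm v' : ℂ) ≠ 0 := by rw [← herm_eq_sqNorm]; exact herm_ne_zero hv'
        let o := (Bott.oddBasis t i).1
        change o + (1 - stereoRe v' : ℂ)⁻¹ • koszul (stereoVec v') o =
          (herm v')⁻¹ • koszul v' o + koszul v' ((herm v')⁻¹ • koszul v' o)
        rw [_root_.map_smul, koszul_koszul, stereo_smul, LinearMap.smul_apply, herm_eq_sqNorm,
            smul_smul,
          smul_smul, inv_mul_cancel₀ hn, one_smul, ← one_add_stereoRe_mul, mul_inv, mul_comm, ←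
              mul_assoc,
          mul_inv_cancel₀ (one_add_stereoRe_ne_zero v'), one_mul, add_comm]
    | coe a =>
      refine Continuous.congr (continuous_add_koszul (c := fun x : {x // x ∈ Bott.base
        (OnePoint.some a)} => (1 + (sphereMap t).re x.1 : ℂ)⁻¹) ((continuous_const.add hr).inv₀
          fun x => sphereMap_re_ne_neg_one x.2) hv (Bott.evenBasis t i).1) ?_
      rintro ⟨x, hx⟩
      refine congrArg (extBasis t).equivFun ?_
      cases x using OnePoint.rec with
      | infty => exact (hx rfl).elim
      | coe v =>
        let v' : Fin t → ℂ := v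
        let o := (Bott.evenBasis t i).1
        change o + (1 + stereoRe v' : ℂ)⁻¹ • koszul (stereoVec v') o = o + koszul v' o
        rw [stereo_smul, LinearMap.smul_apply, smul_smul,
          inv_mul_cancel₀ (one_add_stereoRe_ne_zero v'), one_smul]

/-- The Bott class is the class of Clifford multiplication, up to the class of a product bundle. -/
theorem exists_bottClass_eq (t : ℕ) : ∃ c : RepRing Pin2,
    bottClass t = (sphereMap t).cls sphereMap_sq_pos + constClass _ c := by
  let r : MatRep Pin2 (Fin (Module.finrank ℂ (extPart t 1))) :=
    ⟨(LinearMap.toMatrixAlgEquiv (Module.finBasis ℂ (extPart t 1))).toMonoidHom.comp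
      (signRepHom (extPart t 1)), continuous_matrix fun i j => by
        simpa [LinearMap.toMatrixAlgEquiv_apply] using continuous_signRepHom
          (Module.finBasis ℂ (extPart t 1) j) ((Module.finBasis ℂ (extPart t 1)).coord i)⟩
  have h := mk_ofRep (X := RepSphere (Fin t → ℂ)) (signRepHom (extPart t 1)) continuous_signRepHom
    r (Module.finBasis ℂ (extPart t 1)) fun g => rfl
  refine ⟨-r.cls, ?_⟩
  rw [bottClass, mk_bottBundle, h, ProjFamily.cls_one, map_neg, sub_eq_add_neg]

end BottClass

/-! ### Relations in the representation ring -/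

section RepresentationRing

open scoped Kronecker

variable {G : Type v} [Group G] [TopologicalSpace G] [IsTopologicalGroup G]
variable {ι κ : Type} [Fintype ι] [DecidableEq ι] [Fintype κ] [DecidableEq κ]

namespace MatRep

theorem cls_eq_of_conj (ρ : MatRep G ι) (ρ' : MatRep G κ) (T : Matrix κ ι ℂ) (T' : Matrix ι κ ℂ)
    (h₁ : T' * T = 1) (h₂ : T * T' = 1) (hρ : ∀ g, ρ'.toHom g * T = T * ρ.toHom g) :
    ρ.cls = ρ'.cls :=
  ProjFamily.cls_eq_of_conj _ _ T T' h₁ h₂ (fun _ => (Matrix.mul_one T).trans (Matrix.one_mul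
      T).symm)
    hρ

theorem cls_kron (ρ : MatRep G ι) (ρ' : MatRep G κ) : (ρ.kron ρ').cls = ρ.cls * ρ'.cls :=
  (ProjFamily.cls_congr fun _ => one_kronecker_one.symm).trans
    (ProjFamily.cls_kron (ProjFamily.one Unit ρ) (ProjFamily.one Unit ρ'))

end MatRep

theorem signRep_cls_mul_self : signRep.cls * signRep.cls = 1 := by
  rw [← MatRep.cls_kron, ← MatRep.cls_triv_unit]
  refine MatRep.cls_eq_of_conj _ _ (Matrix.of fun (_ : Unit) (_ : Unit × Unit) => (1 : ℂ))
    (Matrix.of fun (_ : Unit × Unit) (_ : Unit) => (1 : ℂ)) ?_ ?_ fun g => ?_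
  · ext ⟨i, i'⟩ ⟨j, j'⟩
    simp [Matrix.mul_apply]
  · ext i j
    simp [Matrix.mul_apply]
  · ext i ⟨j, k⟩
    simp [Matrix.mul_apply, MatRep.triv, MatRep.kron, signRep, Pin2.signC_mul_self]

/-- `w² = 2w`. -/
theorem wClass_mul_self : wClass * wClass = 2 * wClass := by
  rw [wClass_eq]
  linear_combination signRep_cls_mul_self

/-- The quaternion `i`. -/
def quatI : ℍ[ℝ] := ⟨0, 1, 0, 0⟩

@[simp] theorem quatI_re : quatI.re = 0 := rfl
@[simp] theorem quatI_imI : quatI.imI = 1 := rfl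
@[simp] theorem quatI_imJ : quatI.imJ = 0 := rfl
@[simp] theorem quatI_imK : quatI.imK = 0 := rfl

/-- Left multiplication by quaternions on the quaternionic representation. -/
noncomputable def quatMul : ℍ[ℝ] →+* Module.End ℂ QuatRep where
  toFun h :=
    { toFun := fun (q : ℍ[ℝ]) => (h * q : ℍ[ℝ])
      map_add' := fun (p q : ℍ[ℝ]) => mul_add h p q
      map_smul' := fun z (q : ℍ[ℝ]) => (mul_assoc h q (Quaternion.coeComplex z)).symm }
  map_one' := LinearMap.ext fun (q : ℍ[ℝ]) => one_mul q
  map_mul' g h := LinearMap.ext fun (q : ℍ[ℝ]) => mul_assoc g h q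
  map_zero' := LinearMap.ext fun (q : ℍ[ℝ]) => zero_mul q
  map_add' g h := LinearMap.ext fun (q : ℍ[ℝ]) => add_mul g h q

/-- The basis `1, j` of the quaternions as a right complex vector space. -/
noncomputable def quatBasis : Module.Basis (Unit ⊕ Unit) ℂ QuatRep :=
  .ofEquivFun
    { toFun := fun (q : ℍ[ℝ]) => Sum.elim (fun _ => ⟨q.re, q.imI⟩) (fun _ => ⟨q.imJ, -q.imK⟩)
      map_add' := fun (p q : ℍ[ℝ]) => by
        change Sum.elim (fun _ => (⟨(p + q : ℍ[ℝ]).re, _⟩ : ℂ)) (fun _ => ⟨_, -(p + q : ℍ[ℝ]).imK⟩)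
            = _
        ext (i | i)
        · exact Complex.ext rfl rfl
        · exact Complex.ext rfl (neg_add p.imK q.imK)
      map_smul' := fun z (q : ℍ[ℝ]) => by
        rw [QuatRep.smul_def]
        ext (i | i) <;> simp [Complex.ext_iff] <;> constructor <;> ring
      invFun := fun c => (⟨(c (.inl ())).re, (c (.inl ())).im, (c (.inr ())).re,
        -(c (.inr ())).im⟩ : ℍ[ℝ])
      left_inv := fun (q : ℍ[ℝ]) => by
        change (⟨_, _, _, _⟩ : ℍ[ℝ]) = q
        ext <;> simp
      right_inv := fun c => by ext (i | i) <;> simp }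

/-- The matrix of left multiplication by a quaternion. -/
noncomputable def quatMat (h : ℍ[ℝ]) : Matrix (Unit ⊕ Unit) (Unit ⊕ Unit) ℂ :=
  LinearMap.toMatrixAlgEquiv quatBasis (quatMul h)

theorem quatMat_mul (g h : ℍ[ℝ]) : quatMat (g * h) = quatMat g * quatMat h := by
  simp [quatMat]

theorem quatMat_real (r : ℝ) : quatMat (r : ℍ[ℝ]) = (r : ℂ) • 1 := by
  have h : quatMul (r : ℍ[ℝ]) = (r : ℂ) • 1 := by
    refine LinearMap.ext fun (q : ℍ[ℝ]) => ?_
    refine Eq.trans ?_ (QuatRep.ofReal_smul r q).symm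
    exact Quaternion.coe_mul_eq_smul r q
  rw [quatMat, h, map_smul, map_one]

theorem quatMat_one : quatMat 1 = 1 := by simp [quatMat]

theorem continuous_quatMat : Continuous quatMat := by
  let l : ℍ[ℝ] →ₗ[ℝ] Matrix (Unit ⊕ Unit) (Unit ⊕ Unit) ℂ :=
    { toFun := quatMat
      map_add' := fun p q => by simp [quatMat]
      map_smul' := fun r q => by
        rw [← Quaternion.coe_mul_eq_smul, quatMat_mul, quatMat_real, smul_mul_assoc, one_mul]
        exact Complex.coe_smul r _ }
  exact LinearMap.continuous_of_finiteDimensional l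

/-- The quaternionic representation as a matrix representation. -/
noncomputable def quatMatRep : MatRep Pin2 (Unit ⊕ Unit) where
  toHom :=
    { toFun := fun g => quatMat g.toQuat
      map_one' := by rw [Pin2.toQuat_one, quatMat_one]
      map_mul' := fun g h => by rw [Pin2.toQuat_mul, quatMat_mul] }
  continuous_toHom := continuous_quatMat.comp Pin2.continuous_toQuat

theorem zClass_eq : zClass = (MatRep.triv Pin2 (Unit ⊕ Unit)).cls - quatMatRep.cls := by
  rw [MatRep.cls_triv_two]
  exact congrArg (2 - ·) (mk_ofRep_unit _ _ _ quatBasis fun g => rfl)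

/-- Elements of `S¹` commute with `i`, and elements of `j S¹` anticommute with `i`. -/
theorem Pin2.toQuat_mul_I (g : Pin2) :
    quatMat g.toQuat * quatMat quatI =
      Pin2.signC g • (quatMat quatI * quatMat g.toQuat) := by
  rw [← quatMat_mul, ← quatMat_mul]
  by_cases hg : g.InCircle
  · have h₁ : signC g = 1 := by simp [signC, sign, hg]
    rw [h₁, one_smul]
    congr 1
    ext <;> simp [hg.1, hg.2]
  · have h₁ : signC g = ((-1 : ℝ) : ℂ) := by simp [signC, sign, hg]
    have h₂ := not_inCircle hg
    have h₃ : (((-1 : ℝ) : ℂ) • quatMat (quatI * g.toQuat)) =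
        quatMat (((-1 : ℝ) : ℍ[ℝ]) * (quatI * g.toQuat)) := by
      rw [quatMat_mul (((-1 : ℝ) : ℍ[ℝ])), quatMat_real, smul_mul_assoc, one_mul]
    rw [h₁, h₃]
    congr 1
    ext <;> simp [h₂.1, h₂.2]

/-- Left multiplication by `i` is an isomorphism from `ℂ̃ ⊗ ℍ` to `ℍ`. -/
theorem signRep_mul_quatMatRep : signRep.cls * quatMatRep.cls = quatMatRep.cls := by
  rw [← MatRep.cls_kron]
  have hI : quatMat quatI * quatMat (-quatI) = 1 := by
    rw [← quatMat_mul, ← quatMat_one]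
    congr 1
    ext <;> simp
  have hI' : quatMat (-quatI) * quatMat quatI = 1 := by
    rw [← quatMat_mul, ← quatMat_one]
    congr 1
    ext <;> simp
  let e : Unit ⊕ Unit ≃ Unit × (Unit ⊕ Unit) := (Equiv.punitProd _).symm
  have he : ∀ g, (signRep.kron quatMatRep).toHom g =
      (Pin2.signC g • quatMat g.toQuat).submatrix e.symm e.symm := by
    intro g
    ext ⟨i, j⟩ ⟨k, l⟩
    simp [MatRep.kron, signRep, quatMatRep, e]
  refine MatRep.cls_eq_of_conj _ _ ((quatMat quatI).submatrix id e.symm)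
    ((quatMat (-quatI)).submatrix e.symm id) ?_ ?_ fun g => ?_
  · rw [submatrix_mul _ _ _ _ _ Function.bijective_id |>.symm, hI', submatrix_one_equiv]
  · rw [submatrix_mul _ _ _ _ _ e.symm.bijective |>.symm, hI, submatrix_one _ Function.injective_id]
  · rw [he, submatrix_mul _ _ _ _ _ e.symm.bijective |>.symm, mul_smul_comm, ← Pin2.toQuat_mul_I,
      submatrix_mul _ _ _ _ _ Function.bijective_id]
    rfl

/-- `wz = 2w`. -/
theorem wClass_mul_zClass : wClass * zClass = 2 * wClass := by
  rw [wClass_eq, zClass_eq, MatRep.cls_triv_two]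
  linear_combination signRep_mul_quatMatRep

theorem wClass_mul_wClass_pow (n : ℕ) : wClass * wClass ^ n = 2 ^ n * wClass := by
  induction n with
  | zero => simp
  | succ n ih => rw [pow_succ', ← mul_assoc, wClass_mul_self, mul_assoc, ih, pow_succ]; ring

theorem wClass_mul_zClass_pow (n : ℕ) : wClass * zClass ^ n = 2 ^ n * wClass := by
  induction n with
  | zero => simp
  | succ n ih => rw [pow_succ', ← mul_assoc, wClass_mul_zClass, mul_assoc, ih, pow_succ]; ring

end RepresentationRing

/-! ### Graded tensor product with maps to the quaternions -/

/-- A continuous equivariant map from a `Pin(2)`-space to the quaternions. -/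
structure QuatMap (X : Type u) [TopologicalSpace X] [MulAction Pin2 X] where
  toFun : X → ℍ[ℝ]
  continuous_toFun : Continuous toFun
  map_smul : ∀ (g : Pin2) x, toFun (g • x) = g.toQuat * toFun x

section QuaternionStep

open scoped Kronecker

variable {X : Type u} {Y : Type w} [TopologicalSpace X] [MulAction Pin2 X] [TopologicalSpace Y]
  [MulAction Pin2 Y] {ι : Type} [Fintype ι] [DecidableEq ι] {ρ : MatRep Pin2 ι}

theorem Pin2.normSq_toQuat_eq_one (g : Pin2) : Quaternion.normSq g.toQuat = 1 := by
  rw [Quaternion.normSq_def', Pin2.normSq_toQuat]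

/-- The graded tensor product of a Clifford family with the Clifford multiplication of an
equivariant map to `ℍ` on `ℂ² ⊕ ℍ`. -/
noncomputable def CliffordFamily.quatStep (A : CliffordFamily X ρ) (h : QuatMap X) :
    CliffordFamily X ((ρ.kron (MatRep.triv Pin2 (Unit ⊕ Unit))).sum (ρ.kron quatMatRep)) :=
  A.step (fun x => quatMat (h.toFun x)) (fun x => quatMat (star (h.toFun x)))
    (continuous_quatMat.comp h.continuous_toFun)
    (continuous_quatMat.comp h.continuous_toFun.star) (fun x => Quaternion.normSq (h.toFun x))
    (Quaternion.continuous_normSq.comp h.continuous_toFun) (fun _ => Quaternion.normSq_nonneg)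
    (fun x => by rw [← quatMat_mul, Quaternion.star_mul_self, quatMat_real])
    (fun x => by rw [← quatMat_mul, Quaternion.self_mul_star, quatMat_real])
    (fun g x => by
      rw [h.map_smul, quatMat_mul]
      exact (mul_one _).symm)
    (fun g x => by
      rw [h.map_smul, star_mul, quatMat_mul]
      change _ = _ * quatMat _
      rw [mul_assoc, ← quatMat_mul (star _), Quaternion.star_mul_self,
        Pin2.normSq_toQuat_eq_one, Quaternion.coe_one, quatMat_one, mul_one]
      exact one_mul _)
    (fun g x => by rw [h.map_smul, map_mul, Pin2.normSq_toQuat_eq_one, one_mul])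

/-- Adding equivariant maps to `ℍ` to a Clifford family removes zeros of its square outside their
common zero set; where all of the maps vanish, the class is multiplied by a power of `z`, up to
classes of product bundles. -/
theorem exists_quatSteps (f : GMap Pin2 Y X) (l : List (QuatMap X))
    (hl : ∀ h ∈ l, ∀ y, h.toFun (f y) = 0) (A : CliffordFamily X ρ) (hA : ∀ y, 0 < A.sq (f y)) :
    ∃ (κ : Type) (_ : Fintype κ) (_ : DecidableEq κ) (ρ' : MatRep Pin2 κ)
      (B : CliffordFamily X ρ'), (∀ x, A.sq x ≤ B.sq x) ∧
      (∀ h ∈ l, ∀ x, h.toFun x ≠ 0 → 0 < B.sq x) ∧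
      ∀ hB : ∀ y, 0 < B.sq (f y), ∃ c, ((B.comp f).toProj hB).cls =
        ((A.comp f).toProj hA).cls * constClass Y (zClass ^ l.length) + constClass Y c := by
  induction l generalizing ι with
  | nil => exact ⟨ι, _, _, ρ, A, fun _ => le_rfl, by simp, fun _ => ⟨0, by simp⟩⟩
  | cons h l ih =>
    have hsq : ∀ x, (A.quatStep h).sq x = A.sq x + Quaternion.normSq (h.toFun x) := fun _ => rfl
    have hle : ∀ x, A.sq x ≤ (A.quatStep h).sq x := fun x => by
      rw [hsq]; exact le_add_of_nonneg_right Quaternion.normSq_nonneg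
    have hA' : ∀ y, 0 < (A.quatStep h).sq (f y) := fun y => (hA y).trans_le (hle _)
    obtain ⟨κ, i₁, i₂, ρ', B, hB₁, hB₂, hB₃⟩ := ih (fun h' hh' => hl h' (List.mem_cons_of_mem _
        hh'))
      (A.quatStep h) hA'
    refine ⟨κ, i₁, i₂, ρ', B, fun x => (hle x).trans (hB₁ x), ?_, fun hB => ?_⟩
    · intro h' hh' x hx
      rcases List.mem_cons.1 hh' with rfl | hh'
      · refine lt_of_lt_of_le ?_ (hB₁ x)
        rw [hsq]
        exact add_pos_of_nonneg_of_pos (A.sq_nonneg x)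
          (Quaternion.normSq_nonneg.lt_of_ne' (Quaternion.normSq_ne_zero.2 hx))
      · exact hB₂ h' hh' x hx
    · obtain ⟨c, hc⟩ := hB₃ hB
      have hz : ∀ y, h.toFun (f y) = 0 := hl h List.mem_cons_self
      have hq : quatMat 0 = 0 := by simp [quatMat]
      have e := (A.comp f).cls_of_fromBlocks ((A.quatStep h).comp f) hA hA'
        (fun y => (hsq _).trans (by rw [hz, map_zero, add_zero]; rfl))
        (fun y => by
          change fromBlocks _ (_ ⊗ₖ quatMat (star (h.toFun (f y)))) (_ ⊗ₖ quatMat (h.toFun (f y))) _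
              = _
          rw [hz, star_zero, hq, kronecker_zero]
          rfl)
      rw [← zClass_eq] at e
      refine ⟨ρ.cls * quatMatRep.cls * zClass ^ l.length + c, ?_⟩
      rw [hc, e, List.length_cons, pow_succ']
      simp only [map_mul, map_add]
      ring

end QuaternionStep

/-! ### Averaging and the equivariant Tietze theorem -/

section Averaging

open MeasureTheory

instance : CompactSpace Pin2 := by
  have : ProperSpace ℍ[ℝ] := FiniteDimensional.proper ℝ _
  refine isCompact_iff_compactSpace.1 (IsClosed.isCompact ?_ : IsCompact
    (pinTwo : Set (Metric.sphere (0 : ℍ[ℝ]) 1)))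
  have h₁ : Continuous fun q : Metric.sphere (0 : ℍ[ℝ]) 1 => q.1.re :=
    Quaternion.continuous_re.comp continuous_subtype_val
  have h₂ : Continuous fun q : Metric.sphere (0 : ℍ[ℝ]) 1 => q.1.imI :=
    Quaternion.continuous_imI.comp continuous_subtype_val
  have h₃ : Continuous fun q : Metric.sphere (0 : ℍ[ℝ]) 1 => q.1.imJ :=
    Quaternion.continuous_imJ.comp continuous_subtype_val
  have h₄ : Continuous fun q : Metric.sphere (0 : ℍ[ℝ]) 1 => q.1.imK :=
    Quaternion.continuous_imK.comp continuous_subtype_val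
  exact ((isClosed_eq h₃ continuous_const).inter (isClosed_eq h₄ continuous_const)).union
    ((isClosed_eq h₁ continuous_const).inter (isClosed_eq h₂ continuous_const))

/-- A finite `G`-CW complex is the union of the images of finitely many products `G/H × D^n`, which
are compact if `G` is. -/
theorem FiniteGCWStructure.compactSpace {G : Type v} {X : Type u} [Group G] [TopologicalSpace G]
    [CompactSpace G] [TopologicalSpace X] [MulAction G X] (S : FiniteGCWStructure G X) :
    CompactSpace X := by
  have := S.finite
  have : ∀ c, CompactSpace (G ⧸ S.stab c) := fun c => Quotient.compactSpace
  have h : (Set.univ : Set X) = ⋃ c, Set.range (S.char c) := by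
    refine (Set.eq_univ_of_forall fun x => ?_).symm
    obtain ⟨c, p, d, -, h⟩ := S.covers x
    exact Set.mem_iUnion.2 ⟨c, (p, d), h⟩
  refine ⟨?_⟩
  rw [h]
  exact isCompact_iUnion fun c => isCompact_range (S.char c).continuous

variable {G : Type v} [Group G] [TopologicalSpace G] [IsTopologicalGroup G] [CompactSpace G]
  {X : Type u} [TopologicalSpace X] [MulAction G X] [ContinuousSMul G X]
  {Y : Type w} [TopologicalSpace Y] [MulAction G Y]
  {E : Type} [NormedAddCommGroup E] [NormedSpace ℝ E] [FiniteDimensional ℝ E]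

/-- The equivariant Tietze extension theorem for a compact group: extend, and average. -/
theorem exists_equivariant_extension [CompactSpace X] [T2Space X] (α : G →* (E →ₗ[ℝ] E))
    (hα : Continuous fun p : G × E => α p.1 p.2) (e : GMap G Y X)
    (he : Topology.IsClosedEmbedding e) (f : C(Y, E)) (hf : ∀ (g : G) y, f (g • y) = α g (f y)) :
    ∃ F : C(X, E), (∀ (g : G) x, F (g • x) = α g (F x)) ∧ ∀ y, F (e y) = f y := by
  have : TietzeExtension.{u} E := TietzeExtension.of_tvs ℝ
  obtain ⟨f₁, hf₁⟩ := f.exists_extension he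
  have hf₁' : ∀ y, f₁ (e y) = f y := fun y => DFunLike.congr_fun hf₁ y
  let : MeasurableSpace G := borel G
  have : BorelSpace G := ⟨rfl⟩
  -- The Haar measure normalised on the whole group.
  let μ : Measure G := Measure.haarMeasure ⊤
  have : IsProbabilityMeasure μ := ⟨Measure.haarMeasure_self⟩
  let c : C(X × G, E) := ⟨fun p => α p.2 (f₁ (p.2⁻¹ • p.1)), hα.comp (continuous_snd.prodMk
    (f₁.continuous.comp (continuous_snd.inv.smul continuous_fst)))⟩
  have hint : ∀ k : C(G, E), Integrable k μ := fun k =>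
    k.continuous.integrable_of_hasCompactSupport (HasCompactSupport.of_compactSpace k)
  have hcont : Continuous fun k : C(G, E) => ∫ g, k g ∂μ := by
    refine (LipschitzWith.of_dist_le_mul (K := 1) fun k l => ?_).continuous
    rw [dist_eq_norm, ← integral_sub (hint k) (hint l), NNReal.coe_one, one_mul]
    refine (norm_integral_le_of_norm_le_const (C := dist k l) (Filter.Eventually.of_forall
      fun g => ?_)).trans ?_
    · rw [← dist_eq_norm]; exact ContinuousMap.dist_apply_le_dist g
    · simp
  refine ⟨⟨fun x => ∫ g, c.curry x g ∂μ, hcont.comp c.curry.continuous⟩, fun h x => ?_, fun y => ?_⟩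
  · change ∫ g, α g (f₁ (g⁻¹ • h • x)) ∂μ = α h (∫ g, α g (f₁ (g⁻¹ • x)) ∂μ)
    have h₁ := (LinearMap.toContinuousLinearMap (α h)).integral_comp_comm (hint (c.curry x))
    refine Eq.trans ?_ h₁
    rw [← integral_mul_left_eq_self _ h]
    refine integral_congr_ae (Filter.Eventually.of_forall fun g => ?_)
    change α (h * g) (f₁ ((h * g)⁻¹ • h • x)) = α h (α g (f₁ (g⁻¹ • x)))
    rw [map_mul, Module.End.mul_apply, _root_.mul_inv_rev, mul_smul, inv_smul_smul]
  · change ∫ g, α g (f₁ (g⁻¹ • e y)) ∂μ = f y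
    have h₁ : ∀ g, α g (f₁ (g⁻¹ • e y)) = f y := fun g => by
      have h₂ : g⁻¹ • e y = e (g⁻¹ • y) := (e.map_smul' _ _).symm
      rw [h₂, hf₁', hf, ← Module.End.mul_apply, ← map_mul, mul_inv_cancel, map_one]
      rfl
    simp [h₁]

end Averaging

/-! ### Extension of equivariant maps to linear representations -/

section Extension

variable {X : Type u} [TopologicalSpace X] [MulAction Pin2 X] [ContinuousSMul Pin2 X]
  {Y : Type w} [TopologicalSpace Y] [MulAction Pin2 Y]

theorem CircleFixed.isClosedEmbedding [T2Space X] :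
    Topology.IsClosedEmbedding (CircleFixed.incl X) := by
  refine IsClosed.isClosedEmbedding_subtypeVal (X := X) ?_
  have h : {x : X | ∀ g : Pin2, g.sign = 1 → g • x = x} =
      ⋂ g : Pin2, ⋂ _ : g.sign = 1, {x | g • x = x} := by ext; simp
  change IsClosed {x : X | ∀ g : Pin2, g.sign = 1 → g • x = x}
  rw [h]
  exact isClosed_iInter fun g => isClosed_iInter fun _ =>
    isClosed_eq (continuous_const_smul g) continuous_id

theorem CircleFixed.compactSpace [T2Space X] [CompactSpace X] : CompactSpace (CircleFixed X) :=
  CircleFixed.isClosedEmbedding.compactSpace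

theorem SignMap.ext {t : ℕ} {q q' : SignMap Y t} (h₁ : ∀ y, q.re y = q'.re y)
    (h₂ : ∀ y, q.vec y = q'.vec y) : q = q' := by
  cases q; cases q'
  obtain rfl := funext h₁
  obtain rfl := funext h₂
  rfl

theorem SignMap.exists_extension [CompactSpace X] [T2Space X] {t : ℕ} (e : GMap Pin2 Y X)
    (he : Topology.IsClosedEmbedding e) (q : SignMap Y t) : ∃ Q : SignMap X t, Q.comp e = q := by
  obtain ⟨F₁, h₁, h₁'⟩ := exists_equivariant_extension (E := ℝ) 1 continuous_snd e he
    ⟨q.re, q.continuous_re⟩ q.re_smul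
  let α : Pin2 →* ((Fin t → ℂ) →ₗ[ℝ] (Fin t → ℂ)) :=
    { toFun := fun g => Pin2.signC g • LinearMap.id
      map_one' := by rw [Pin2.signC_one, one_smul]; rfl
      map_mul' := fun g h => by
        ext v
        simp [Pin2.signC_mul, mul_assoc] }
  obtain ⟨F₂, h₂, h₂'⟩ := exists_equivariant_extension α
    ((Pin2.continuous_signC.comp continuous_fst).smul continuous_snd) e he
    ⟨q.vec, q.continuous_vec⟩ q.vec_smul
  exact ⟨⟨F₁, F₂, F₁.continuous, F₂.continuous, h₁, h₂⟩, SignMap.ext h₁' h₂'⟩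

/-- At a point `x` with trivial stabiliser some equivariant map to the quaternions does not vanish:
extend `g x ↦ g` from the orbit of `x`, which is closed. -/
theorem QuatMap.exists_ne_zero [CompactSpace X] [T2Space X] (x : X)
    (hx : ∀ g : Pin2, g • x = x → g = 1) : ∃ h : QuatMap X, h.toFun x ≠ 0 := by
  let e : GMap Pin2 Pin2 X := ⟨⟨fun g => g • x, by fun_prop⟩, fun g h => mul_smul g h x⟩
  have he : Topology.IsClosedEmbedding e := by
    refine e.continuous.isClosedEmbedding fun g h hgh => ?_
    have h₁ : g • x = h • x := hgh
    have := hx (h⁻¹ * g) (by rw [mul_smul, h₁, inv_smul_smul])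
    exact (inv_mul_eq_one.1 this).symm
  let α : Pin2 →* (ℍ[ℝ] →ₗ[ℝ] ℍ[ℝ]) :=
    { toFun := fun g => LinearMap.mulLeft ℝ g.toQuat
      map_one' := by rw [Pin2.toQuat_one]; exact LinearMap.mulLeft_one ℝ _
      map_mul' := fun g h => by rw [Pin2.toQuat_mul]; exact LinearMap.mulLeft_mul ℝ _ _ _ }
  obtain ⟨F, h₁, h₂⟩ := exists_equivariant_extension α
    ((Pin2.continuous_toQuat.comp continuous_fst).mul continuous_snd) e he
    ⟨Pin2.toQuat, Pin2.continuous_toQuat⟩ fun g h => Pin2.toQuat_mul g h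
  refine ⟨⟨F, F.continuous, h₁⟩, ?_⟩
  have h₃ : F x = 1 := by
    have := h₂ 1
    rw [show e (1 : Pin2) = x from one_smul _ _] at this
    exact this
  change F x ≠ 0
  rw [h₃]
  exact one_ne_zero

/-- The element `-1` of `Pin(2)`. -/
noncomputable def Pin2.negOne : Pin2 := ⟨-1, Or.inl ⟨by simp, by simp⟩⟩

theorem Pin2.toQuat_negOne : Pin2.negOne.toQuat = -1 := rfl

/-- Equivariant maps to the quaternions vanish on `X^{S¹}`, because `-1 ∈ S¹` acts as `-1`. -/
theorem QuatMap.eq_zero_of_circleFixed (h : QuatMap X) (y : CircleFixed X) :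
    h.toFun (CircleFixed.incl X y) = 0 := by
  have h₁ : Pin2.negOne.sign = 1 := by
    have : Pin2.negOne.InCircle := by simp [Pin2.InCircle, Pin2.toQuat_negOne]
    simp [Pin2.sign, this]
  have h₂ := h.map_smul Pin2.negOne y.1
  rw [y.2 _ h₁, Pin2.toQuat_negOne, neg_one_mul] at h₂
  refine (smul_eq_zero.1 (?_ : (2 : ℝ) • h.toFun y.1 = 0)).resolve_left two_ne_zero
  rw [two_smul]
  nth_rewrite 1 [h₂]
  exact neg_add_cancel _

end Extension

/-! ### Pullbacks and the base point -/

section BasePoint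

open OnePoint

variable {G : Type v} [Group G] [TopologicalSpace G]
variable {X : Type u} [TopologicalSpace X] [MulAction G X]
  {Y : Type w} [TopologicalSpace Y] [MulAction G Y]

theorem GMap.ext {f f' : GMap G X Y} (h : ∀ x, f x = f' x) : f = f' := by
  cases f; cases f'
  congr
  exact ContinuousMap.ext h

theorem KG.pullback_mk (f : GMap G Y X) (E : GVectorBundle G X) :
    KG.pullback f (KG.mk E) = KG.mk (E.pullback f.toContinuousMap f.map_smul') :=
  KG.pullback_of _ _

theorem KG.pullback_comp {Z : Type*} [TopologicalSpace Z] [MulAction G Z] (f : GMap G Y X)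
    (f' : GMap G Z Y) (ξ : KG G X) :
    KG.pullback (f.comp f') ξ = KG.pullback f' (KG.pullback f ξ) := by
  obtain ⟨b, c, rfl⟩ := GrothendieckRing.exists_sub ξ
  have h : ∀ b : GVectorBundle.IsoClass G X,
      KG.pullback (f.comp f') (GrothendieckRing.of b) =
        KG.pullback f' (KG.pullback f (GrothendieckRing.of b)) := by
    intro b
    rw [KG.pullback_of, KG.pullback_of, KG.pullback_of]
    refine congrArg GrothendieckRing.of ?_
    obtain ⟨E⟩ := b
    rfl
  simp only [map_sub, h]

/-- The Bott class restricts to zero at the base point. -/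
theorem pullback_infty_bottClass (t : ℕ) :
    KG.pullback (GMap.ofFixedPoint (∞ : RepSphere (Fin t → ℂ)) RepSphere.smul_infty)
      (bottClass t) = 0 := by
  rw [bottClass, map_sub, KG.pullback_mk, KG.pullback_mk, sub_eq_zero]
  refine congrArg GrothendieckRing.of (Quotient.sound ⟨⟨fun _ => LinearEquiv.refl ℂ (extPart t 1),
    fun _ _ _ _ _ => rfl, fun _ _ _ _ => ?_, fun _ _ _ _ => ?_⟩⟩)
  · exact continuous_of_discreteTopology
  · exact continuous_of_discreteTopology

end BasePoint

/-! ### Powers of `z` in the ideal `𝔍(X)` -/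

section FixedIdeal

open OnePoint

variable {X : Type u} [TopologicalSpace X] [MulAction Pin2 X]

/-- A class on `X` whose restriction to `X^{S¹}` is `a b` up to the class of a product bundle
witnesses `a ∈ 𝔍(X)`, since the product bundle can be removed by evaluation at the base point. -/
theorem mem_fixedIdeal_of_eq_add_const {x₀ : X} {t : ℕ} (φ : SphereFraming x₀ (Fin t → ℂ))
    {a c : RepRing Pin2} {ξ : KG Pin2 X}
    (h : KG.pullback (CircleFixed.incl X) ξ =
      constClass _ a * KG.pullback φ.toGMap (bottClass t) + constClass _ c) :
    a ∈ fixedIdeal φ := by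
  have h₁ : KG.pullback (CircleFixed.incl X) (ξ - constClass X c) =
      constClass _ a * KG.pullback φ.toGMap (bottClass t) := by
    rw [map_sub, h, constClass, KG.pullback_toPoint, add_sub_cancel_right]
  refine ⟨ξ - constClass X c, ?_, h₁⟩
  let y₀ : CircleFixed X := ⟨x₀, fun g _ => φ.fixed_base g⟩
  have hy₀ : ∀ g : Pin2, g • y₀ = y₀ := fun g => Subtype.ext (φ.fixed_base g)
  have e₁ : GMap.ofFixedPoint x₀ φ.fixed_base =
      (CircleFixed.incl X).comp (GMap.ofFixedPoint y₀ hy₀) := rfl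
  have e₂ : φ.toGMap.comp (GMap.ofFixedPoint y₀ hy₀) =
      GMap.ofFixedPoint (∞ : RepSphere (Fin t → ℂ)) RepSphere.smul_infty :=
    GMap.ext fun _ => φ.map_base
  refine (RingHom.mem_ker).2 ?_
  rw [e₁, KG.pullback_comp, h₁, map_mul, ← KG.pullback_comp φ.toGMap, e₂, pullback_infty_bottClass,
      mul_zero]

/-- Some power of `z` lies in `𝔍(X)`: the Clifford multiplication representing the Bott class
extends to `X` if its zeros, which lie in free orbits, are removed by adding maps to `ℍ`. -/
theorem exists_zClass_pow_mem [ContinuousSMul Pin2 X] {x₀ : X} {t : ℕ} (hX : IsSWF x₀ (2 * t))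
    (φ : SphereFraming x₀ (Fin t → ℂ)) : ∃ n : ℕ, zClass ^ n ∈ fixedIdeal φ := by
  have := hX.hausdorff
  obtain ⟨S⟩ := hX.cellular
  have := S.compactSpace
  obtain ⟨q, hq⟩ := SignMap.exists_extension (CircleFixed.incl X) CircleFixed.isClosedEmbedding
    ((sphereMap t).comp φ.toGMap)
  have hq0 : ∀ y, 0 < q.sq (CircleFixed.incl X y) := fun y => by
    have : (q.comp (CircleFixed.incl X)).sq y = 1 := by rw [hq]; exact sphereMap_sq _
    exact this.symm ▸ one_pos
  have hz : ∀ x, ∃ h : QuatMap X, q.sq x = 0 → h.toFun x ≠ 0 := fun x => by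
    by_cases hx : ∀ g : Pin2, g.sign = 1 → g • x = x
    · exact ⟨⟨fun _ => 0, continuous_const, fun _ _ => (mul_zero _).symm⟩,
        fun h0 => absurd h0 (hq0 ⟨x, hx⟩).ne'⟩
    · obtain ⟨h, hh⟩ := QuatMap.exists_ne_zero x (hX.free x hx)
      exact ⟨h, fun _ => hh⟩
  choose h hh using hz
  have hZ : IsCompact {x | q.sq x = 0} :=
    (isClosed_eq q.clifford.continuous_sq continuous_const).isCompact
  obtain ⟨s, hs⟩ := hZ.elim_nhds_subcover (fun x => {y | (h x).toFun y ≠ 0} ∪ {y | q.sq y ≠ 0})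
    fun x hx => ((isOpen_ne_fun (h x).continuous_toFun continuous_const).union
      (isOpen_ne_fun q.clifford.continuous_sq continuous_const)).mem_nhds (Or.inl (hh x hx))
  obtain ⟨κ, _, _, ρ', B, hB₁, hB₂, hB₃⟩ := exists_quatSteps (CircleFixed.incl X)
    (s.toList.map h) (fun k hk y => k.eq_zero_of_circleFixed y) q.clifford hq0
  have hB : ∀ x, 0 < B.sq x := fun x => by
    by_cases hx : q.sq x = 0
    · obtain ⟨i, hi, hx'⟩ := Set.mem_iUnion₂.1 (hs.2 hx)
      exact hB₂ (h i) (List.mem_map.2 ⟨i, Finset.mem_toList.2 hi, rfl⟩) x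
        (hx'.resolve_right fun h' => h' hx)
    · exact ((q.clifford.sq_nonneg x).lt_of_ne' hx).trans_le (hB₁ x)
  obtain ⟨c, hc⟩ := hB₃ fun y => hB _
  obtain ⟨c', hc'⟩ := exists_bottClass_eq t
  refine ⟨(s.toList.map h).length, mem_fixedIdeal_of_eq_add_const φ (ξ := (B.toProj hB).cls)
    (c := c - zClass ^ (s.toList.map h).length * c') ?_⟩
  have e : ((q.clifford.comp (CircleFixed.incl X)).toProj hq0).cls =
      KG.pullback φ.toGMap (bottClass t) - constClass _ c' := by
    rw [hc', map_add, constClass, constClass, KG.pullback_toPoint, add_sub_cancel_right,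
      SignMap.pullback_cls]
    exact ProjFamily.cls_congr fun y => by simp only [← hq]; rfl
  rw [B.pullback_cls, hc, e]
  simp only [map_sub, map_mul]
  ring

end FixedIdeal

/-! ### Generic linear perturbations -/

section Transversality

variable {E : Type} [NormedAddCommGroup E] [NormedSpace ℝ E] [FiniteDimensional ℝ E] {t t' : ℕ}

theorem finrank_pi_complex (ι : Type) [Fintype ι] :
    Module.finrank ℝ (ι → Fin t' → ℂ) = Fintype.card ι * (2 * t') := by
  simp [Module.finrank_pi_fintype, mul_comm]

/-- A `C¹` family `q` of vectors in `ℂ^{t'}` with fewer than `2t'` real parameters is made non-zero,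
wherever `u ≠ 0`, by a generic linear perturbation in `u`: the perturbations for which this fails
are parametrised by a zero and all columns but one. -/
theorem dense_setOf_forall_add_sum_ne_zero {q : E → Fin t' → ℂ} {u : E → Fin t → ℂ}
    (hq : ContDiff ℝ 1 q) (hu : ContDiff ℝ 1 u) (hE : Module.finrank ℝ E < 2 * t') :
    Dense {c : Fin t → Fin t' → ℂ | ∀ e, u e ≠ 0 → q e + ∑ l, u e l • c l ≠ 0} := by
  rcases Nat.eq_zero_or_pos t with rfl | ht
  · have : {c : Fin 0 → Fin t' → ℂ | ∀ e, u e ≠ 0 → q e + ∑ l, u e l • c l ≠ 0} = Set.univ :=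
      Set.eq_univ_of_forall fun c e he => absurd (Subsingleton.elim _ _) he
    rw [this]
    exact dense_univ
  -- If `q e + ∑ l, u e l • c l = 0` and `u e k ≠ 0`, then column `k` of `c` is determined by `e`
  -- and the other columns; `Φ k` is the resulting parametrisation of the bad perturbations.
  let D : Fin t → Type := fun k => E × ({l : Fin t // l ≠ k} → Fin t' → ℂ)
  let S : ∀ k, Set (D k) := fun k => {p | u p.1 k ≠ 0}
  let Φ : ∀ k, D k → Fin t → Fin t' → ℂ := fun k p l =>
    if h : l = k then -(u p.1 k)⁻¹ • (q p.1 + ∑ l : {l : Fin t // l ≠ k}, u p.1 l • p.2 l)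
    else p.2 ⟨l, h⟩
  have hΦ : ∀ k, ∀ p ∈ S k, ContDiffAt ℝ 1 (Φ k) p := by
    intro k p hp
    have h₁ : ∀ l, ContDiff ℝ 1 fun p : D k => u p.1 l := fun l =>
      (contDiff_apply ℝ ℂ l).comp (hu.comp contDiff_fst)
    have h₂ : ∀ l : {l : Fin t // l ≠ k}, ContDiff ℝ 1 fun p : D k => p.2 l := fun l =>
      (contDiff_apply ℝ (Fin t' → ℂ) l).comp contDiff_snd
    refine contDiffAt_pi.2 fun l => ?_
    by_cases h : l = k
    · simp only [Φ, dif_pos h]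
      refine ContDiffAt.smul ((h₁ k).contDiffAt.inv hp).neg ?_
      exact ((hq.comp contDiff_fst).add
        (ContDiff.sum fun (l : {l : Fin t // l ≠ k}) _ => (h₁ l).smul (h₂ l))).contDiffAt
    · simp only [Φ, dif_neg h]
      exact (h₂ ⟨l, h⟩).contDiffAt
  have hdim : ∀ k, dimH (Φ k '' S k) ≤ (Module.finrank ℝ E + (t - 1) * (2 * t') : ℕ) := by
    intro k
    have h₁ : dimH (Φ k '' S k) ≤ dimH (S k) := dimH_image_le_of_locally_lipschitzOn fun p hp => by
      obtain ⟨K, s, hs, hK⟩ := (hΦ k p hp).exists_lipschitzOnWith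
      exact ⟨K, s, mem_nhdsWithin_of_mem_nhds hs, hK⟩
    refine h₁.trans ((dimH_mono (Set.subset_univ _)).trans ?_)
    rw [Real.dimH_univ_eq_finrank, Module.finrank_prod, finrank_pi_complex]
    simp
  have hlt : dimH (⋃ k, Φ k '' S k) < Module.finrank ℝ (Fin t → Fin t' → ℂ) := by
    rw [dimH_iUnion, finrank_pi_complex, Fintype.card_fin]
    refine (iSup_le hdim).trans_lt (Nat.cast_lt.2 ?_)
    obtain ⟨n, rfl⟩ : ∃ n, t = n + 1 := ⟨t - 1, by omega⟩
    rw [Nat.add_sub_cancel, add_mul]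
    omega
  refine (dense_compl_of_dimH_lt_finrank hlt).mono fun c hc e he h0 => (hc : c ∉ _) ?_
  obtain ⟨k, hk⟩ := Function.ne_iff.1 he
  refine Set.mem_iUnion.2 ⟨k, (e, fun l => c l), hk, funext fun l => ?_⟩
  by_cases h : l = k
  · subst h
    simp only [Φ, dif_pos]
    have h₁ := Fintype.sum_eq_add_sum_subtype_ne (fun i => u e i • c i) l
    have h₂ : q e + ∑ i : {i : Fin t // i ≠ l}, u e i • c i = -(u e l • c l) := by
      rw [h₁] at h0
      rw [eq_neg_iff_add_eq_zero, add_assoc, add_comm (∑ i : {i : Fin t // i ≠ l}, u e i • c i)]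
      exact h0
    rw [h₂, neg_smul_neg, smul_smul, inv_mul_cancel₀ hk, one_smul]
  · simp only [Φ, dif_neg h]

end Transversality

/-! ### Approximation of equivariant maps between spheres -/

section SphereApproximation

open OnePoint

variable {t t' : ℕ}

theorem contDiff_sqNorm : ContDiff ℝ 1 (sqNorm : (Fin t → ℂ) → ℝ) :=
  ContDiff.sum fun k _ => (contDiff_apply ℝ ℂ k).norm_sq ℝ

theorem contDiff_stereoRe : ContDiff ℝ 1 (stereoRe : (Fin t → ℂ) → ℝ) :=
  (contDiff_const.sub contDiff_sqNorm).div (contDiff_const.add contDiff_sqNorm)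
    fun v => (one_add_sqNorm_pos v).ne'

theorem contDiff_stereoVec : ContDiff ℝ 1 (stereoVec : (Fin t → ℂ) → _) :=
  (Complex.ofRealCLM.contDiff.comp (contDiff_const.div (contDiff_const.add contDiff_sqNorm)
    fun v => (one_add_sqNorm_pos v).ne')).smul contDiff_id

theorem stereoVec_eq (v : Fin t → ℂ) : stereoVec v = ((1 + stereoRe v : ℝ) : ℂ) • v := by
  have := (one_add_sqNorm_pos v).ne'
  rw [stereoVec, stereoRe]
  congr 2
  field_simp
  ring

theorem stereoVec_ne_zero {v : Fin t → ℂ} (hv : v ≠ 0) : stereoVec v ≠ 0 :=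
  smul_ne_zero (Complex.ofReal_ne_zero.2 (div_pos two_pos (one_add_sqNorm_pos v)).ne') hv

/-- Stereographic projection is injective. -/
theorem sphereMap_injective {x y : RepSphere (Fin t → ℂ)}
    (h₁ : (sphereMap t).re x = (sphereMap t).re y) (h₂ : (sphereMap t).vec x = (sphereMap t).vec y)
        :
    x = y := by
  by_cases hx : x = ∞
  · by_contra hy
    refine sphereMap_re_ne_neg_one (x := y) (fun h => hy (hx.trans h.symm)) ?_
    rw [← h₁, hx]
    change 1 + ((-1 : ℝ) : ℂ) = 0
    norm_num
  by_cases hy : y = ∞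
  · refine absurd ?_ (sphereMap_re_ne_neg_one hx)
    rw [h₁, hy]
    change 1 + ((-1 : ℝ) : ℂ) = 0
    norm_num
  obtain ⟨v, rfl⟩ := OnePoint.ne_infty_iff_exists.1 hx
  obtain ⟨v', rfl⟩ := OnePoint.ne_infty_iff_exists.1 hy
  have key : ∀ v v' : Fin t → ℂ, stereoRe v = stereoRe v' → stereoVec v = stereoVec v' → v = v' :=
      by
    intro v v' h₁ h₂
    rw [stereoVec_eq, stereoVec_eq, h₁] at h₂
    refine smul_right_injective _ ?_ h₂
    push_cast
    exact one_add_stereoRe_ne_zero v'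
  exact congrArg _ (key v v' h₁ h₂)

/-- The algebra of continuous functions on the sphere that are `C¹` in the affine chart. -/
def sphereSmooth (t : ℕ) : Subalgebra ℝ C(RepSphere (Fin t → ℂ), ℝ) where
  carrier := {f | ContDiff ℝ 1 fun v : Fin t → ℂ => f (OnePoint.some v)}
  mul_mem' := fun {f g} (hf : ContDiff ℝ 1 fun v : Fin t → ℂ => f (OnePoint.some v))
    (hg : ContDiff ℝ 1 fun v : Fin t → ℂ => g (OnePoint.some v)) => hf.mul hg
  add_mem' := fun {f g} (hf : ContDiff ℝ 1 fun v : Fin t → ℂ => f (OnePoint.some v))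
    (hg : ContDiff ℝ 1 fun v : Fin t → ℂ => g (OnePoint.some v)) => hf.add hg
  algebraMap_mem' r := (contDiff_const : ContDiff ℝ 1 fun _ : Fin t → ℂ => r)

theorem mem_sphereSmooth {f : C(RepSphere (Fin t → ℂ), ℝ)} : f ∈ sphereSmooth t ↔
    ContDiff ℝ 1 fun v : Fin t → ℂ => f (OnePoint.some v) := Iff.rfl

theorem separatesPoints_sphereSmooth (t : ℕ) : (sphereSmooth t).SeparatesPoints := by
  intro x y hxy
  by_contra! h
  have h' : ∀ f ∈ sphereSmooth t, f x = f y := fun f hf => h f ⟨f, hf, rfl⟩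
  have hc : ∀ k, Continuous fun x => (sphereMap t).vec x k := fun k =>
    (continuous_apply k).comp (sphereMap t).continuous_vec
  refine hxy (sphereMap_injective (h' ⟨_, (sphereMap t).continuous_re⟩ (mem_sphereSmooth.2
      contDiff_stereoRe))
    (funext fun k => Complex.ext ?_ ?_))
  · exact h' ⟨_, Complex.continuous_re.comp (hc k)⟩
      (mem_sphereSmooth.2
        (Complex.reCLM.contDiff.comp ((contDiff_apply ℝ ℂ k).comp contDiff_stereoVec)))
  · exact h' ⟨_, Complex.continuous_im.comp (hc k)⟩
      (mem_sphereSmooth.2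
        (Complex.imCLM.contDiff.comp ((contDiff_apply ℝ ℂ k).comp contDiff_stereoVec)))

/-- By the Stone–Weierstrass theorem, continuous functions on the sphere are limits of functions
    that
are `C¹` in the affine chart. -/
theorem exists_smooth_approx (p : C(RepSphere (Fin t → ℂ), Fin t' → ℂ)) {ε : ℝ} (hε : 0 < ε) :
    ∃ q : C(RepSphere (Fin t → ℂ), Fin t' → ℂ),
      (ContDiff ℝ 1 fun v : Fin t → ℂ => q (OnePoint.some v)) ∧ ∀ x, ‖q x - p x‖ < ε := by
  have key := fun (f : C(RepSphere (Fin t → ℂ), ℝ)) =>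
    ContinuousMap.exists_mem_subalgebra_near_continuous_of_separatesPoints (sphereSmooth t)
      (separatesPoints_sphereSmooth t) f f.continuous (ε / 2) (half_pos hε)
  have hc : ∀ i, Continuous fun x => p x i := fun i => (continuous_apply i).comp p.continuous
  choose g hg using fun i => key ⟨_, Complex.continuous_re.comp (hc i)⟩
  choose h hh using fun i => key ⟨_, Complex.continuous_im.comp (hc i)⟩
  refine ⟨⟨fun x i => (g i).1 x + (h i).1 x * Complex.I, by fun_prop⟩,
    contDiff_pi.2 fun i => ?_, fun x => (pi_norm_lt_iff hε).2 fun i => ?_⟩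
  · exact (Complex.ofRealCLM.contDiff.comp (mem_sphereSmooth.1 (g i).2)).add
      ((Complex.ofRealCLM.contDiff.comp (mem_sphereSmooth.1 (h i).2)).mul contDiff_const)
  · change ‖((g i).1 x + (h i).1 x * Complex.I : ℂ) - p x i‖ < ε
    refine (Complex.norm_le_abs_re_add_abs_im _).trans_lt ?_
    have h₁ : |(g i).1 x - (p x i).re| < ε / 2 := hg i x
    have h₂ : |(h i).1 x - (p x i).im| < ε / 2 := hh i x
    simp only [Complex.sub_re, Complex.add_re, Complex.ofReal_re, Complex.mul_re, Complex.I_re,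
      Complex.ofReal_im, Complex.I_im, Complex.sub_im, Complex.add_im, Complex.mul_im]
    ring_nf at h₁ h₂ ⊢
    linarith

/-- The involution `v ↦ -v` of the representation sphere, by which the elements of `j S¹` act; it
fixes `0` and `∞`. -/
noncomputable def sphereNeg (t : ℕ) : RepSphere (Fin t → ℂ) ≃ₜ RepSphere (Fin t → ℂ) :=
  Homeomorph.onePointCongr (X := Fin t → ℂ) (Y := Fin t → ℂ) (Homeomorph.neg _)

theorem smul_eq_of_signC_one {g : Pin2} (hg : Pin2.signC g = 1) (x : RepSphere (Fin t → ℂ)) :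
    g • x = x := by
  cases x using OnePoint.rec with
  | infty => rfl
  | coe v => exact congrArg OnePoint.some ((Bott.sign_smul_eq g v).trans
    ((congrArg (· • (id v : Fin t → ℂ)) hg).trans (one_smul ℂ (id v : Fin t → ℂ))))

theorem smul_eq_of_signC_neg_one {g : Pin2} (hg : Pin2.signC g = -1) (x : RepSphere (Fin t → ℂ)) :
    g • x = sphereNeg t x := by
  cases x using OnePoint.rec with
  | infty => rfl
  | coe v =>
    exact congrArg OnePoint.some ((Bott.sign_smul_eq g v).trans
      ((congrArg (· • (id v : Fin t → ℂ)) hg).trans (neg_one_smul ℂ (id v : Fin t → ℂ))))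

/-- The quaternion `j`. -/
def quatJ : ℍ[ℝ] := ⟨0, 0, 1, 0⟩

@[simp] theorem quatJ_re : quatJ.re = 0 := rfl
@[simp] theorem quatJ_imI : quatJ.imI = 0 := rfl
@[simp] theorem quatJ_imJ : quatJ.imJ = 1 := rfl
@[simp] theorem quatJ_imK : quatJ.imK = 0 := rfl

/-- The element `j` of `Pin(2)`. -/
noncomputable def Pin2.j : Pin2 :=
  ⟨⟨quatJ, by
    rw [mem_sphere_zero_iff_norm, ← sq_eq_sq₀ (norm_nonneg _) zero_le_one, sq,
      ← Quaternion.normSq_eq_norm_mul_self, Quaternion.normSq_def']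
    change (0 : ℝ) ^ 2 + 0 ^ 2 + 1 ^ 2 + 0 ^ 2 = 1 ^ 2
    norm_num⟩, Or.inr ⟨rfl, rfl⟩⟩

theorem Pin2.not_inCircle_j : ¬ Pin2.j.InCircle := fun h => one_ne_zero (α := ℝ) h.1

theorem Pin2.signC_j : Pin2.signC Pin2.j = -1 := by
  simp [signC, sign, not_inCircle_j]

/-- A generic equivariant perturbation of the vector part of a map between spheres avoids, away
from the two fixed points, all real multiples of a given linear map. -/
theorem SignMap.exists_perturbation (htt' : t < t') (q : SignMap (RepSphere (Fin t → ℂ)) t')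
    (L : (Fin t → ℂ) →ₗ[ℂ] (Fin t' → ℂ)) {ε : ℝ} (hε : 0 < ε) :
    ∃ q' : SignMap (RepSphere (Fin t → ℂ)) t', q'.re = q.re ∧ (∀ x, ‖q'.vec x - q.vec x‖ < ε) ∧
      ∀ v : Fin t → ℂ, v ≠ 0 → ∀ a : ℝ,
        q'.vec (OnePoint.some v) + (a : ℂ) • L (stereoVec v) ≠ 0 := by
  obtain ⟨p, hp, hpq⟩ := exists_smooth_approx ⟨q.vec, q.continuous_vec⟩ (half_pos hε)
  -- Taking the odd part makes the approximation equivariant.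
  let p' : RepSphere (Fin t → ℂ) → Fin t' → ℂ := fun x => (2⁻¹ : ℂ) • (p x - p (sphereNeg t x))
  have hp' : Continuous p' :=
    (p.continuous.sub (p.continuous.comp (sphereNeg t).continuous)).const_smul (2⁻¹ : ℂ)
  have hneg : ∀ x, sphereNeg t (sphereNeg t x) = x := fun x => by
    rw [← smul_eq_of_signC_neg_one Pin2.signC_j, ← smul_eq_of_signC_neg_one Pin2.signC_j, smul_smul]
    exact smul_eq_of_signC_one (by rw [Pin2.signC_mul, Pin2.signC_j]; norm_num) x
  have hodd : ∀ x, q.vec (sphereNeg t x) = -q.vec x := fun x => by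
    rw [← smul_eq_of_signC_neg_one Pin2.signC_j, q.vec_smul, Pin2.signC_j, neg_one_smul]
  have hp's : ∀ (g : Pin2) x, p' (g • x) = Pin2.signC g • p' x := fun g x => by
    rcases signC_eq g with hg | hg
    · rw [smul_eq_of_signC_one hg, hg, one_smul]
    · simp only [p', smul_eq_of_signC_neg_one hg, hg, hneg]
      module
  have hp'q : ∀ x, ‖p' x - q.vec x‖ < ε / 2 := fun x => by
    have e : p' x - q.vec x = (2⁻¹ : ℂ) • ((p x - q.vec x) -
        (p (sphereNeg t x) - q.vec (sphereNeg t x))) := by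
      rw [hodd]
      simp only [p']
      module
    have h₁ : ‖p x - q.vec x‖ < ε / 2 := hpq x
    have h₂ : ‖p (sphereNeg t x) - q.vec (sphereNeg t x)‖ < ε / 2 := hpq _
    rw [e, norm_smul]
    have h₃ := norm_sub_le (p x - q.vec x) (p (sphereNeg t x) - q.vec (sphereNeg t x))
    norm_num
    linarith
  have hp'd : ContDiff ℝ 1 fun v : Fin t → ℂ => p' (OnePoint.some v) := by
    have h : ContDiff ℝ 1 fun v : Fin t → ℂ => p (sphereNeg t (OnePoint.some v)) :=
      hp.comp (contDiff_neg (𝕜 := ℝ) (F := Fin t → ℂ))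
    exact ContDiff.const_smul (R := ℂ) (2⁻¹ : ℂ) (hp.sub h)
  have hL : ContDiff ℝ 1 L := (LinearMap.toContinuousLinearMap
    (L.restrictScalars ℝ : (Fin t → ℂ) →ₗ[ℝ] (Fin t' → ℂ))).contDiff
  -- The parameters are `v` and the multiple `a` of `L`, of real dimension `2t + 1 < 2t'`.
  have hdense := dense_setOf_forall_add_sum_ne_zero (t' := t') (E := (Fin t → ℂ) × ℝ)
    (q := fun e => p' (OnePoint.some e.1) + (e.2 : ℂ) • L (stereoVec e.1))
    (u := fun e => stereoVec e.1)
    ((hp'd.comp contDiff_fst).add ((Complex.ofRealCLM.contDiff.comp contDiff_snd).smul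
      ((hL.comp contDiff_stereoVec).comp contDiff_fst)))
    (contDiff_stereoVec.comp contDiff_fst) (by
      simp only [Module.finrank_prod, Module.finrank_pi_fintype, Complex.finrank_real_complex,
        Module.finrank_self, Finset.sum_const, Finset.card_univ, Fintype.card_fin, smul_eq_mul]
      omega)
  obtain ⟨c, hc, hcn⟩ := Metric.dense_iff.1 hdense 0 (ε / (2 * (t + 1))) (by positivity)
  rw [mem_ball_zero_iff] at hc
  have hu : ∀ x l, ‖(sphereMap t).vec x l‖ ≤ 1 := fun x l => by
    have h₁ := norm_sq_le_sqNorm ((sphereMap t).vec x) l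
    have h₂ : (sphereMap t).re x ^ 2 + sqNorm ((sphereMap t).vec x) = 1 := sphereMap_sq x
    nlinarith [sq_nonneg ((sphereMap t).re x), norm_nonneg ((sphereMap t).vec x l)]
  refine ⟨⟨q.re, fun x => p' x + ∑ l, (sphereMap t).vec x l • c l, q.continuous_re, ?_, q.re_smul,
    fun g x => ?_⟩, rfl, fun x => ?_, fun v hv a => ?_⟩
  · have := (sphereMap t).continuous_vec
    exact hp'.add (continuous_finsetSum _ fun l _ =>
      ((continuous_apply l).comp this).smul continuous_const)
  · simp only [hp's, (sphereMap t).vec_smul, smul_add, Finset.smul_sum, Pi.smul_apply, smul_assoc]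
  · have h₁ : ‖∑ l, (sphereMap t).vec x l • c l‖ ≤ t * ‖c‖ := by
      refine (norm_sum_le_of_le _ fun l _ => ?_).trans_eq (b := ∑ _ : Fin t, ‖c‖) (by simp)
      rw [norm_smul]
      exact (mul_le_of_le_one_left (norm_nonneg _) (hu x l)).trans (norm_le_pi_norm c l)
    have h₂ : t * ‖c‖ ≤ ε / 2 := by
      rw [lt_div_iff₀ (by positivity)] at hc
      nlinarith [norm_nonneg c]
    have h₃ : p' x + ∑ l, (sphereMap t).vec x l • c l - q.vec x =
        (p' x - q.vec x) + ∑ l, (sphereMap t).vec x l • c l := by abel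
    change ‖p' x + ∑ l, (sphereMap t).vec x l • c l - q.vec x‖ < ε
    rw [h₃]
    refine (norm_add_le _ _).trans_lt ?_
    linarith [hp'q x]
  · have h := hcn (v, a) (stereoVec_ne_zero hv)
    rw [add_right_comm] at h
    exact h

end SphereApproximation

/-! ### Equivariant maps between spheres up to homotopy -/

section SphereHomotopy

open OnePoint

variable {Y : Type u} [TopologicalSpace Y] [MulAction Pin2 Y] {t t' : ℕ}

/-- The convex combination of two equivariant maps to `ℝ ⊕ ℂ̃^t`. -/
def SignMap.lineMap (q q' : SignMap Y t) (r : unitInterval) : SignMap Y t where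
  re y := (1 - r.1) * q.re y + r.1 * q'.re y
  vec y := ((1 - r.1 : ℝ) : ℂ) • q.vec y + (r.1 : ℂ) • q'.vec y
  continuous_re := (continuous_const.mul q.continuous_re).add (continuous_const.mul
      q'.continuous_re)
  continuous_vec := (q.continuous_vec.const_smul ((1 - r.1 : ℝ) : ℂ)).add
    (q'.continuous_vec.const_smul (r.1 : ℂ))
  re_smul g y := by rw [q.re_smul, q'.re_smul]
  vec_smul g y := by rw [q.vec_smul, q'.vec_smul, smul_add, smul_comm, smul_comm (r.1 : ℂ)]

/-- Equivariant maps joined by a straight line through nowhere vanishing maps have the same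
class. -/
theorem SignMap.cls_eq_of_lineMap [CompactSpace Y] (q q' : SignMap Y t) (h : ∀ y, 0 < q.sq y)
    (h' : ∀ y, 0 < q'.sq y) (hq : ∀ (r : unitInterval) y, 0 < (q.lineMap q' r).sq y) :
    q.cls h = q'.cls h' := by
  have h₁ : q.lineMap q' 0 = q := SignMap.ext (fun y => by simp [lineMap]) fun y => by simp
      [lineMap]
  have h₂ : q.lineMap q' 1 = q' := SignMap.ext (fun y => by simp [lineMap]) fun y => by simp
      [lineMap]
  have e : (q.lineMap q' 0).cls (hq 0) = (q.lineMap q' 1).cls (hq 1) := by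
    have c₁ := q.continuous_re
    have c₂ := q.continuous_vec
    have c₃ := q'.continuous_re
    have c₄ := q'.continuous_vec
    refine SignMap.cls_eq_of_homotopy (q.lineMap q') ?_ ?_ hq
    · change Continuous fun p : unitInterval × Y => (1 - p.1.1) * q.re p.2 + p.1.1 * q'.re p.2
      fun_prop
    · change Continuous fun p : unitInterval × Y =>
        ((1 - p.1.1 : ℝ) : ℂ) • q.vec p.2 + (p.1.1 : ℂ) • q'.vec p.2
      fun_prop
  simp only [h₁, h₂] at e
  exact e

/-- The map to `ℝ ⊕ ℂ̃^{t'}` given by the coordinates of `ℝ ⊕ ℂ̃^t`, the real one with a sign, and a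
linear map. -/
noncomputable def linearSphereMap (σ : ℝ) (L : (Fin t → ℂ) →ₗ[ℂ] (Fin t' → ℂ)) :
    SignMap (RepSphere (Fin t → ℂ)) t' where
  re x := σ * (sphereMap t).re x
  vec x := L ((sphereMap t).vec x)
  continuous_re := continuous_const.mul (sphereMap t).continuous_re
  continuous_vec := (LinearMap.continuous_of_finiteDimensional L).comp (sphereMap t).continuous_vec
  re_smul g x := by rw [(sphereMap t).re_smul]
  vec_smul g x := by rw [(sphereMap t).vec_smul, _root_.map_smul]

theorem linearSphereMap_sq_pos {σ : ℝ} (hσ : σ ≠ 0) {L : (Fin t → ℂ) →ₗ[ℂ] (Fin t' → ℂ)}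
    (hL : Function.Injective L) (x : RepSphere (Fin t → ℂ)) : 0 < (linearSphereMap σ L).sq x := by
  rw [SignMap.sq_pos_iff]
  refine ((SignMap.sq_pos_iff _ x).1 (sphereMap_sq_pos x)).imp (mul_ne_zero hσ) fun h => ?_
  exact (map_ne_zero_iff L hL).2 h

/-- A nowhere vanishing equivariant map from the representation sphere of `ℂ̃^t` to `ℝ ⊕ ℂ̃^{t'}`,
where `t < t'`, which takes values of opposite signs at the two fixed points, has the same class as
a linear one. -/
theorem SignMap.cls_eq_linear (htt' : t < t') (q : SignMap (RepSphere (Fin t → ℂ)) t')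
    (hq : ∀ x, 0 < q.sq x) {σ : ℝ} (hσ : σ ≠ 0) (h0 : 0 < σ * q.re (OnePoint.some 0))
    (hinf : σ * q.re ∞ < 0) {L : (Fin t → ℂ) →ₗ[ℂ] (Fin t' → ℂ)} (hL : Function.Injective L) :
    q.cls hq = (linearSphereMap σ L).cls (linearSphereMap_sq_pos hσ hL) := by
  have hcont : Continuous fun x => |q.re x| + ‖q.vec x‖ :=
    q.continuous_re.abs.add q.continuous_vec.norm
  obtain ⟨x₁, -, hx₁⟩ := isCompact_univ.exists_isMinOn Set.univ_nonempty hcont.continuousOn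
  have hε : 0 < |q.re x₁| + ‖q.vec x₁‖ := by
    rcases (q.sq_pos_iff x₁).1 (hq x₁) with h | h
    · exact add_pos_of_pos_of_nonneg (abs_pos.2 h) (norm_nonneg _)
    · exact add_pos_of_nonneg_of_pos (abs_nonneg _) (norm_pos_iff.2 h)
  obtain ⟨q', hre, hq', hne⟩ := q.exists_perturbation htt' L hε
  have hne' : ∀ v : Fin t → ℂ, v ≠ 0 → q'.vec (OnePoint.some v) ≠ 0 := fun v hv => by
    simpa using hne v hv 0
  -- The vector parts of `q` and `q'` are close where the real part vanishes.
  have hline : ∀ (r : unitInterval) x, 0 < (q.lineMap q' r).sq x := fun r x => by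
    rw [SignMap.sq_pos_iff]
    by_cases hx : q.re x = 0
    · right
      intro h
      have h₁ : |q.re x₁| + ‖q.vec x₁‖ ≤ |q.re x| + ‖q.vec x‖ := hx₁ (Set.mem_univ x)
      rw [hx, abs_zero, zero_add] at h₁
      have h₂ : q.vec x = -((r.1 : ℂ) • (q'.vec x - q.vec x)) := by
        have h₃ : ((1 - r.1 : ℝ) : ℂ) • q.vec x + (r.1 : ℂ) • q'.vec x = 0 := h
        rw [← sub_eq_zero, ← h₃]
        push_cast
        module
      have h₃ : ‖q.vec x‖ ≤ ‖q'.vec x - q.vec x‖ := by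
        rw [h₂, norm_neg, norm_smul, Complex.norm_real, Real.norm_eq_abs, abs_of_nonneg r.2.1, ← h₂]
        exact mul_le_of_le_one_left (norm_nonneg _) r.2.2
      linarith [hq' x]
    · left
      change (1 - r.1) * q.re x + r.1 * q'.re x ≠ 0
      rw [hre]
      convert hx using 1
      ring
  have hsq' : ∀ x, 0 < q'.sq x := fun x => by
    have := hline 1 x
    rwa [show q.lineMap q' 1 = q' from
      SignMap.ext (fun y => by simp [lineMap]) fun y => by simp [lineMap]] at this
  rw [q.cls_eq_of_lineMap q' hq hsq' hline]
  have hsphere : ∀ x : RepSphere (Fin t → ℂ), x = ∞ ∨ x = OnePoint.some 0 ∨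
      ∃ v : Fin t → ℂ, v ≠ 0 ∧ x = OnePoint.some (show SignRep _ from v) := fun x => by
    cases x using OnePoint.rec with
    | infty => exact Or.inl rfl
    | coe v =>
      by_cases hv : v = 0
      · exact Or.inr (Or.inl (congrArg _ hv))
      · exact Or.inr (Or.inr ⟨v, hv, rfl⟩)
  -- The real part can be replaced, since the vector part of `q'` vanishes at the fixed points only.
  let p : SignMap (RepSphere (Fin t → ℂ)) t' := ⟨(linearSphereMap σ L).re, q'.vec,
    (linearSphereMap σ L).continuous_re, q'.continuous_vec, (linearSphereMap σ L).re_smul,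
    q'.vec_smul⟩
  have hline₂ : ∀ (r : unitInterval) x, 0 < (q'.lineMap p r).sq x := fun r x => by
    rw [SignMap.sq_pos_iff]
    have hr₀ := r.2.1
    have hr₁ := r.2.2
    have hσ2 : 0 < σ * σ := mul_self_pos.2 hσ
    rcases hsphere x with rfl | rfl | ⟨v, hv, rfl⟩
    · left
      change (1 - r.1) * q'.re ∞ + r.1 * (σ * -1) ≠ 0
      rw [hre]
      intro h
      have : (1 - r.1) * (σ * q.re ∞) + r.1 * (-(σ * σ)) = 0 := by linear_combination σ * h
      rcases hr₁.lt_or_eq with hr | hr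
      · nlinarith [mul_pos (sub_pos.2 hr) (neg_pos.2 hinf)]
      · rw [hr] at this; linarith
    · left
      have h1 : (sphereMap t).re (OnePoint.some 0) = 1 := by
        change stereoRe (0 : Fin t → ℂ) = 1
        simp [stereoRe, sqNorm]
      change (1 - r.1) * q'.re _ + r.1 * (σ * (sphereMap t).re (OnePoint.some 0)) ≠ 0
      rw [hre, h1]
      intro h
      have : (1 - r.1) * (σ * q.re (OnePoint.some 0)) + r.1 * (σ * σ) = 0 := by
        linear_combination σ * h
      rcases hr₁.lt_or_eq with hr | hr
      · nlinarith [mul_pos (sub_pos.2 hr) h0]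
      · rw [hr] at this; linarith
    · right
      change ((1 - r.1 : ℝ) : ℂ) • q'.vec _ + (r.1 : ℂ) • q'.vec _ ≠ 0
      rw [← add_smul]
      push_cast
      rw [sub_add_cancel, one_smul]
      exact hne' v hv
  have hp : ∀ x, 0 < p.sq x := fun x => by
    have := hline₂ 1 x
    rwa [show q'.lineMap p 1 = p from
      SignMap.ext (fun y => by simp [lineMap]) fun y => by simp [lineMap]] at this
  rw [q'.cls_eq_of_lineMap p hsq' hp hline₂]
  -- Away from the fixed points, the line from the vector part of `q'` to the linear map has no zero:
  -- a zero at the parameter `r` would give `q'` the vector part `-(r / (1 - r))` times the linear map.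
  refine p.cls_eq_of_lineMap _ hp _ fun r x => ?_
  rw [SignMap.sq_pos_iff]
  by_cases hx : (sphereMap t).re x = 0
  · right
    rcases hsphere x with rfl | rfl | ⟨v, hv, rfl⟩
    · exact absurd hx (by change (-1 : ℝ) ≠ 0; norm_num)
    · exact absurd hx (by change stereoRe (0 : Fin t → ℂ) ≠ 0; simp [stereoRe, sqNorm])
    · change ((1 - r.1 : ℝ) : ℂ) • q'.vec _ + (r.1 : ℂ) • L (stereoVec v) ≠ 0
      rcases r.2.2.lt_or_eq with hr | hr
      · have hr' : ((1 - r.1 : ℝ) : ℂ) ≠ 0 := Complex.ofReal_ne_zero.2 (sub_pos.2 hr).ne'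
        have h := smul_ne_zero hr' (hne v hv (r.1 / (1 - r.1)))
        rwa [smul_add, smul_smul, ← Complex.ofReal_mul, mul_div_cancel₀ _ (sub_pos.2 hr).ne'] at h
      · rw [hr, sub_self, Complex.ofReal_zero, zero_smul, zero_add, Complex.ofReal_one, one_smul]
        exact (map_ne_zero_iff L hL).2 (stereoVec_ne_zero hv)
  · left
    change (1 - r.1) * (σ * (sphereMap t).re x) + r.1 * (σ * (sphereMap t).re x) ≠ 0
    convert mul_ne_zero hσ hx using 1
    ring

/-- The inclusion `ℂ^t → ℂ^{t + n}` into the first coordinates. -/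
def snocZeros (t : ℕ) : ∀ n : ℕ, (Fin t → ℂ) →ₗ[ℂ] (Fin (t + n) → ℂ)
  | 0 => LinearMap.id
  | n + 1 => (snocZero (t + n)) ∘ₗ snocZeros t n

theorem snocZeros_injective (t n : ℕ) : Function.Injective (snocZeros t n) := by
  induction n with
  | zero => exact Function.injective_id
  | succ n ih => exact snocZero_injective.comp ih

/-- Iterated stabilisation multiplies the class by `w^n`, up to a product bundle. -/
theorem exists_cls_linearSphereMap {σ : ℝ} (hσ : σ ≠ 0) (t n : ℕ) : ∃ c : RepRing Pin2,
    (linearSphereMap σ (snocZeros t n)).cls (linearSphereMap_sq_pos hσ (snocZeros_injective t n)) =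
      (linearSphereMap σ (snocZeros t 0)).cls
        (linearSphereMap_sq_pos hσ (snocZeros_injective t 0)) * constClass _ (wClass ^ n) +
          constClass _ c := by
  induction n with
  | zero => exact ⟨0, by simp⟩
  | succ n ih =>
    obtain ⟨c, hc⟩ := ih
    have e : linearSphereMap σ (snocZeros t (n + 1)) = (linearSphereMap σ (snocZeros t n)).snoc :=
        rfl
    have h := (linearSphereMap σ (snocZeros t n)).cls_snoc
      (linearSphereMap_sq_pos hσ (snocZeros_injective t n))
      (e ▸ linearSphereMap_sq_pos hσ (snocZeros_injective t (n + 1)))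
    simp only [← e] at h
    refine ⟨c * wClass + (extRep (t + n)).cls * signRep.cls, h.trans ((congrArg
      (· * constClass _ wClass + constClass _ ((extRep (t + n)).cls * signRep.cls)) hc).trans ?_)⟩
    generalize (linearSphereMap σ (snocZeros t 0)).cls _ = S
    simp only [map_mul, map_add, pow_succ]
    ring

/-- A nowhere vanishing equivariant map from the representation sphere of `ℂ̃^t` to
`ℝ ⊕ ℂ̃^{t + n}`, where `n > 0`, with values of opposite signs at the two fixed points, represents
`± w^n` times the Bott class, up to the class of a product bundle. -/
theorem SignMap.exists_cls_eq_bottClass {n : ℕ} (hn : 0 < n)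
    (q : SignMap (RepSphere (Fin t → ℂ)) (t + n)) (hq : ∀ x, 0 < q.sq x)
    (hq₀ : q.re (OnePoint.some 0) * q.re ∞ < 0) : ∃ a c : RepRing Pin2, (a = wClass ^ n ∨ a =
        -wClass ^ n) ∧
      q.cls hq = constClass _ a * bottClass t + constClass _ c := by
  obtain ⟨c₀, hc₀⟩ := exists_bottClass_eq t
  have hb : (sphereMap t).cls sphereMap_sq_pos = bottClass t - constClass _ c₀ := by
    rw [hc₀, add_sub_cancel_right]
  rcases mul_neg_iff.1 hq₀ with ⟨h0, hinf⟩ | ⟨h0, hinf⟩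
  · have e := q.cls_eq_linear (Nat.lt_add_of_pos_right hn) hq one_ne_zero (by linarith) (by
      linarith)
      (snocZeros_injective t n)
    obtain ⟨c, hc⟩ := exists_cls_linearSphereMap one_ne_zero t n
    have e₁ : linearSphereMap 1 (snocZeros t 0) = sphereMap t :=
      SignMap.ext (fun _ => one_mul _) fun _ => rfl
    simp only [e₁, hb] at hc
    refine ⟨wClass ^ n, c - c₀ * wClass ^ n, Or.inl rfl, ?_⟩
    rw [e, hc]
    simp only [map_mul, map_sub]
    ring
  · have h1 : (-1 : ℝ) ≠ 0 := by norm_num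
    have e := q.cls_eq_linear (Nat.lt_add_of_pos_right hn) hq h1 (by linarith) (by linarith)
      (snocZeros_injective t n)
    obtain ⟨c, hc⟩ := exists_cls_linearSphereMap h1 t n
    have e₁ : linearSphereMap (-1) (snocZeros t 0) = (sphereMap t).reflect :=
      SignMap.ext (fun _ => neg_one_mul _) fun _ => rfl
    have e₂ := (sphereMap t).cls_reflect sphereMap_sq_pos
      (fun x => ((sphereMap t).sq_reflect x).symm ▸ sphereMap_sq_pos x)
    simp only [e₁, e₂, hb] at hc
    refine ⟨-wClass ^ n, c + ((extRep t).cls + c₀) * wClass ^ n, Or.inr rfl, ?_⟩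
    rw [e, hc]
    simp only [map_mul, map_add, map_neg]
    ring

end SphereHomotopy

/-! ### Homotopies and fixed points -/

section FixedPoints

variable {G : Type v} [Group G] [TopologicalSpace G]
variable {X : Type u} [TopologicalSpace X] [MulAction G X]
  {Y : Type w} [TopologicalSpace Y] [MulAction G Y]

/-- A map with a left homotopy inverse is injective on path components. -/
theorem joined_of_joined_map {A B : Type*} [TopologicalSpace A] [TopologicalSpace B] {k : C(A, B)}
    {l : C(B, A)} (h : (l.comp k).Homotopic (ContinuousMap.id A)) {x y : A}
    (hxy : Joined (k x) (k y)) : Joined x y := by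
  obtain ⟨H⟩ := h
  have e : ∀ x, Joined (l (k x)) x := fun x => ⟨H.evalAt x⟩
  exact ((e x).symm.trans (hxy.map l.continuous)).trans (e y)

theorem GMap.Homotopic.onFixedPoints {f f' : GMap G X Y} (h : f.Homotopic f') :
    f.onFixedPoints.Homotopic f'.onFixedPoints := by
  obtain ⟨H, hH⟩ := h
  refine ⟨⟨⟨fun p => ⟨H (p.1, p.2.1), fun g => ?_⟩, ?_⟩, fun x => ?_, fun x => ?_⟩⟩
  · rw [← hH, p.2.2 g]
  · exact (H.continuous.comp (continuous_fst.prodMk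
      (continuous_subtype_val.comp continuous_snd))).subtype_mk _
  · exact Subtype.ext (H.apply_zero x.1)
  · exact Subtype.ext (H.apply_one x.1)

end FixedPoints

/-! ### The induced map on `X^{S¹}` -/

section CircleFixedMaps

open OnePoint

variable {X : Type u} [TopologicalSpace X] [MulAction Pin2 X]
  {Y : Type w} [TopologicalSpace Y] [MulAction Pin2 Y] {t t' : ℕ}

/-- The map `X^{S¹} → Y^{S¹}` induced by an equivariant map. -/
def GMap.circleFixed (f : GMap Pin2 X Y) : GMap Pin2 (CircleFixed X) (CircleFixed Y) :=
  ⟨⟨fun x => ⟨f x.1, fun g hg => (f.map_smul' g x.1).symm.trans (congrArg f (x.2 g hg))⟩,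
    (f.continuous.comp continuous_subtype_val).subtype_mk _⟩,
    fun g x => Subtype.ext (f.map_smul' g x.1)⟩

/-- A fixed point of `Pin(2)`, as a fixed point in `X^{S¹}`. -/
def CircleFixed.ofFixedPoints (X : Type u) [TopologicalSpace X] [MulAction Pin2 X] :
    C(MulAction.fixedPoints Pin2 X, MulAction.fixedPoints Pin2 (CircleFixed X)) where
  toFun x := ⟨⟨x.1, fun g _ => x.2 g⟩, fun g => Subtype.ext (x.2 g)⟩
  continuous_toFun := (continuous_subtype_val.subtype_mk _).subtype_mk _

theorem SignMap.vec_eq_zero_of_fixed (q : SignMap X t) {x : X} (hx : ∀ g : Pin2, g • x = x) :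
    q.vec x = 0 := by
  have h := q.vec_smul Pin2.j x
  rw [hx, Pin2.signC_j, neg_one_smul] at h
  exact self_eq_neg.1 h

theorem sphereMap_re_sq_of_fixed {x : RepSphere (Fin t → ℂ)} (hx : ∀ g : Pin2, g • x = x) :
    (sphereMap t).re x ^ 2 = 1 := by
  have h := sphereMap_sq x
  rwa [SignMap.sq, (sphereMap t).vec_eq_zero_of_fixed hx, sqNorm_eq_zero.2 rfl, add_zero] at h

theorem sphereMap_re_zero : (sphereMap t).re (OnePoint.some 0) = 1 := by
  change stereoRe (0 : Fin t → ℂ) = 1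
  simp [stereoRe, sqNorm]

theorem RepSphere.smul_zero (g : Pin2) :
    g • (OnePoint.some 0 : RepSphere (Fin t → ℂ)) = OnePoint.some 0 :=
  congrArg OnePoint.some ((Bott.sign_smul_eq g (0 : Fin t → ℂ)).trans (by simp : Pin2.signC g • (0 :
      Fin t → ℂ) = 0))

/-- The two fixed points lie in different components of the fixed point set, as the real coordinate
is `±1` there. -/
theorem not_joined_zero_infty : ¬ Joined
    (⟨OnePoint.some 0, RepSphere.smul_zero⟩ : MulAction.fixedPoints Pin2 (RepSphere (Fin t → ℂ)))
    ⟨∞, RepSphere.smul_infty⟩ := by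
  rintro ⟨γ⟩
  have hc : Continuous fun s => (sphereMap t).re (γ s).1 :=
    (sphereMap t).continuous_re.comp (continuous_subtype_val.comp γ.continuous)
  obtain ⟨s, hs⟩ := mem_range_of_exists_le_of_exists_ge (c := 0) hc
    ⟨1, by rw [γ.target]; change (-1 : ℝ) ≤ 0; norm_num⟩
    ⟨0, by rw [γ.source, sphereMap_re_zero]; norm_num⟩
  have h := sphereMap_re_sq_of_fixed (γ s).2
  simp only at hs
  rw [hs] at h
  norm_num at h

/-- A map that is a homotopy equivalence on fixed points takes the two fixed points of `X^{S¹}`, up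
to homotopy, to different ones. -/
theorem re_mul_re_neg {Z : Type*} [TopologicalSpace Z] [MulAction Pin2 Z] {x₀ : X} {z₀ : Z}
    (φ : SphereFraming x₀ (Fin t → ℂ)) (φ' : SphereFraming z₀ (Fin t' → ℂ)) {f : GMap Pin2 X Z}
    (hf : f.IsHomotopyEquivOnFixedPoints) {ψ : GMap Pin2 (RepSphere (Fin t → ℂ)) (CircleFixed X)}
    (hψ : (φ.toGMap.comp ψ).Homotopic (GMap.id _ _)) :
    (sphereMap t').re (φ'.toGMap (f.circleFixed (ψ (OnePoint.some 0)))) *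
      (sphereMap t').re (φ'.toGMap (f.circleFixed (ψ ∞))) < 0 := by
  let k := (φ'.toGMap.comp (f.circleFixed.comp ψ)).onFixedPoints
  let p₀ : MulAction.fixedPoints Pin2 (RepSphere (Fin t → ℂ)) := ⟨OnePoint.some 0,
      RepSphere.smul_zero⟩
  let p₁ : MulAction.fixedPoints Pin2 (RepSphere (Fin t → ℂ)) := ⟨∞, RepSphere.smul_infty⟩
  -- If the images agreed, the two fixed points would be joined by a path of fixed points, since
  -- every map in the composition is injective on path components of fixed points.
  have hne : k p₀ ≠ k p₁ := fun h => by
    obtain ⟨ψ', hψ', -⟩ := φ'.isHomotopyEquiv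
    have h₁ : Joined (φ'.toGMap.onFixedPoints (f.circleFixed.onFixedPoints (ψ.onFixedPoints p₀)))
        (φ'.toGMap.onFixedPoints (f.circleFixed.onFixedPoints (ψ.onFixedPoints p₁))) :=
      h ▸ Joined.refl _
    have h₂ := joined_of_joined_map (k := φ'.toGMap.onFixedPoints) (l := ψ'.onFixedPoints)
      hψ'.onFixedPoints h₁
    have h₃ := h₂.map (CircleFixed.incl Z).onFixedPoints.continuous
    obtain ⟨e, he⟩ := hf
    have h₄ : Joined ((CircleFixed.incl X).onFixedPoints (ψ.onFixedPoints p₀))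
        ((CircleFixed.incl X).onFixedPoints (ψ.onFixedPoints p₁)) := by
      refine joined_of_joined_map (k := f.onFixedPoints) (l := e.invFun) ?_ h₃
      rw [← he]
      exact e.left_inv
    have h₅ := h₄.map (CircleFixed.ofFixedPoints X).continuous
    exact not_joined_zero_infty (joined_of_joined_map (k := ψ.onFixedPoints)
      (l := φ.toGMap.onFixedPoints) hψ.onFixedPoints h₅)
  have h₀ := sphereMap_re_sq_of_fixed (k p₀).2
  have h₁ := sphereMap_re_sq_of_fixed (k p₁).2
  have hre : (sphereMap t').re (k p₀).1 ≠ (sphereMap t').re (k p₁).1 := fun h =>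
    hne (Subtype.ext (sphereMap_injective h (((sphereMap t').vec_eq_zero_of_fixed (k p₀).2).trans
      ((sphereMap t').vec_eq_zero_of_fixed (k p₁).2).symm)))
  change (sphereMap t').re (k p₀).1 * (sphereMap t').re (k p₁).1 < 0
  rw [(eq_or_eq_neg_of_sq_eq_sq _ _ (h₀.trans h₁.symm)).resolve_left hre, neg_mul, ← sq, h₁]
  norm_num

/-- Equivariantly homotopic maps pull `q` back to maps of the same class. -/
theorem SignMap.cls_comp_eq_of_homotopic [CompactSpace Y] (q : SignMap X t) (hq : ∀ x, 0 < q.sq x)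
    {f f' : GMap Pin2 Y X} (h : f.Homotopic f') :
    (q.comp f).cls (fun y => hq (f y)) = (q.comp f').cls fun y => hq (f' y) := by
  obtain ⟨H, hH⟩ := h
  let F : unitInterval → GMap Pin2 Y X := fun s =>
    ⟨⟨fun y => H (s, y), H.continuous.comp (continuous_const.prodMk continuous_id)⟩, hH s⟩
  have h₀ : F 0 = f := GMap.ext fun y => H.apply_zero y
  have h₁ : F 1 = f' := GMap.ext fun y => H.apply_one y
  have e := SignMap.cls_eq_of_homotopy (fun s => q.comp (F s)) (q.continuous_re.comp H.continuous)
    (q.continuous_vec.comp H.continuous) fun s y => hq (F s y)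
  simp only [h₀, h₁] at e
  exact e

/-- Pulling back along `f` multiplies Bott classes by `± w^n` up to product bundles, hence carries
`𝔍(Z)` into `𝔍(X)` after multiplication by `w^n`. -/
theorem wClass_pow_mul_mem_fixedIdeal {Z : Type*} [TopologicalSpace Z] [MulAction Pin2 Z]
    [CompactSpace (CircleFixed X)] {x₀ : X} {z₀ : Z} {n : ℕ} (hn : 0 < n)
    (φ : SphereFraming x₀ (Fin t → ℂ)) (φ' : SphereFraming z₀ (Fin (t + n) → ℂ))
    {f : GMap Pin2 X Z} (hf : f.IsHomotopyEquivOnFixedPoints) {x : RepRing Pin2}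
    (hx : x ∈ fixedIdeal φ') : wClass ^ n * x ∈ fixedIdeal φ := by
  obtain ⟨ξ, -, hξ⟩ := hx
  obtain ⟨ψ, hψ₁, hψ₂⟩ := φ.isHomotopyEquiv
  let k : GMap Pin2 (RepSphere (Fin t → ℂ)) (RepSphere (Fin (t + n) → ℂ)) :=
    φ'.toGMap.comp (f.circleFixed.comp ψ)
  obtain ⟨a, c, ha, hac⟩ := SignMap.exists_cls_eq_bottClass hn ((sphereMap (t + n)).comp k)
    (fun y => sphereMap_sq_pos (k y)) (re_mul_re_neg φ φ' hf hψ₂)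
  obtain ⟨c₀, hc₀⟩ := exists_bottClass_eq (t + n)
  have hH : (k.comp φ.toGMap).Homotopic (φ'.toGMap.comp f.circleFixed) := by
    obtain ⟨H, hH⟩ := hψ₁
    let l := φ'.toGMap.comp f.circleFixed
    exact ⟨⟨⟨fun p => l (H p), l.continuous.comp H.continuous⟩,
      fun y => congrArg l (H.apply_zero y), fun y => congrArg l (H.apply_one y)⟩,
      fun s g y => (congrArg l (hH s g y)).trans (l.map_smul' g _)⟩
  have e : KG.pullback (φ'.toGMap.comp f.circleFixed) (bottClass (t + n)) =
      constClass _ a * KG.pullback φ.toGMap (bottClass t) + constClass _ (c + c₀) := by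
    have e₁ := (sphereMap (t + n)).cls_comp_eq_of_homotopic sphereMap_sq_pos hH
    have e₂ := SignMap.pullback_cls ((sphereMap (t + n)).comp k) (fun y => sphereMap_sq_pos (k y))
      φ.toGMap
    rw [hac, map_add, map_mul, constClass, KG.pullback_toPoint, KG.pullback_toPoint] at e₂
    rw [hc₀, map_add, SignMap.pullback_cls, ← e₁, constClass, KG.pullback_toPoint, map_add,
      ← add_assoc, e₂]
    rfl
  have hmem : x * a ∈ fixedIdeal φ := by
    refine mem_fixedIdeal_of_eq_add_const φ (ξ := KG.pullback f ξ) (c := x * (c + c₀)) ?_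
    have e₃ : f.comp (CircleFixed.incl X) = (CircleFixed.incl Z).comp f.circleFixed := rfl
    rw [← KG.pullback_comp, e₃, KG.pullback_comp, hξ, map_mul, ← KG.pullback_comp φ'.toGMap, e,
      KG.pullback_toPoint, map_mul, map_mul]
    ring
  rcases ha with rfl | rfl
  · rwa [mul_comm]
  · have := (fixedIdeal φ).neg_mem hmem
    rwa [mul_neg, neg_neg, mul_comm] at this

end CircleFixedMaps

/-! ### Characters of virtual representations -/

section Characters

variable {G : Type v} [Group G] [TopologicalSpace G]

namespace GVectorBundle

/-- The representation on the fibre of a bundle over a point. -/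
def pointRep (E : GVectorBundle G Unit) : G →* Module.End ℂ (E.Fiber ()) where
  toFun g := E.act g () () rfl
  map_one' := LinearMap.ext fun v => E.act_one () v
  map_mul' g h := LinearMap.ext fun v => E.act_mul h g () () () rfl rfl rfl v

instance (E : GVectorBundle G Unit) : Module.Finite ℂ (E.Fiber ()) :=
  .of_basis (E.frame () () (E.mem_base ()))

/-- The character of a bundle over a point at a group element. -/
noncomputable def character (g : G) : IsoClass G Unit →+* ℂ where
  toFun := Quotient.lift (fun E => LinearMap.trace ℂ _ (E.pointRep g)) fun E F ⟨e⟩ => by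
    rw [← LinearMap.trace_conj' (E.pointRep g) (e.equiv ())]
    refine congrArg _ (LinearMap.ext fun v => ?_)
    obtain ⟨v, rfl⟩ := (e.equiv ()).surjective v
    rw [LinearEquiv.conj_apply_apply, LinearEquiv.symm_apply_apply]
    exact e.map_act g () () rfl v
  map_one' := (LinearMap.trace_id ℂ ℂ).trans (by simp)
  map_zero' := (LinearMap.trace_id ℂ PUnit).trans
    (by rw [Module.finrank_zero_of_subsingleton, Nat.cast_zero])
  map_add' := by
    rintro ⟨E⟩ ⟨F⟩
    exact LinearMap.trace_prodMap' (E.pointRep g) (F.pointRep g)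
  map_mul' := by
    rintro ⟨E⟩ ⟨F⟩
    exact LinearMap.trace_tensorProduct' (E.pointRep g) (F.pointRep g)

end GVectorBundle

/-- The extension of a homomorphism to a commutative ring from a semiring to its Grothendieck
ring. -/
noncomputable def GrothendieckRing.lift {M : Type u} [CommSemiring M] {A : Type*} [CommRing A]
    (f : M →+* A) : GrothendieckRing M →+* A where
  __ := liftHom f.toAddMonoidHom
  map_one' := (liftHom_of _ _).trans f.map_one
  map_mul' x y := by
    change liftHom _ (x * y) = liftHom _ x * liftHom _ y
    obtain ⟨a, b, rfl⟩ := exists_sub x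
    obtain ⟨c, d, rfl⟩ := exists_sub y
    simp only [sub_mul, mul_sub, of_mul_of, map_sub, liftHom_of,
      RingHom.toAddMonoidHom_eq_coe, AddMonoidHom.coe_coe, map_mul]

/-- The character of a virtual representation at a group element. -/
noncomputable def RepRing.character (g : G) : RepRing G →+* ℂ :=
  GrothendieckRing.lift (GVectorBundle.character g)

theorem RepRing.character_of (g : G) (b : GVectorBundle.IsoClass G Unit) :
    RepRing.character g (GrothendieckRing.of b) = GVectorBundle.character g b :=
  GrothendieckRing.liftHom_of _ _

theorem RepRing.character_mk_ofRep {V : Type} [AddCommGroup V] [Module ℂ V] [Module.Finite ℂ V]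
    (α : G →* (V →ₗ[ℂ] V)) (hα : ∀ (v : V) (l : V →ₗ[ℂ] ℂ), Continuous fun g => l (α g v)) (g : G) :
    RepRing.character g (KG.mk (GVectorBundle.ofRep Unit V α hα)) = LinearMap.trace ℂ V (α g) :=
  RepRing.character_of g _

/-- The averaged powers of an operator of finite order project onto the vectors it fixes. -/
theorem exists_nat_sum_trace_pow {V : Type*} [AddCommGroup V] [Module ℂ V] [Module.Finite ℂ V]
    {N : ℕ} (hN : N ≠ 0) {A : Module.End ℂ V} (hA : A ^ N = 1) :
    ∃ d : ℕ, ∑ i ∈ Finset.range N, LinearMap.trace ℂ V (A ^ i) = N * d := by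
  let P : Module.End ℂ V := (N : ℂ)⁻¹ • ∑ i ∈ Finset.range N, A ^ i
  have hN' : (N : ℂ) ≠ 0 := Nat.cast_ne_zero.2 hN
  have hAP : A * P = P := by
    simp only [P, mul_smul_comm, Finset.mul_sum, ← pow_succ']
    have h₁ := Finset.sum_range_succ (fun i => A ^ i) N
    rw [Finset.sum_range_succ', hA, pow_zero, add_left_inj] at h₁
    rw [h₁]
  have hAP' : ∀ i : ℕ, A ^ i * P = P := fun i => by
    induction i with
    | zero => rw [pow_zero, one_mul]
    | succ i ih => rw [pow_succ, mul_assoc, hAP, ih]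
  have hPP : P * P = P := by
    change ((N : ℂ)⁻¹ • ∑ i ∈ Finset.range N, A ^ i) * P = P
    rw [smul_mul_assoc, Finset.sum_mul, Finset.sum_congr rfl fun i _ => hAP' i, Finset.sum_const,
      Finset.card_range, ← Nat.cast_smul_eq_nsmul ℂ, smul_smul, inv_mul_cancel₀ hN', one_smul]
  have hP : LinearMap.IsProj (LinearMap.range P) P := ⟨fun v => ⟨v, rfl⟩, by
    rintro _ ⟨v, rfl⟩
    exact LinearMap.congr_fun hPP v⟩
  refine ⟨Module.finrank ℂ (LinearMap.range P), ?_⟩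
  rw [← hP.trace]
  simp only [P, map_smul, map_sum, smul_eq_mul]
  rw [mul_inv_cancel_left₀ hN']

/-- The average of a virtual character over the powers of an element of finite order is an
integer. -/
theorem RepRing.exists_int_sum_character_pow {N : ℕ} (hN : N ≠ 0) {g : G} (hg : g ^ N = 1)
    (a : RepRing G) : ∃ d : ℤ, ∑ i ∈ Finset.range N, RepRing.character (g ^ i) a = N * d := by
  have h : ∀ b : GVectorBundle.IsoClass G Unit, ∃ d : ℕ,
      ∑ i ∈ Finset.range N, GVectorBundle.character (g ^ i) b = N * d := by
    rintro ⟨E⟩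
    obtain ⟨d, hd⟩ := exists_nat_sum_trace_pow hN (A := E.pointRep g) (by rw [← map_pow, hg,
        map_one])
    refine ⟨d, (Finset.sum_congr rfl fun i _ => ?_).trans hd⟩
    rw [← map_pow]
    rfl
  obtain ⟨b, c, rfl⟩ := GrothendieckRing.exists_sub a
  obtain ⟨m, hm⟩ := h b
  obtain ⟨n, hn⟩ := h c
  refine ⟨m - n, ?_⟩
  simp only [map_sub, RepRing.character_of, Finset.sum_sub_distrib, hm, hn]
  push_cast
  ring

end Characters

/-! ### Characters of `Pin(2)` -/

section Pin2Characters

open RepRing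

theorem character_wClass (g : Pin2) : character g wClass = 1 - Pin2.signC g := by
  rw [wClass, map_sub, map_one, character_mk_ofRep]
  congr 1
  change LinearMap.trace ℂ ℂ (Pin2.signC g • LinearMap.id) = _
  rw [map_smul, LinearMap.trace_id]
  simp

/-- The character of the quaternionic representation, computed in the basis `1, j`. -/
theorem trace_quatRepHom (g : Pin2) :
    LinearMap.trace ℂ QuatRep (quatRepHom g) = ((2 * g.toQuat.re : ℝ) : ℂ) := by
  have h₁ : quatBasis (.inl ()) = (1 : ℍ[ℝ]) := by
    refine (congrFun (Module.Basis.coe_ofEquivFun _) _).trans ?_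
    change (⟨_, _, _, _⟩ : ℍ[ℝ]) = 1
    ext <;> simp
  have h₂ : quatBasis (.inr ()) = quatJ := by
    refine (congrFun (Module.Basis.coe_ofEquivFun _) _).trans ?_
    change (⟨_, _, _, _⟩ : ℍ[ℝ]) = quatJ
    ext <;> simp
  have e₁ : quatBasis.repr (quatRepHom g (quatBasis (.inl ()))) (.inl ()) =
      (⟨(g.toQuat * 1).re, (g.toQuat * 1).imI⟩ : ℂ) := by
    rw [h₁]
    rfl
  have e₂ : quatBasis.repr (quatRepHom g (quatBasis (.inr ()))) (.inr ()) =
      (⟨(g.toQuat * quatJ).imJ, -(g.toQuat * quatJ).imK⟩ : ℂ) := by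
    rw [h₂]
    rfl
  rw [LinearMap.trace_eq_matrix_trace ℂ quatBasis, Matrix.trace, Fintype.sum_sum_type]
  simp only [Matrix.diag_apply, LinearMap.toMatrix_apply, Finset.univ_unique, Finset.sum_singleton,
    PUnit.default_eq_unit, e₁, e₂]
  refine Complex.ext ?_ ?_
  · simp
    ring
  · simp

theorem character_zClass (g : Pin2) : character g zClass = ((2 - 2 * g.toQuat.re : ℝ) : ℂ) := by
  rw [zClass, map_sub, character_mk_ofRep, trace_quatRepHom]
  push_cast
  rw [map_ofNat]

/-- The element `cos θ + i sin θ` of `Pin(2)` corresponding to a complex number of modulus one. -/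
noncomputable def Pin2.ofUnit (z : ℂ) (hz : ‖z‖ = 1) : Pin2 :=
  ⟨⟨Quaternion.coeComplex z, by
    rw [mem_sphere_zero_iff_norm, ← sq_eq_sq₀ (norm_nonneg _) zero_le_one, sq,
      ← Quaternion.normSq_eq_norm_mul_self, Quaternion.normSq_def']
    have h := Complex.sq_norm z
    rw [hz, Complex.normSq_apply] at h
    simp only [Quaternion.re_coeComplex, Quaternion.imI_coeComplex, Quaternion.imJ_coeComplex,
      Quaternion.imK_coeComplex]
    linarith⟩, Or.inl ⟨rfl, rfl⟩⟩

theorem Pin2.toQuat_injective : Function.Injective Pin2.toQuat :=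
  fun _ _ h => Subtype.ext (Subtype.ext h)

theorem Pin2.toQuat_ofUnit_pow (z : ℂ) (hz : ‖z‖ = 1) (n : ℕ) :
    (Pin2.ofUnit z hz ^ n).toQuat = Quaternion.coeComplex (z ^ n) := by
  induction n with
  | zero => rw [pow_zero, pow_zero, Pin2.toQuat_one, Quaternion.coeComplex_one]
  | succ n ih =>
    rw [pow_succ, Pin2.toQuat_mul, ih, pow_succ, Quaternion.coeComplex_mul]
    rfl

theorem Pin2.ofUnit_pow (z : ℂ) (hz : ‖z‖ = 1) (n : ℕ) :
    Pin2.ofUnit z hz ^ n = Pin2.ofUnit (z ^ n) (by rw [norm_pow, hz, one_pow]) :=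
  Pin2.toQuat_injective (Pin2.toQuat_ofUnit_pow z hz n)

theorem Pin2.j_sq : Pin2.j ^ 2 = Pin2.ofUnit (-1) (by simp) := by
  refine Pin2.toQuat_injective ?_
  rw [sq, Pin2.toQuat_mul]
  change quatJ * quatJ = Quaternion.coeComplex (-1)
  ext <;> simp

theorem Pin2.signC_ofUnit (z : ℂ) (hz : ‖z‖ = 1) : Pin2.signC (Pin2.ofUnit z hz) = 1 := by
  have h : (Pin2.ofUnit z hz).InCircle := ⟨rfl, rfl⟩
  simp [signC, sign, h]

/-- If `z^k` divides `2^m w` in `R(Pin(2))`, then `k ≤ m`: the quotient has a character which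
vanishes on `S¹` away from the identity, hence also at the identity, and whose value at `j` is
therefore an even integer. -/
theorem le_of_zClass_pow_dvd {k m : ℕ} (h : zClass ^ k ∣ 2 ^ m * wClass) : k ≤ m := by
  obtain ⟨a, ha⟩ := h
  have hχ : ∀ g : Pin2, (2 : ℂ) ^ m * (1 - Pin2.signC g) =
      ((2 - 2 * g.toQuat.re : ℝ) : ℂ) ^ k * character g a := fun g => by
    have := congrArg (character g) ha
    rwa [map_mul, map_pow, map_ofNat, character_wClass, map_mul, map_pow, character_zClass] at this
  have hunit : ∀ (z : ℂ) (hz : ‖z‖ = 1), z ≠ 1 → character (Pin2.ofUnit z hz) a = 0 := by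
    intro z hz hz1
    have h₁ := hχ (Pin2.ofUnit z hz)
    rw [Pin2.signC_ofUnit, sub_self, mul_zero, eq_comm] at h₁
    refine (mul_eq_zero.1 h₁).resolve_left (pow_ne_zero _ (Complex.ofReal_ne_zero.2 fun h₂ => hz1
        ?_))
    have h₃ : z.re = 1 := by
      change 2 - 2 * z.re = 0 at h₂
      linarith
    have h₄ := Complex.sq_norm z
    rw [hz, Complex.normSq_apply, h₃] at h₄
    exact Complex.ext h₃ (mul_self_eq_zero.1 (by linarith))
  have hone : character 1 a = 0 := by
    obtain ⟨d, hd⟩ := exists_int_sum_character_pow one_ne_zero (pow_one (1 : Pin2)) a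
    rw [Finset.sum_range_one, pow_zero, Nat.cast_one, one_mul] at hd
    -- The order of the root of unity exceeds the value at the identity, and divides it.
    let N := d.natAbs + 1
    have hζ : IsPrimitiveRoot _ N := Complex.isPrimitiveRoot_exp N (Nat.succ_ne_zero _)
    have hζ1 := hζ.norm'_eq_one (Nat.succ_ne_zero _)
    have hpow : Pin2.ofUnit _ hζ1 ^ N = 1 := Pin2.toQuat_injective (by
      rw [Pin2.toQuat_ofUnit_pow, hζ.pow_eq_one, Quaternion.coeComplex_one, Pin2.toQuat_one])
    obtain ⟨d', hd'⟩ := exists_int_sum_character_pow (N := N) (Nat.succ_ne_zero _) hpow a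
    rw [Finset.sum_eq_single 0 (fun i hi hi0 => by
      rw [Pin2.ofUnit_pow]
      exact hunit _ _ (hζ.pow_ne_one_of_pos_of_lt hi0 (Finset.mem_range.1 hi)))
      (fun h0 => absurd (Finset.mem_range.2 (Nat.succ_pos _)) h0), pow_zero, hd] at hd'
    have hdvd : (N : ℤ) ∣ d := ⟨d', by exact_mod_cast hd'⟩
    have hd0 : d = 0 := Int.eq_zero_of_dvd_of_natAbs_lt_natAbs hdvd (by
      rw [Int.natAbs_natCast]; exact Nat.lt_succ_self _)
    rw [hd, hd0, Int.cast_zero]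
  have hj : ∀ g : Pin2, Pin2.signC g = -1 → (2 : ℂ) ^ k * character g a = 2 ^ m * 2 := fun g hg =>
      by
    have hc : ¬ g.InCircle := fun h => by
      have : Pin2.signC g = 1 := by simp [Pin2.signC, Pin2.sign, h]
      rw [hg] at this
      norm_num at this
    have h₁ := hχ g
    rw [hg, (Pin2.not_inCircle hc).1] at h₁
    norm_num at h₁
    exact h₁.symm
  have hj4 : Pin2.j ^ 4 = 1 := by
    rw [show 4 = 2 * 2 from rfl, pow_mul, Pin2.j_sq]
    refine Pin2.toQuat_injective ?_
    rw [Pin2.toQuat_ofUnit_pow, Pin2.toQuat_one, neg_one_sq, Quaternion.coeComplex_one]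
  obtain ⟨d, hd⟩ := exists_int_sum_character_pow four_ne_zero hj4 a
  have h₁ := hj Pin2.j Pin2.signC_j
  have h₃ := hj (Pin2.j ^ 3) (by
    rw [pow_succ, sq, Pin2.signC_mul, Pin2.signC_mul, Pin2.signC_j]; norm_num)
  -- The powers of `j` are `1`, `j`, `j² = -1` and `j³`.
  have h₂ : character (Pin2.j ^ 2) a = 0 := by
    rw [Pin2.j_sq]
    exact hunit _ _ (by norm_num)
  simp only [Finset.sum_range_succ, Finset.sum_range_zero, pow_zero, pow_one, hone, h₂] at hd
  have e : (2 : ℂ) ^ m = 2 ^ k * d := by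
    push_cast at hd
    linear_combination (-1 / 4 : ℂ) * h₁ - (1 / 4 : ℂ) * h₃ + (2 : ℂ) ^ k / 4 * hd
  have hdvd : (2 : ℤ) ^ k ∣ 2 ^ m := ⟨d, by exact_mod_cast e⟩
  exact (Nat.pow_dvd_pow_iff_le_right (le_refl 2)).1 (by exact_mod_cast hdvd)

end Pin2Characters

/-! ### The invariant `k(X)` -/

section Invariants

variable {X : Type u} [TopologicalSpace X] [MulAction Pin2 X] {x₀ : X} {t : ℕ}

theorem mem_kSet_of_zClass_pow_mem {φ : SphereFraming x₀ (Fin t → ℂ)} {k : ℕ}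
    (h : zClass ^ k ∈ fixedIdeal φ) : k ∈ kSet φ :=
  ⟨_, h, wClass_mul_zClass_pow k⟩

theorem kSet_nonempty [ContinuousSMul Pin2 X] (hX : IsSWF x₀ (2 * t))
    (φ : SphereFraming x₀ (Fin t → ℂ)) : (kSet φ).Nonempty :=
  let ⟨n, hn⟩ := exists_zClass_pow_mem hX φ
  ⟨n, mem_kSet_of_zClass_pow_mem hn⟩

theorem wClass_mul_wClass_pow_mul {x : RepRing Pin2} {k : ℕ} (hx : wClass * x = 2 ^ k * wClass)
    (n : ℕ) : wClass * (wClass ^ n * x) = 2 ^ (k + n) * wClass := by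
  rw [mul_left_comm, hx, mul_left_comm, mul_comm (wClass ^ n), wClass_mul_wClass_pow, ← mul_assoc,
    pow_add]

end Invariants

theorem mainTheorem7 {X : Type*} {X' : Type*}
    [TopologicalSpace X] [MulAction Pin2 X] [ContinuousSMul Pin2 X]
    [TopologicalSpace X'] [MulAction Pin2 X'] [ContinuousSMul Pin2 X']
    (x₀ : X) (x₀' : X') (t t' : ℕ) (htt' : t < t')
    (hX : IsSWF x₀ (2 * t)) (hX' : IsSWF x₀' (2 * t'))
    (φ : SphereFraming x₀ (Fin t → ℂ)) (φ' : SphereFraming x₀' (Fin t' → ℂ))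
    (f : GMap Pin2 X X') (hf : f.IsHomotopyEquivOnFixedPoints) :
    (kSet φ).Nonempty ∧ (kSet φ').Nonempty ∧
      kInvariant φ + t ≤ kInvariant φ' + t' ∧
      (IsKGSplit φ → kInvariant φ + t + 1 ≤ kInvariant φ' + t') := by
  have := hX.hausdorff
  have : CompactSpace (CircleFixed X) := by
    obtain ⟨S⟩ := hX.cellular
    have := S.compactSpace
    exact CircleFixed.compactSpace
  obtain ⟨n, rfl⟩ : ∃ n, t' = t + (n + 1) := ⟨t' - t - 1, by omega⟩
  have hk' := kSet_nonempty hX' φ'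
  obtain ⟨x, hx, hwx⟩ : kInvariant φ' ∈ kSet φ' := Nat.sInf_mem hk'
  have hmem := wClass_pow_mul_mem_fixedIdeal n.succ_pos φ φ' hf hx
  refine ⟨kSet_nonempty hX φ, hk', ?_, ?_⟩
  · have : kInvariant φ ≤ kInvariant φ' + (n + 1) :=
      Nat.sInf_le ⟨_, hmem, wClass_mul_wClass_pow_mul hwx (n + 1)⟩
    omega
  · rintro ⟨k, hk⟩
    have h₁ : kInvariant φ ≤ k := Nat.sInf_le (mem_kSet_of_zClass_pow_mem
      (hk ▸ Ideal.mem_span_singleton_self _))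
    -- `w ^ (n + 1) x = w (w ^ n x) = 2 ^ (k(X') + n) w`, where `w x = 2 ^ k(X') w`.
    have h₂ : zClass ^ k ∣ 2 ^ (kInvariant φ' + n) * wClass := by
      rw [← wClass_mul_wClass_pow_mul hwx n, ← mul_assoc, ← pow_succ']
      exact Ideal.mem_span_singleton.1 (hk ▸ hmem)
    have h₃ := le_of_zClass_pow_dvd h₂
    omega
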